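/- Let $\mathbb T\subset\mathbb C$ be the unit circle with normalized arclength $m$, let $g^*(z)=\overline{g(1/\bar z)}$, and for a complex measure $\mu$ on $\mathbb T$ and polynomials $f,g$ put $\langle f,g\rangle_\mu=\int_{\mathbb T} f g^*\,d\mu$. A polynomial $\Phi$ is left (right) orthogonal if $\langle\Phi,p\rangle_\mu=0$ ($\langle p,\Phi\rangle_\mu=0$) for every polynomial $p$ with $\deg p<\deg\Phi$. Let $\mathcal T$ be the class of complex measures $\mu$ with $\mu(\mathbb T)=1$ having, for each $n\ge 0$, a unique monic left orthogonal polynomial $\Phi_n$ and a unique monic right orthogonal polynomial $\tilde\Phi_n$ of degree $n$. For $\mu\in\mathcal T$ there are unique $F_{n+1},\tilde F_{n+1}\in\mathbb C$ ($n\ge 0$) with $$\Phi_{n+1}-z\Phi_n=\overline{F_{n+1}}\,z^n\tilde\Phi_n^*,\qquad \tilde\Phi_{n+1}-z\tilde\Phi_n=\overline{\tilde F_{n+1}}\,z^n\Phi_n^*,$$ and $\mathcal T_-$ is the class of $\mu\in\mathcal T$ with $F_n=-\tilde F_n$ for all $n\ge1$. For $\mu\in\mathcal T_-$ one has $\langle\Phi_n,\tilde\Phi_n\rangle_\mu>0$;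 put $\phi_n=\Phi_n/\sqrt{\langle\Phi_n,\tilde\Phi_n\rangle_\mu}$, $\tilde\phi_n=\tilde\Phi_n/\sqrt{\langle\Phi_n,\tilde\Phi_n\rangle_\mu}$ and, with $\gamma_n=e^{i\pi/n}$, $$A_{n,s}=\frac{\phi_n(s)-\phi_n(s\gamma_n)}{2s^n},\qquad B_{n,s}=\frac{\phi_n(s)+\phi_n(s\gamma_n)}{2}.$$ Let $w$ be (a representative of) the density of the absolutely continuous part of $\mu$ with respect to $m$, and let $E(\mu)$ be the set of $s\in\mathbb T$ that are not in the closed support of the singular part of $\mu$ and are Lebesgue points of $w$. **Theorem.** Let $\mu\in\mathcal T_-$. (1) If $s\in E(\mu)$ and $(n_k)$ is a strictly increasing sequence of nonnegative integers with $\lim_{k\to\infty}A_{n_k,s}B_{n_k,s}=0$, then $\lim_{k\to\infty}\big(\phi_{n_k}^*(s)\tilde\phi_{n_k}(s)\big)^2=\overline{w(s)^{-2}}$. (2) Assume that $\lim_{n\to\infty}|F_n|=0$ and $\lim_{n\to\infty}\int_{\mathbb T}\big|\phi_n^*\tilde\phi_n-1/\overline{w}\big|\,dm=0$. Then there is a set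 $E_0(\mu)\subset E(\mu)$ with $m(\mathbb T\setminus E_0(\mu))=0$ such that for every $s\in E_0(\mu)$: if $\lim_{n\to\infty}\big(\phi_n^*(s)\tilde\phi_n(s)\big)^2=\overline{w(s)^{-2}}$, then both $\lim_{n\to\infty}\phi_n^*(s)\tilde\phi_n(s)=\overline{w(s)^{-1}}$ and $\lim_{n\to\infty}A_{n,s}B_{n,s}=0$. -/

import Mathlib

open MeasureTheory Filter Topology Polynomial ComplexConjugate

noncomputable section

namespace OneSidedOP

/-- The unit circle, parametrised by the angle `θ ∈ ℝ/2πℤ`. -/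
abbrev Torus : Type := AddCircle (2 * Real.pi)

instance : Fact (0 < 2 * Real.pi) := ⟨Real.two_pi_pos⟩

/-- The point `e^{iθ}` of the unit circle in `ℂ` with angle `θ`. -/
def pt (θ : Torus) : ℂ := (AddCircle.toCircle θ : ℂ)

/-- Normalized arclength on the unit circle (total mass one). -/
abbrev arc : Measure Torus := AddCircle.haarAddCircle

/-- The operation `g^*(z) = conj (g (1 / conj z))`. -/
def starFn (g : ℂ → ℂ) (z : ℂ) : ℂ := conj (g (conj z)⁻¹)

/-- The pairing `⟨f, g⟩_μ = ∫ f g^* dμ` of two polynomials. -/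
def pairing (μ : ComplexMeasure Torus) (f g : ℂ[X]) : ℂ :=
  VectorMeasure.integral μ
    (fun θ => f.eval (pt θ) * starFn (fun z => g.eval z) (pt θ)) (ContinuousLinearMap.mul ℝ ℂ)

/-- `Φ` is a left orthogonal polynomial. -/
def IsLeftOrthogonal (μ : ComplexMeasure Torus) (Φ : ℂ[X]) : Prop :=
  ∀ p : ℂ[X], p.degree < Φ.degree → pairing μ Φ p = 0

/-- `Φ` is a right orthogonal polynomial. -/
def IsRightOrthogonal (μ : ComplexMeasure Torus) (Φ : ℂ[X]) : Prop :=
  ∀ p : ℂ[X], p.degree < Φ.degree → pairing μ p Φ = 0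

/-- `Φ` is a monic left orthogonal polynomial of degree `n`. -/
def IsMonicLeft (μ : ComplexMeasure Torus) (n : ℕ) (Φ : ℂ[X]) : Prop :=
  Φ.Monic ∧ Φ.natDegree = n ∧ IsLeftOrthogonal μ Φ

/-- `Φ` is a monic right orthogonal polynomial of degree `n`. -/
def IsMonicRight (μ : ComplexMeasure Torus) (n : ℕ) (Φ : ℂ[X]) : Prop :=
  Φ.Monic ∧ Φ.natDegree = n ∧ IsRightOrthogonal μ Φ

/-- The class `𝒯`: complex measures of total integral one which have, in every degree, exactly one
monic left orthogonal and exactly one monic right orthogonal polynomial. -/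
def ClassT (μ : ComplexMeasure Torus) : Prop :=
  μ Set.univ = 1 ∧ ∀ n : ℕ, (∃! Φ : ℂ[X], IsMonicLeft μ n Φ) ∧ (∃! Φ : ℂ[X], IsMonicRight μ n Φ)

/-- The monic left orthogonal polynomial `Φ_n` (used for `μ ∈ 𝒯`). -/
def Phi (μ : ComplexMeasure Torus) (n : ℕ) : ℂ[X] := Classical.epsilon (IsMonicLeft μ n)

/-- The monic right orthogonal polynomial `Φ̃_n` (used for `μ ∈ 𝒯`). -/
def PhiT (μ : ComplexMeasure Torus) (n : ℕ) : ℂ[X] := Classical.epsilon (IsMonicRight μ n)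

/-- The recurrence `Φ_{n+1} - z Φ_n = conj c · z^n Φ̃_n^*`. -/
def LeftRecurrence (μ : ComplexMeasure Torus) (n : ℕ) (c : ℂ) : Prop :=
  ∀ z : ℂ, z ≠ 0 → (Phi μ (n + 1)).eval z - z * (Phi μ n).eval z =
    conj c * z ^ n * starFn (fun y => (PhiT μ n).eval y) z

/-- The recurrence `Φ̃_{n+1} - z Φ̃_n = conj c · z^n Φ_n^*`. -/
def RightRecurrence (μ : ComplexMeasure Torus) (n : ℕ) (c : ℂ) : Prop :=
  ∀ z : ℂ, z ≠ 0 → (PhiT μ (n + 1)).eval z - z * (PhiT μ n).eval z =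
    conj c * z ^ n * starFn (fun y => (Phi μ n).eval y) z

/-- The coefficient `F_n`, for `n ≥ 1`, in the left recurrence; `F_0` is not used and set to 0.
For `μ ∈ 𝒯` the coefficient exists and is unique. -/
def coeffF (μ : ComplexMeasure Torus) : ℕ → ℂ
  | 0 => 0
  | n + 1 => Classical.epsilon (LeftRecurrence μ n)

/-- The coefficient `F̃_n`, for `n ≥ 1`, in the right recurrence; `F̃_0` is not used and set to 0.
For `μ ∈ 𝒯` the coefficient exists and is unique. -/
def coeffFT (μ : ComplexMeasure Torus) : ℕ → ℂ
  | 0 => 0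
  | n + 1 => Classical.epsilon (RightRecurrence μ n)

/-- The class `𝒯₋`: those `μ ∈ 𝒯` with `F_n = -F̃_n` for all `n ≥ 1`. -/
def ClassTMinus (μ : ComplexMeasure Torus) : Prop :=
  ClassT μ ∧ ∀ n : ℕ, 1 ≤ n → coeffF μ n = -coeffFT μ n

/-- The normalizing factor `√⟨Φ_n, Φ̃_n⟩_μ`; for `μ ∈ 𝒯₋` the pairing is a positive real. -/
def normFactor (μ : ComplexMeasure Torus) (n : ℕ) : ℝ :=
  Real.sqrt (pairing μ (Phi μ n) (PhiT μ n)).re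

/-- The normalized left orthogonal polynomial `φ_n`, as a function on `ℂ`. -/
def phi (μ : ComplexMeasure Torus) (n : ℕ) (z : ℂ) : ℂ :=
  (Phi μ n).eval z / (normFactor μ n : ℂ)

/-- The normalized right orthogonal polynomial `φ̃_n`, as a function on `ℂ`. -/
def phiT (μ : ComplexMeasure Torus) (n : ℕ) (z : ℂ) : ℂ :=
  (PhiT μ n).eval z / (normFactor μ n : ℂ)

/-- The function `φ_n^* φ̃_n` on the circle. -/
def phiProd (μ : ComplexMeasure Torus) (n : ℕ) (s : Torus) : ℂ :=
  starFn (phi μ n) (pt s) * phiT μ n (pt s)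

/-- `γ_n = e^{iπ/n}`. -/
def gam (n : ℕ) : ℂ := Complex.exp (Complex.I * Real.pi / n)

/-- The local parameter `A_{n,s}`. -/
def paramA (μ : ComplexMeasure Torus) (n : ℕ) (s : Torus) : ℂ :=
  (phi μ n (pt s) - phi μ n (pt s * gam n)) / (2 * pt s ^ n)

/-- The local parameter `B_{n,s}`. -/
def paramB (μ : ComplexMeasure Torus) (n : ℕ) (s : Torus) : ℂ :=
  (phi μ n (pt s) + phi μ n (pt s * gam n)) / 2

/-- The set `E(μ)`, for a representative `w` of the density of `μ` with respect to normalized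
arclength: points outside the (closed) support of the singular part of `μ` that are Lebesgue points
of `w`. -/
def setE (μ : ComplexMeasure Torus) (w : Torus → ℂ) : Set Torus :=
  {s | s ∉ (μ.singularPart arc).variation.support ∧
    Tendsto (fun r : ℝ => ⨍ x in Metric.closedBall s r, ‖w x - w s‖ ∂arc) (𝓝[>] 0) (𝓝 0)}

end OneSidedOP

end

/-!
The normalized polynomials `φ_n`, `φ̃_n` are studied on the circle at the scale `1/n`. For a measure
in `𝒯₋` one step of the recurrence acts on the vector `(φ_n, conj φ̃_n)` by a unitary matrix, so `|φ_n|² + |φ̃_n|² = 2` on the circle (`OPSystem.norm_sq_add_norm_sq`). This uniform bound,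
together with orthogonality and the Christoffel–Darboux formula, is all that the local analysis
needs; it is recorded in the structure `OPSystem`.

Near a point `s` of `E(μ)`, kernels of height `n` and width `1/n` with quadratic tails see `μ` as
`w(s)` times arclength (`tendsto_cint_sub_mul_integral`). Applied to the reproducing kernel at `s`
times the Dirichlet kernel at `s γ_n`, this gives
`w(s) (φ_n(s) conj φ̃_n(s γ_n) + φ_n(s γ_n) conj φ̃_n(s)) → -2`, and in particular `w(s) ≠ 0`
(`OPSystem.tendsto_density_mul`, `OPSystem.density_ne_zero`). Applied to `φ_n` times a polynomial
of degree less than `n` which represents an interpolation error, it gives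
`φ_n(s e^{ix/n}) ≈ A e^{ix} + B` for `|x| ≤ π`, where `A` and `B` are determined by the values of
`φ_n` at `s` and `s γ_n` (`OPSystem.tendsto_left_interp`). Any limits `A, B, Ã, B̃` of these
parameters for `φ_n` and `φ̃_n` then satisfy `A conj B + Ã conj B̃ = 0`,
`|A|² + |B|² + |Ã|² + |B̃|² = 2` and `A conj Ã - B conj B̃ = 1 / w(s)` (`LimitRelations`). If
`A B = 0`, the relations force `(A + B) conj (Ã + B̃) = ± 1 / w(s)`
(`LimitRelations.sq_eq_of_mul_eq_zero`), and compactness gives the first part.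

For the second part, suppose that `(φ_n^* φ̃_n)(s)²` converges to the square of `1 / conj w(s)`.
Since `F_n → 0`, the numbers `(φ_n^* φ̃_n)(s)` vary slowly with `n`, so they converge to
`1 / conj w(s)` as soon as some subsequence does. Once they do, the relations leave only two
possible limits for `|A_{n,s} B_{n,s}|`, zero and a number determined by `w(s)`
(`LimitRelations.norm_mul_eq`). This modulus also varies slowly, so it tends to zero as soon as it
does so along a subsequence, and it does so along any subsequence on which `φ_n^* φ̃_n` tends to
`1 / conj w(s)` both at `s` and at `s γ_n` (`LimitRelations.mul_eq_zero_of_eq`,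
`OPSystem.tendsto_of_tendsto_sq`). For almost every `s` such a subsequence is supplied by
convergence in `L¹` and continuity of translations in `L¹` (`exists_seq_tendsto_ae_nearPt`).

It remains to see that almost every point lies in `E(μ)`, for which the singular part must vanish.
When `F_n → 0`, the measures `|φ_n|² dμ` have asymptotically no moments of positive order and
`|φ̃_n|² dμ` none of negative order. As in the theorem of F. and M. Riesz, peak functions
(`exists_peak`) show that neither charges a compact null set in the limit, while their sum is
`2 dμ` (`OPSystem.singularPart_eq_zero`).
-/

noncomputable section

namespace OneSidedOP

/-! ### Integration against a complex measure -/

section ComplexIntegral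

variable {X : Type*} [MeasurableSpace X]

instance isFiniteMeasure_variation (μ : ComplexMeasure X) : IsFiniteMeasure μ.variation := by
  have key : μ.variation ≤
      (ComplexMeasure.re μ).totalVariation + (ComplexMeasure.im μ).totalVariation := by
    refine VectorMeasure.variation_le_of_forall_enorm_le fun E _ => ?_
    calc ‖μ E‖ₑ ≤ ‖(μ E).re‖ₑ + ‖(μ E).im‖ₑ := by
          have h : ‖μ E‖ ≤ ‖(μ E).re‖ + ‖(μ E).im‖ := by
            simpa using Complex.norm_le_abs_re_add_abs_im (μ E)
          rw [← ofReal_norm, ← ofReal_norm, ← ofReal_norm,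
            ← ENNReal.ofReal_add (norm_nonneg _) (norm_nonneg _)]
          exact ENNReal.ofReal_le_ofReal h
      _ ≤ _ := by
          rw [Measure.add_apply]
          exact add_le_add (SignedMeasure.enorm_le_totalVariation _ E)
            (SignedMeasure.enorm_le_totalVariation _ E)
  exact isFiniteMeasure_of_le _ key

/-- The integral `∫ f dμ` of a complex function against a complex measure. -/
def cint (μ : ComplexMeasure X) (f : X → ℂ) : ℂ :=
  VectorMeasure.integral μ f (ContinuousLinearMap.mul ℝ ℂ)

variable {μ : ComplexMeasure X} {f g : X → ℂ}

theorem cint_add (hf : Integrable f μ.variation) (hg : Integrable g μ.variation) :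
    cint μ (fun x => f x + g x) = cint μ f + cint μ g :=
  VectorMeasure.integral_fun_add hf hg

theorem cint_sub (hf : Integrable f μ.variation) (hg : Integrable g μ.variation) :
    cint μ (fun x => f x - g x) = cint μ f - cint μ g :=
  VectorMeasure.integral_fun_sub hf hg

theorem cint_const_mul (hf : Integrable f μ.variation) (c : ℂ) :
    cint μ (fun x => c * f x) = c * cint μ f := by
  have h1 := VectorMeasure.integral_continuousLinearMap_comp (μ := μ)
    (B := ContinuousLinearMap.mul ℝ ℂ) (C := ContinuousLinearMap.mul ℝ ℂ c) hf
  have h2 := VectorMeasure.continuousLinearMap_apply_integral (μ := μ)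
    (B := ContinuousLinearMap.mul ℝ ℂ) (C := ContinuousLinearMap.mul ℝ ℂ c) hf
  simp only [ContinuousLinearMap.mul_apply'] at h1 h2
  unfold cint
  rw [h1, h2]
  congr 1
  ext; simp [mul_assoc]

theorem norm_cint_le : ‖cint μ f‖ ≤ ∫ x, ‖f x‖ ∂μ.variation := by
  have := VectorMeasure.norm_integral_le_integral_norm (μ := μ) (f := f)
    (B := ContinuousLinearMap.mul ℝ ℂ)
  rwa [ContinuousLinearMap.opNorm_mul, one_mul] at this

theorem norm_cint_le_of_norm_le {C : ℝ} (h : ∀ x, ‖f x‖ ≤ C) :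
    ‖cint μ f‖ ≤ C * μ.variation.real Set.univ := by
  have := VectorMeasure.norm_integral_le_of_norm_le_const (μ := μ) (f := f)
    (B := ContinuousLinearMap.mul ℝ ℂ) (Eventually.of_forall h)
  rwa [ContinuousLinearMap.opNorm_mul, mul_one] at this

theorem tendsto_cint {F : ℕ → X → ℂ} {f : X → ℂ} (hF : ∀ n, Measurable (F n)) (C : ℝ)
    (hC : ∀ n x, ‖F n x‖ ≤ C) (h : ∀ x, Tendsto (fun n => F n x) atTop (𝓝 (f x))) :
    Tendsto (fun n => cint μ (F n)) atTop (𝓝 (cint μ f)) :=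
  VectorMeasure.tendsto_integral_of_dominated_convergence (fun _ => C)
    (fun n => (hF n).aestronglyMeasurable) (integrable_const C)
    (fun n => Eventually.of_forall (hC n)) (Eventually.of_forall h)

theorem cint_indicator_const {s : Set X} (hs : MeasurableSet s) (c : ℂ) :
    cint μ (s.indicator fun _ => c) = c * μ s := by
  have h := VectorMeasure.integral_indicator_const (μ := μ) (B := ContinuousLinearMap.mul ℝ ℂ) c hs
  simpa [cint] using h

theorem integrable_of_measurable_of_norm_le {ν : Measure X} [IsFiniteMeasure ν]
    (hf : Measurable f) {C : ℝ} (h : ∀ x, ‖f x‖ ≤ C) : Integrable f ν :=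
  Integrable.of_bound hf.aestronglyMeasurable C (Eventually.of_forall h)

/-- Against a measure with an integrable density `w`, the integral is the Bochner integral of
`f w`. -/
theorem cint_withDensity {m : Measure X} {w : X → ℂ} (hw : Integrable w m)
    (hf : Measurable f) {C : ℝ} (hC : ∀ x, ‖f x‖ ≤ C) :
    cint (m.withDensityᵥ w) f = ∫ x, f x * w x ∂m := by
  have simple : ∀ φ : SimpleFunc X ℂ, cint (m.withDensityᵥ w) φ = ∫ x, φ x * w x ∂m := by
    intro φ
    induction φ using SimpleFunc.induction with
    | const c hs =>
      rename_i s
      have e : (SimpleFunc.piecewise s hs (SimpleFunc.const X c) (SimpleFunc.const X 0) : X → ℂ)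
          = s.indicator fun _ => c := by
        ext x
        by_cases hx : x ∈ s <;> simp [hx]
      rw [e, cint_indicator_const hs, withDensityᵥ_apply hw hs, ← integral_indicator hs,
        ← integral_const_mul]
      congr 1
      ext x
      by_cases hx : x ∈ s <;> simp [hx]
    | add _ hf hg =>
      rename_i f g _
      have hb : ∀ h : SimpleFunc X ℂ, Integrable (fun x => h x * w x) m := by
        intro h
        obtain ⟨D, hD⟩ := h.exists_forall_norm_le
        exact hw.bdd_mul h.measurable.aestronglyMeasurable (Eventually.of_forall hD)
      have hi : ∀ h : SimpleFunc X ℂ, Integrable h (m.withDensityᵥ w).variation := by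
        intro h
        obtain ⟨D, hD⟩ := h.exists_forall_norm_le
        exact integrable_of_measurable_of_norm_le h.measurable hD
      have := cint_add (hi f) (hi g)
      simp only [SimpleFunc.coe_add, Pi.add_apply, add_mul]
      rw [integral_add (hb f) (hb g), ← hf, ← hg, ← this]
      rfl
  have hsm := hf.stronglyMeasurable
  have hbound : ∀ n x, ‖hsm.approxBounded C n x‖ ≤ C ⊔ 0 := fun n x =>
    (hsm.norm_approxBounded_le (le_max_right C 0 |> fun _ => by
      rcases isEmpty_or_nonempty X with h | ⟨⟨y⟩⟩
      · exact (h.false x).elim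
      · exact (norm_nonneg _).trans (hC y)) n x).trans (le_max_left _ _)
  have hlim : ∀ x, Tendsto (fun n => hsm.approxBounded C n x) atTop (𝓝 (f x)) := fun x =>
    hsm.tendsto_approxBounded_of_norm_le (hC x)
  have h1 := tendsto_cint (μ := m.withDensityᵥ w)
    (fun n => (hsm.approxBounded C n).measurable) (C ⊔ 0) hbound hlim
  have h2 : Tendsto (fun n => ∫ x, hsm.approxBounded C n x * w x ∂m) atTop
      (𝓝 (∫ x, f x * w x ∂m)) := by
    refine tendsto_integral_of_dominated_convergence (fun x => (C ⊔ 0) * ‖w x‖)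
      (fun n => ((hsm.approxBounded C n).measurable.aestronglyMeasurable.mul
        hw.aestronglyMeasurable)) (hw.norm.const_mul _) (fun n => ?_) ?_
    · refine Eventually.of_forall fun x => ?_
      rw [norm_mul]
      exact mul_le_mul_of_nonneg_right (hbound n x) (norm_nonneg _)
    · exact Eventually.of_forall fun x => (hlim x).mul_const _
  simp only [simple] at h1
  exact tendsto_nhds_unique h1 h2

/-- Lebesgue decomposition at the level of integrals. -/
theorem cint_eq_singularPart_add (μ : ComplexMeasure X) (m : Measure X) [SigmaFinite m]
    {w : X → ℂ} (hw : w =ᵐ[m] μ.rnDeriv m) (hf : Measurable f) {C : ℝ} (hC : ∀ x, ‖f x‖ ≤ C) :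
    cint μ f = cint (μ.singularPart m) f + ∫ x, f x * w x ∂m := by
  have hdec : μ.HaveLebesgueDecomposition m := ⟨inferInstance, inferInstance⟩
  have hint := ComplexMeasure.integrable_rnDeriv μ m
  have h1 : ∫ x, f x * w x ∂m = cint (m.withDensityᵥ (μ.rnDeriv m)) f := by
    rw [cint_withDensity hint hf hC]
    refine integral_congr_ae ?_
    filter_upwards [hw] with x hx
    rw [hx]
  rw [h1]
  conv_lhs => rw [← ComplexMeasure.singularPart_add_withDensity_rnDeriv_eq (c := μ) (μ := m)]
  exact VectorMeasure.integral_add_vectorMeasure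
    (integrable_of_measurable_of_norm_le hf hC) (integrable_of_measurable_of_norm_le hf hC)

/-- The singular part is carried by a null set. -/
theorem exists_null_carrier_singularPart (μ : ComplexMeasure X) (m : Measure X) [SigmaFinite m] :
    ∃ S : Set X, MeasurableSet S ∧ m S = 0 ∧
      ∀ B, MeasurableSet B → Disjoint B S → μ.singularPart m B = 0 := by
  obtain ⟨s, hs, hs0, hs1⟩ :=
    SignedMeasure.mutuallySingular_singularPart (ComplexMeasure.re μ) m
  obtain ⟨t, ht, ht0, ht1⟩ :=
    SignedMeasure.mutuallySingular_singularPart (ComplexMeasure.im μ) m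
  have e1 : ∀ {s : Set X}, MeasurableSet s → (∀ u ⊆ s, m.toENNRealVectorMeasure u = 0) →
      m s = 0 := by
    intro s hs h
    have := h s subset_rfl
    rwa [Measure.toENNRealVectorMeasure_apply_measurable hs] at this
  refine ⟨sᶜ ∪ tᶜ, hs.compl.union ht.compl,
    measure_union_null (e1 hs.compl hs1) (e1 ht.compl ht1), fun B _ hB => ?_⟩
  rw [Set.disjoint_union_right, Set.disjoint_compl_right_iff_subset,
    Set.disjoint_compl_right_iff_subset] at hB
  rw [ComplexMeasure.singularPart, SignedMeasure.toComplexMeasure_apply, hs0 B hB.1, ht0 B hB.2]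
  rfl

end ComplexIntegral

/-! ### The pairing of polynomials and the recurrence -/

theorem norm_pt (θ : Torus) : ‖pt θ‖ = 1 := Circle.norm_coe _

theorem pt_ne_zero (θ : Torus) : pt θ ≠ 0 := Circle.coe_ne_zero _

theorem continuous_pt : Continuous pt :=
  continuous_subtype_val.comp AddCircle.continuous_toCircle

theorem pt_mul_conj (θ : Torus) : pt θ * conj (pt θ) = 1 := by
  rw [Complex.mul_conj, Complex.normSq_eq_norm_sq, norm_pt]; simp

theorem conj_pt_mul (θ : Torus) : conj (pt θ) * pt θ = 1 := by
  rw [mul_comm, pt_mul_conj]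

theorem conj_pt (θ : Torus) : conj (pt θ) = (pt θ)⁻¹ :=
  eq_inv_of_mul_eq_one_left (conj_pt_mul θ)

theorem starFn_pt (g : ℂ → ℂ) (θ : Torus) : starFn g (pt θ) = conj (g (pt θ)) := by
  rw [starFn, conj_pt, inv_inv]

/-- The restriction of a polynomial to the circle. -/
def onCircle (p : ℂ[X]) (θ : Torus) : ℂ := p.eval (pt θ)

theorem continuous_onCircle (p : ℂ[X]) : Continuous (onCircle p) :=
  p.continuous.comp continuous_pt

theorem integrable_of_continuous {ν : Measure Torus} [IsFiniteMeasure ν] {f : Torus → ℂ}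
    (hf : Continuous f) : Integrable f ν :=
  hf.integrable_of_hasCompactSupport (HasCompactSupport.of_compactSpace f)

theorem pairing_eq (μ : ComplexMeasure Torus) (f g : ℂ[X]) :
    pairing μ f g = cint μ (fun θ => onCircle f θ * conj (onCircle g θ)) := by
  simp only [pairing, cint, starFn_pt, onCircle]

theorem continuous_onCircle_mul_conj (f g : ℂ[X]) :
    Continuous fun θ => onCircle f θ * conj (onCircle g θ) :=
  (continuous_onCircle f).mul (Complex.continuous_conj.comp (continuous_onCircle g))

/-- The reversed polynomial `z^n p^*`. -/
def revPoly (n : ℕ) (p : ℂ[X]) : ℂ[X] := (p.map (starRingEnd ℂ)).reflect n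

theorem eval_revPoly {n : ℕ} {p : ℂ[X]} (hp : p.natDegree ≤ n) {z : ℂ} (hz : z ≠ 0) :
    (revPoly n p).eval z = z ^ n * starFn (fun y => p.eval y) z := by
  let _ : Invertible z⁻¹ := invertibleOfNonzero (inv_ne_zero hz)
  have h := eval₂_reflect_mul_pow (RingHom.id ℂ) z⁻¹ n (p.map (starRingEnd ℂ))
    (natDegree_map_le.trans hp)
  have e : ⅟(z⁻¹) = z := by simp
  rw [e, eval₂_id, eval₂_id] at h
  have h2 : starFn (fun y => p.eval y) z = (p.map (starRingEnd ℂ)).eval z⁻¹ := by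
    have : (z⁻¹ : ℂ) = conj ((conj z)⁻¹) := by simp
    rw [starFn, this, eval_map, eval₂_hom]
  rw [h2, ← h, revPoly, mul_left_comm, ← mul_pow, mul_inv_cancel₀ hz, one_pow, mul_one]

theorem natDegree_revPoly_le {n : ℕ} {p : ℂ[X]} (hp : p.natDegree ≤ n) :
    (revPoly n p).natDegree ≤ n := by
  rw [revPoly]
  refine (natDegree_reflect_le (p := p.map (starRingEnd ℂ)) (N := n)).trans ?_
  exact max_le le_rfl (natDegree_map_le.trans hp)

theorem onCircle_revPoly {n : ℕ} {p : ℂ[X]} (hp : p.natDegree ≤ n) (θ : Torus) :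
    onCircle (revPoly n p) θ = pt θ ^ n * conj (onCircle p θ) := by
  rw [onCircle, eval_revPoly hp (pt_ne_zero θ), starFn_pt, onCircle]

theorem revPoly_revPoly (n : ℕ) (p : ℂ[X]) : revPoly n (revPoly n p) = p := by
  rw [revPoly, revPoly, reflect_map, reflect_reflect, Polynomial.map_map]
  have : (starRingEnd ℂ).comp (starRingEnd ℂ) = RingHom.id ℂ := by ext; simp
  rw [this, Polynomial.map_id]

theorem revPoly_C_mul (n : ℕ) (c : ℂ) (p : ℂ[X]) :
    revPoly n (C c * p) = C (conj c) * revPoly n p := by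
  rw [revPoly, Polynomial.map_mul, map_C, reflect_C_mul, revPoly]

theorem revPoly_X_pow {n k : ℕ} (h : k ≤ n) : revPoly n (X ^ k) = X ^ (n - k) := by
  rw [revPoly, Polynomial.map_pow, map_X, reflect_monomial, revAt_le h]

/-- The algebraic properties shared by the pairing `⟨f, g⟩_μ` and its adjoint
`conj ⟨g, f⟩_μ`: sesquilinearity, invariance under multiplication by `z`, and the symmetry
`⟨p, z^n q^*⟩ = ⟨q, z^n p^*⟩`. Working with an abstract form gives left and right statements from
one proof. -/
structure IsToeplitzForm (B : ℂ[X] → ℂ[X] → ℂ) : Prop where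
  add_left : ∀ f g h, B (f + g) h = B f h + B g h
  C_mul_left : ∀ c f h, B (C c * f) h = c * B f h
  add_right : ∀ f g h, B f (g + h) = B f g + B f h
  C_mul_right : ∀ c f h, B f (C c * h) = conj c * B f h
  X_mul : ∀ f g, B (X * f) (X * g) = B f g
  rev : ∀ n p q, p.natDegree ≤ n → q.natDegree ≤ n → B p (revPoly n q) = B q (revPoly n p)

theorem isToeplitzForm_pairing (μ : ComplexMeasure Torus) : IsToeplitzForm (pairing μ) where
  add_left f g h := by
    simp only [pairing_eq]
    rw [← cint_add (integrable_of_continuous (continuous_onCircle_mul_conj _ _))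
      (integrable_of_continuous (continuous_onCircle_mul_conj _ _))]
    simp [onCircle, add_mul]
  C_mul_left c f h := by
    simp only [pairing_eq]
    rw [← cint_const_mul (integrable_of_continuous (continuous_onCircle_mul_conj _ _))]
    simp [onCircle, mul_assoc]
  add_right f g h := by
    simp only [pairing_eq]
    rw [← cint_add (integrable_of_continuous (continuous_onCircle_mul_conj _ _))
      (integrable_of_continuous (continuous_onCircle_mul_conj _ _))]
    simp [onCircle, mul_add]
  C_mul_right c f h := by
    simp only [pairing_eq]
    rw [← cint_const_mul (integrable_of_continuous (continuous_onCircle_mul_conj _ _))]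
    simp [onCircle, mul_left_comm]
  X_mul f g := by
    simp only [pairing_eq]
    congr 1
    ext θ
    simp only [onCircle, eval_mul, eval_X, map_mul]
    linear_combination (f.eval (pt θ) * conj (g.eval (pt θ))) * pt_mul_conj θ
  rev n p q hp hq := by
    simp only [pairing_eq, onCircle_revPoly hp, onCircle_revPoly hq]
    congr 1
    ext θ
    simp only [map_mul, Complex.conj_conj]
    ring

namespace IsToeplitzForm

variable {B : ℂ[X] → ℂ[X] → ℂ}

/-- The adjoint form. -/
theorem adjoint (hB : IsToeplitzForm B) : IsToeplitzForm fun f g => conj (B g f) where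
  add_left f g h := by simp [hB.add_right]
  C_mul_left c f h := by simp [hB.C_mul_right]
  add_right f g h := by simp [hB.add_left]
  C_mul_right c f h := by simp [hB.C_mul_left]
  X_mul f g := by simp [hB.X_mul]
  rev n p q hp hq := by
    have h := hB.rev n (revPoly n q) (revPoly n p) (natDegree_revPoly_le hq)
      (natDegree_revPoly_le hp)
    rw [revPoly_revPoly, revPoly_revPoly] at h
    simp only [h]

theorem sub_left (hB : IsToeplitzForm B) (f g h : ℂ[X]) : B (f - g) h = B f h - B g h := by
  have := hB.add_left (f - g) g h
  rw [sub_add_cancel] at this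
  rw [this, add_sub_cancel_right]

theorem sub_right (hB : IsToeplitzForm B) (f g h : ℂ[X]) : B f (g - h) = B f g - B f h := by
  have := hB.add_right f (g - h) h
  rw [sub_add_cancel] at this
  rw [this, add_sub_cancel_right]

theorem zero_left (hB : IsToeplitzForm B) (h : ℂ[X]) : B 0 h = 0 := by
  simpa using hB.sub_left 0 0 h

theorem zero_right (hB : IsToeplitzForm B) (h : ℂ[X]) : B h 0 = 0 := by
  simpa using hB.sub_right h 0 0

theorem sum_left (hB : IsToeplitzForm B) {ι : Type*} (s : Finset ι) (f : ι → ℂ[X]) (h : ℂ[X]) :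
    B (∑ i ∈ s, f i) h = ∑ i ∈ s, B (f i) h := by
  classical
  induction s using Finset.induction_on with
  | empty => simp [hB.zero_left]
  | insert i s hi ih => rw [Finset.sum_insert hi, Finset.sum_insert hi, hB.add_left, ih]

theorem sum_right (hB : IsToeplitzForm B) {ι : Type*} (s : Finset ι) (f : ι → ℂ[X]) (h : ℂ[X]) :
    B h (∑ i ∈ s, f i) = ∑ i ∈ s, B h (f i) := by
  classical
  induction s using Finset.induction_on with
  | empty => simp [hB.zero_right]
  | insert i s hi ih => rw [Finset.sum_insert hi, Finset.sum_insert hi, hB.add_right, ih]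

/-- A polynomial of degree at most `n` orthogonal to `z, …, z^n` is a multiple of the reversal of
the right orthogonal polynomial `T` of degree `n`, provided `T` is unique. -/
theorem eq_C_mul_revPoly (hB : IsToeplitzForm B) {n : ℕ} {T Q : ℂ[X]}
    (hT : T.Monic) (hTn : T.natDegree = n) (hTo : ∀ p : ℂ[X], p.degree < n → B p T = 0)
    (huniq : ∀ T' : ℂ[X], T'.Monic → T'.natDegree = n →
      (∀ p : ℂ[X], p.degree < n → B p T' = 0) → T' = T)
    (hQ : Q.natDegree ≤ n) (hQo : ∀ j, 1 ≤ j → j ≤ n → B Q (X ^ j) = 0) :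
    ∃ c, Q = C c * revPoly n T := by
  set R := revPoly n Q with hR
  have hRo : ∀ p : ℂ[X], p.degree < n → B p R = 0 := by
    intro p hp
    rcases eq_or_ne p 0 with rfl | h0
    · exact hB.zero_left R
    rw [p.as_sum_range_C_mul_X_pow' ((natDegree_lt_iff_degree_lt h0).2 hp), hB.sum_left]
    refine Finset.sum_eq_zero fun k hk => ?_
    have hk := Finset.mem_range.1 hk
    rw [hB.C_mul_left, hR, hB.rev n _ _ (by simpa using hk.le) hQ, revPoly_X_pow hk.le,
      hQo _ (by omega) (by omega), mul_zero]
  have hRn : R.natDegree ≤ n := natDegree_revPoly_le hQ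
  set d := R.coeff n
  have hlt : (R - C d * T).degree < n := by
    rw [degree_lt_iff_coeff_zero]
    intro m hm
    rcases hm.eq_or_lt with rfl | hm
    · have : T.coeff n = 1 := by rw [← hTn]; exact hT
      simp [this, d]
    · rw [coeff_sub, coeff_C_mul, coeff_eq_zero_of_natDegree_lt (hRn.trans_lt hm),
        coeff_eq_zero_of_natDegree_lt (hTn.trans_lt hm)]
      simp
  have hTd : T.degree = n := by rw [degree_eq_natDegree hT.ne_zero, hTn]
  have hlt' : (R - C d * T).degree < T.degree := hTd ▸ hlt
  have := huniq (T + (R - C d * T)) (hT.add_of_left hlt')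
    (by rw [natDegree_add_eq_left_of_degree_lt hlt', hTn]) (fun p hp => by
      rw [hB.add_right, hB.sub_right, hB.C_mul_right, hTo p hp, hRo p hp]; simp)
  have hRT : R = C d * T := by
    rw [← sub_eq_zero]; simpa using this
  refine ⟨conj d, ?_⟩
  rw [← revPoly_C_mul, ← hRT, hR, revPoly_revPoly]

/-- The recurrence in polynomial form. -/
theorem exists_recurrence (hB : IsToeplitzForm B) {n : ℕ} {T P P' : ℂ[X]}
    (hT : T.Monic) (hTn : T.natDegree = n) (hTo : ∀ p : ℂ[X], p.degree < n → B p T = 0)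
    (huniq : ∀ T' : ℂ[X], T'.Monic → T'.natDegree = n →
      (∀ p : ℂ[X], p.degree < n → B p T' = 0) → T' = T)
    (hP : P.Monic) (hPn : P.natDegree = n) (hPo : ∀ p : ℂ[X], p.degree < n → B P p = 0)
    (hP' : P'.Monic) (hPn' : P'.natDegree = n + 1)
    (hPo' : ∀ p : ℂ[X], p.degree < (n + 1 : ℕ) → B P' p = 0) :
    ∃ c, P' - X * P = C c * revPoly n T := by
  refine hB.eq_C_mul_revPoly hT hTn hTo huniq ?_ fun j hj1 hjn => ?_
  · rw [← Nat.lt_succ_iff, Nat.succ_eq_add_one]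
    have hXP : (X * P).natDegree = n + 1 := by rw [natDegree_X_mul hP.ne_zero, hPn]
    have hlt : (P' - X * P).degree < P'.degree := by
      refine degree_sub_lt_left ?_ hP'.ne_zero ?_
      · rw [degree_eq_natDegree hP'.ne_zero, degree_eq_natDegree (monic_X.mul hP).ne_zero, hXP,
          hPn']
      · rw [hP'.leadingCoeff, (monic_X.mul hP).leadingCoeff]
    rcases eq_or_ne (P' - X * P) 0 with h0 | h0
    · rw [h0]; simp
    · rw [← hPn']; exact natDegree_lt_natDegree h0 hlt
  · obtain ⟨k, rfl⟩ := Nat.exists_eq_add_of_le' hj1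
    rw [hB.sub_left, hPo' _ (by rw [degree_X_pow]; exact_mod_cast (by omega)), pow_succ', hB.X_mul,
      hPo _ (by rw [degree_X_pow]; exact_mod_cast (by omega)), sub_zero]

end IsToeplitzForm

/-! ### The normalized system of orthogonal polynomials -/

section Monic

variable {μ : ComplexMeasure Torus}

theorem Phi_spec (hμ : ClassT μ) (n : ℕ) : IsMonicLeft μ n (Phi μ n) :=
  Classical.epsilon_spec (hμ.2 n).1.exists

theorem PhiT_spec (hμ : ClassT μ) (n : ℕ) : IsMonicRight μ n (PhiT μ n) :=
  Classical.epsilon_spec (hμ.2 n).2.exists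

theorem degree_Phi (hμ : ClassT μ) (n : ℕ) : (Phi μ n).degree = n := by
  rw [degree_eq_natDegree (Phi_spec hμ n).1.ne_zero, (Phi_spec hμ n).2.1]

theorem degree_PhiT (hμ : ClassT μ) (n : ℕ) : (PhiT μ n).degree = n := by
  rw [degree_eq_natDegree (PhiT_spec hμ n).1.ne_zero, (PhiT_spec hμ n).2.1]

theorem pairing_Phi (hμ : ClassT μ) (n : ℕ) (p : ℂ[X]) (hp : p.degree < n) :
    pairing μ (Phi μ n) p = 0 :=
  (Phi_spec hμ n).2.2 p (by rwa [degree_Phi hμ])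

theorem pairing_PhiT (hμ : ClassT μ) (n : ℕ) (p : ℂ[X]) (hp : p.degree < n) :
    pairing μ p (PhiT μ n) = 0 :=
  (PhiT_spec hμ n).2.2 p (by rwa [degree_PhiT hμ])

theorem exists_leftRecurrence (hμ : ClassT μ) (n : ℕ) : ∃ c, LeftRecurrence μ n c := by
  obtain ⟨c, hc⟩ := (isToeplitzForm_pairing μ).exists_recurrence
    (PhiT_spec hμ n).1 (PhiT_spec hμ n).2.1 (pairing_PhiT hμ n)
    (fun T' h1 h2 h3 => (hμ.2 n).2.unique ⟨h1, h2, fun p hp => h3 p (by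
      rwa [degree_eq_natDegree h1.ne_zero, h2] at hp)⟩ (PhiT_spec hμ n))
    (Phi_spec hμ n).1 (Phi_spec hμ n).2.1 (pairing_Phi hμ n)
    (Phi_spec hμ (n + 1)).1 (Phi_spec hμ (n + 1)).2.1 (pairing_Phi hμ (n + 1))
  refine ⟨conj c, fun z hz => ?_⟩
  have := congrArg (fun p => p.eval z) hc
  simp only [eval_sub, eval_mul, eval_X, eval_C,
    eval_revPoly (PhiT_spec hμ n).2.1.le hz] at this
  rw [this, Complex.conj_conj, mul_assoc]

theorem exists_rightRecurrence (hμ : ClassT μ) (n : ℕ) : ∃ c, RightRecurrence μ n c := by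
  obtain ⟨c, hc⟩ := (isToeplitzForm_pairing μ).adjoint.exists_recurrence
    (Phi_spec hμ n).1 (Phi_spec hμ n).2.1 (fun p hp => by simp [pairing_Phi hμ n p hp])
    (fun T' h1 h2 h3 => (hμ.2 n).1.unique ⟨h1, h2, fun p hp => by
      simpa using h3 p (by rwa [degree_eq_natDegree h1.ne_zero, h2] at hp)⟩ (Phi_spec hμ n))
    (PhiT_spec hμ n).1 (PhiT_spec hμ n).2.1 (fun p hp => by simp [pairing_PhiT hμ n p hp])
    (PhiT_spec hμ (n + 1)).1 (PhiT_spec hμ (n + 1)).2.1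
    (fun p hp => by simp [pairing_PhiT hμ (n + 1) p hp])
  refine ⟨conj c, fun z hz => ?_⟩
  have := congrArg (fun p => p.eval z) hc
  simp only [eval_sub, eval_mul, eval_X, eval_C,
    eval_revPoly (Phi_spec hμ n).2.1.le hz] at this
  rw [this, Complex.conj_conj, mul_assoc]

theorem eq_of_forall_eval_eq {p q : ℂ[X]} (h : ∀ z : ℂ, z ≠ 0 → p.eval z = q.eval z) : p = q := by
  refine eq_of_infinite_eval_eq p q (Set.Infinite.mono (s := {0}ᶜ) (fun z hz => h z hz) ?_)
  exact (Set.finite_singleton (0 : ℂ)).infinite_compl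

theorem Phi_succ (hμ : ClassT μ) (n : ℕ) :
    Phi μ (n + 1) = X * Phi μ n + C (conj (coeffF μ (n + 1))) * revPoly n (PhiT μ n) := by
  have h : LeftRecurrence μ n (coeffF μ (n + 1)) :=
    Classical.epsilon_spec (exists_leftRecurrence hμ n)
  refine eq_of_forall_eval_eq fun z hz => ?_
  rw [eval_add, eval_mul, eval_X, eval_mul, eval_C, eval_revPoly (PhiT_spec hμ n).2.1.le hz]
  linear_combination h z hz

theorem PhiT_succ (hμ : ClassTMinus μ) (n : ℕ) :
    PhiT μ (n + 1) = X * PhiT μ n - C (conj (coeffF μ (n + 1))) * revPoly n (Phi μ n) := by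
  have h : RightRecurrence μ n (coeffFT μ (n + 1)) :=
    Classical.epsilon_spec (exists_rightRecurrence hμ.1 n)
  have hF := hμ.2 (n + 1) (by omega)
  refine eq_of_forall_eval_eq fun z hz => ?_
  rw [eval_sub, eval_mul, eval_X, eval_mul, eval_C, eval_revPoly (Phi_spec hμ.1 n).2.1.le hz, hF,
    map_neg]
  linear_combination h z hz

theorem Phi_zero (hμ : ClassT μ) : Phi μ 0 = 1 :=
  (Phi_spec hμ 0).1.natDegree_eq_zero.1 (Phi_spec hμ 0).2.1

theorem PhiT_zero (hμ : ClassT μ) : PhiT μ 0 = 1 :=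
  (PhiT_spec hμ 0).1.natDegree_eq_zero.1 (PhiT_spec hμ 0).2.1

/-- The normalization `μ(𝕋) = 1`. -/
theorem pairing_one_one (hμ : ClassT μ) : pairing μ 1 1 = 1 := by
  have h := cint_indicator_const (μ := μ) MeasurableSet.univ 1
  rw [Set.indicator_univ, hμ.1] at h
  simpa [pairing_eq, onCircle] using h

theorem degree_lt_succ_of_natDegree_le {p : ℂ[X]} {n : ℕ} (h : p.natDegree ≤ n) :
    p.degree < (n + 1 : ℕ) :=
  (natDegree_le_iff_degree_le.1 h).trans_lt (by exact_mod_cast n.lt_succ_self)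

/-- `⟨Φ_n, Φ̃_n⟩` is multiplied by `1 + |F_{n+1}|²` at each step. -/
theorem pairing_Phi_PhiT_succ (hμ : ClassTMinus μ) (n : ℕ) :
    pairing μ (Phi μ (n + 1)) (PhiT μ (n + 1)) =
      (1 + ‖coeffF μ (n + 1)‖ ^ 2 : ℝ) * pairing μ (Phi μ n) (PhiT μ n) := by
  have hB := isToeplitzForm_pairing μ
  have hl := (Phi_spec hμ.1 n).2.1.le
  have hr := (PhiT_spec hμ.1 n).2.1.le
  have e1 : pairing μ (Phi μ (n + 1)) (PhiT μ (n + 1)) =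
      pairing μ (Phi μ (n + 1)) (X * PhiT μ n) := by
    rw [PhiT_succ hμ, hB.sub_right, hB.C_mul_right, pairing_Phi hμ.1 (n + 1) (revPoly n (Phi μ n))
      (degree_lt_succ_of_natDegree_le (natDegree_revPoly_le hl)), mul_zero, sub_zero]
  have e2 : X * PhiT μ n =
      PhiT μ (n + 1) + C (conj (coeffF μ (n + 1))) * revPoly n (Phi μ n) := by
    rw [PhiT_succ hμ]; ring
  have e3 : pairing μ (revPoly n (PhiT μ n)) (X * PhiT μ n) =
      coeffF μ (n + 1) * pairing μ (Phi μ n) (PhiT μ n) := by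
    rw [e2, hB.add_right, hB.C_mul_right, pairing_PhiT hμ.1 (n + 1) _
      (degree_lt_succ_of_natDegree_le (natDegree_revPoly_le hr)),
      hB.rev n _ _ (natDegree_revPoly_le hr) hl, revPoly_revPoly, Complex.conj_conj, zero_add]
  rw [e1, Phi_succ hμ.1, hB.add_left, hB.X_mul, hB.C_mul_left, e3, ← mul_assoc,
    Complex.conj_mul']
  push_cast
  ring

theorem exists_pos_pairing (hμ : ClassTMinus μ) (n : ℕ) :
    ∃ k : ℝ, 0 < k ∧ pairing μ (Phi μ n) (PhiT μ n) = k := by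
  induction n with
  | zero => exact ⟨1, one_pos, by rw [Phi_zero hμ.1, PhiT_zero hμ.1, pairing_one_one hμ.1]; simp⟩
  | succ n ih =>
    obtain ⟨k, hk, h⟩ := ih
    refine ⟨(1 + ‖coeffF μ (n + 1)‖ ^ 2) * k, by positivity, ?_⟩
    rw [pairing_Phi_PhiT_succ hμ, h]
    push_cast
    ring

theorem pairing_eq_normFactor_sq (hμ : ClassTMinus μ) (n : ℕ) :
    pairing μ (Phi μ n) (PhiT μ n) = (normFactor μ n : ℂ) ^ 2 := by
  obtain ⟨k, hk, h⟩ := exists_pos_pairing hμ n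
  rw [normFactor, h, Complex.ofReal_re, ← Complex.ofReal_pow, Real.sq_sqrt hk.le]

theorem normFactor_pos (hμ : ClassTMinus μ) (n : ℕ) : 0 < normFactor μ n := by
  obtain ⟨k, hk, h⟩ := exists_pos_pairing hμ n
  rw [normFactor, h, Complex.ofReal_re]
  exact Real.sqrt_pos.2 hk

theorem normFactor_zero (hμ : ClassTMinus μ) : normFactor μ 0 = 1 := by
  rw [normFactor, Phi_zero hμ.1, PhiT_zero hμ.1, pairing_one_one hμ.1]; simp

theorem normFactor_succ (hμ : ClassTMinus μ) (n : ℕ) :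
    normFactor μ (n + 1) = Real.sqrt (1 + ‖coeffF μ (n + 1)‖ ^ 2) * normFactor μ n := by
  obtain ⟨k, hk, h⟩ := exists_pos_pairing hμ n
  rw [normFactor, normFactor, pairing_Phi_PhiT_succ hμ, h, ← Complex.ofReal_mul,
    Complex.ofReal_re, Complex.ofReal_re, Real.sqrt_mul (by positivity)]

end Monic

/-- The properties of the normalized orthogonal polynomials `P n = φ_n`, `Q n = φ̃_n` of a measure
in `𝒯₋` on which the asymptotic analysis rests. The polynomials enter through their values on the
circle, where `f^* = conj f`. -/
structure OPSystem (μ : ComplexMeasure Torus) (F : ℕ → ℂ) (P Q : ℕ → ℂ[X]) : Prop where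
  degree_left : ∀ n, (P n).degree = n
  degree_right : ∀ n, (Q n).degree = n
  orth_left : ∀ (n : ℕ) (p : ℂ[X]), p.degree < n → pairing μ (P n) p = 0
  orth_right : ∀ (n : ℕ) (p : ℂ[X]), p.degree < n → pairing μ p (Q n) = 0
  pairing_self : ∀ n, pairing μ (P n) (Q n) = 1
  zero_left : ∀ θ, onCircle (P 0) θ = 1
  zero_right : ∀ θ, onCircle (Q 0) θ = 1
  rec_left : ∀ n θ, (Real.sqrt (1 + ‖F (n + 1)‖ ^ 2) : ℂ) * onCircle (P (n + 1)) θ =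
    pt θ * onCircle (P n) θ + conj (F (n + 1)) * pt θ ^ n * conj (onCircle (Q n) θ)
  rec_right : ∀ n θ, (Real.sqrt (1 + ‖F (n + 1)‖ ^ 2) : ℂ) * onCircle (Q (n + 1)) θ =
    pt θ * onCircle (Q n) θ - conj (F (n + 1)) * pt θ ^ n * conj (onCircle (P n) θ)

/-- `φ_n` as a polynomial. -/
def normPhi (μ : ComplexMeasure Torus) (n : ℕ) : ℂ[X] := C (normFactor μ n : ℂ)⁻¹ * Phi μ n

/-- `φ̃_n` as a polynomial. -/
def normPhiT (μ : ComplexMeasure Torus) (n : ℕ) : ℂ[X] := C (normFactor μ n : ℂ)⁻¹ * PhiT μ n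

theorem phi_eq (μ : ComplexMeasure Torus) (n : ℕ) (z : ℂ) : phi μ n z = (normPhi μ n).eval z := by
  simp [phi, normPhi, div_eq_inv_mul]

theorem phiT_eq (μ : ComplexMeasure Torus) (n : ℕ) (z : ℂ) :
    phiT μ n z = (normPhiT μ n).eval z := by
  simp [phiT, normPhiT, div_eq_inv_mul]

theorem opSystem {μ : ComplexMeasure Torus} (hμ : ClassTMinus μ) :
    OPSystem μ (coeffF μ) (normPhi μ) (normPhiT μ) := by
  have hB := isToeplitzForm_pairing μ
  have hN : ∀ n, (normFactor μ n : ℂ) ≠ 0 := fun n =>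
    Complex.ofReal_ne_zero.2 (normFactor_pos hμ n).ne'
  have hN' : ∀ n, (normFactor μ n : ℂ)⁻¹ ≠ 0 := fun n => inv_ne_zero (hN n)
  refine ⟨fun n => ?_, fun n => ?_, fun n p hp => ?_, fun n p hp => ?_, fun n => ?_, fun θ => ?_,
    fun θ => ?_, fun n θ => ?_, fun n θ => ?_⟩
  · rw [normPhi, degree_C_mul (hN' n), degree_Phi hμ.1]
  · rw [normPhiT, degree_C_mul (hN' n), degree_PhiT hμ.1]
  · rw [normPhi, hB.C_mul_left, pairing_Phi hμ.1 n p hp, mul_zero]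
  · rw [normPhiT, hB.C_mul_right, pairing_PhiT hμ.1 n p hp, mul_zero]
  · rw [normPhi, normPhiT, hB.C_mul_left, hB.C_mul_right, pairing_eq_normFactor_sq hμ, map_inv₀,
      Complex.conj_ofReal]
    field_simp [hN n]
  · simp [onCircle, normPhi, Phi_zero hμ.1, normFactor_zero hμ]
  · simp [onCircle, normPhiT, PhiT_zero hμ.1, normFactor_zero hμ]
  · have h := congrArg (fun p => onCircle p θ) (Phi_succ hμ.1 n)
    have hr := onCircle_revPoly (PhiT_spec hμ.1 n).2.1.le θ
    have hn := hN n
    have hs : (Real.sqrt (1 + ‖coeffF μ (n + 1)‖ ^ 2) : ℂ) ≠ 0 :=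
      Complex.ofReal_ne_zero.2 (Real.sqrt_pos.2 (by positivity)).ne'
    simp only [onCircle, eval_add, eval_mul, eval_X, eval_C] at h hr
    simp only [onCircle, normPhi, normPhiT, eval_mul, eval_C, map_mul, map_inv₀,
      Complex.conj_ofReal, normFactor_succ hμ, Complex.ofReal_mul]
    rw [h, hr]
    field_simp
  · have h := congrArg (fun p => onCircle p θ) (PhiT_succ hμ n)
    have hr := onCircle_revPoly (Phi_spec hμ.1 n).2.1.le θ
    have hn := hN n
    have hs : (Real.sqrt (1 + ‖coeffF μ (n + 1)‖ ^ 2) : ℂ) ≠ 0 :=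
      Complex.ofReal_ne_zero.2 (Real.sqrt_pos.2 (by positivity)).ne'
    simp only [onCircle, eval_sub, eval_mul, eval_X, eval_C] at h hr
    simp only [onCircle, normPhi, normPhiT, eval_mul, eval_C, map_mul, map_inv₀,
      Complex.conj_ofReal, normFactor_succ hμ, Complex.ofReal_mul]
    rw [h, hr]
    field_simp

/-- One step of the recurrence acts on `(p, conj q)` as `r⁻¹` times a matrix `[[z, b], [-b̄, z̄]]` of
determinant `r²`, hence by a unitary matrix. -/
theorem norm_sq_add_norm_sq_of_step {r : ℝ} {f z u p q p' q' : ℂ} (hr : r ^ 2 = 1 + ‖f‖ ^ 2)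
    (hz : z * conj z = 1) (hu : u * conj u = 1)
    (hp : (r : ℂ) * p' = z * p + conj f * u * conj q)
    (hq : (r : ℂ) * q' = z * q - conj f * u * conj p) :
    ‖p'‖ ^ 2 + ‖q'‖ ^ 2 = ‖p‖ ^ 2 + ‖q‖ ^ 2 := by
  have hp2 := congrArg conj hp
  have hq2 := congrArg conj hq
  simp only [map_mul, map_add, map_sub, Complex.conj_ofReal, Complex.conj_conj] at hp2 hq2
  have hr' : (r : ℂ) ^ 2 = 1 + f * conj f := by
    rw [Complex.mul_conj']; exact_mod_cast hr
  have hr0 : (r : ℂ) ^ 2 ≠ 0 := by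
    rw [← Complex.ofReal_pow, hr]
    exact Complex.ofReal_ne_zero.2 (by positivity)
  have key : p' * conj p' + q' * conj q' = p * conj p + q * conj q := by
    apply mul_left_cancel₀ hr0
    calc (r : ℂ) ^ 2 * (p' * conj p' + q' * conj q')
        = (r * p') * (r * conj p') + (r * q') * (r * conj q') := by ring
      _ = (r : ℂ) ^ 2 * (p * conj p + q * conj q) := by
        rw [hp, hq, hp2, hq2, hr']
        linear_combination (p * conj p + q * conj q) * hz +
          f * conj f * (p * conj p + q * conj q) * hu
  simp only [Complex.mul_conj'] at key
  exact_mod_cast key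

namespace OPSystem

variable {μ : ComplexMeasure Torus} {F : ℕ → ℂ} {P Q : ℕ → ℂ[X]}

theorem norm_sq_add_norm_sq (h : OPSystem μ F P Q) (n : ℕ) (θ : Torus) :
    ‖onCircle (P n) θ‖ ^ 2 + ‖onCircle (Q n) θ‖ ^ 2 = 2 := by
  induction n with
  | zero => rw [h.zero_left, h.zero_right]; norm_num
  | succ n ih =>
    rw [← ih]
    refine norm_sq_add_norm_sq_of_step (Real.sq_sqrt (by positivity)) (pt_mul_conj θ) ?_
      (h.rec_left n θ) (h.rec_right n θ)
    rw [map_pow, ← mul_pow, pt_mul_conj, one_pow]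

theorem norm_left_le (h : OPSystem μ F P Q) (n : ℕ) (θ : Torus) : ‖onCircle (P n) θ‖ ≤ 2 := by
  nlinarith [h.norm_sq_add_norm_sq n θ, sq_nonneg ‖onCircle (Q n) θ‖,
    norm_nonneg (onCircle (P n) θ)]

theorem norm_right_le (h : OPSystem μ F P Q) (n : ℕ) (θ : Torus) : ‖onCircle (Q n) θ‖ ≤ 2 := by
  nlinarith [h.norm_sq_add_norm_sq n θ, sq_nonneg ‖onCircle (P n) θ‖,
    norm_nonneg (onCircle (Q n) θ)]

theorem natDegree_left (h : OPSystem μ F P Q) (n : ℕ) : (P n).natDegree = n :=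
  natDegree_eq_of_degree_eq_some (h.degree_left n)

theorem natDegree_right (h : OPSystem μ F P Q) (n : ℕ) : (Q n).natDegree = n :=
  natDegree_eq_of_degree_eq_some (h.degree_right n)

end OPSystem

/-- A step of the normalized recurrence differs from multiplication by `z` by `O(|f|)`. -/
theorem norm_step_sub_le {r : ℝ} {f z u p q p' : ℂ} (hr0 : 0 ≤ r) (hr : r ^ 2 = 1 + ‖f‖ ^ 2)
    (hz : ‖z‖ = 1) (hu : ‖u‖ = 1) (hp : ‖p‖ ≤ 2) (hq : ‖q‖ ≤ 2)
    (h : (r : ℂ) * p' = z * p + conj f * u * conj q) : ‖p' - z * p‖ ≤ 4 * ‖f‖ := by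
  have hf := norm_nonneg f
  have hr1 : 1 ≤ r := by nlinarith
  have hr2 : r - 1 ≤ ‖f‖ := by nlinarith
  have e : (r : ℂ) * (p' - z * p) = conj f * u * conj q - ((r - 1 : ℝ) : ℂ) * (z * p) := by
    push_cast
    linear_combination h
  have h1 : r * ‖p' - z * p‖ ≤ ‖f‖ * 2 + (r - 1) * 2 := by
    calc r * ‖p' - z * p‖ = ‖(r : ℂ) * (p' - z * p)‖ := by
          rw [norm_mul, Complex.norm_real, Real.norm_of_nonneg hr0]
      _ ≤ ‖conj f * u * conj q‖ + ‖((r - 1 : ℝ) : ℂ) * (z * p)‖ := by rw [e]; exact norm_sub_le _ _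
      _ ≤ _ := by
          rw [norm_mul, norm_mul, norm_mul, norm_mul, RCLike.norm_conj, RCLike.norm_conj, hz, hu,
            Complex.norm_real, Real.norm_of_nonneg (by linarith), mul_one, one_mul]
          gcongr
  nlinarith [norm_nonneg (p' - z * p)]

namespace OPSystem

variable {μ : ComplexMeasure Torus} {F : ℕ → ℂ} {P Q : ℕ → ℂ[X]}

/-- If `F_{n+1}` is small, then `φ_{n+1}` is close to `z φ_n`. -/
theorem norm_left_succ_sub_le (h : OPSystem μ F P Q) (n : ℕ) (θ : Torus) :
    ‖onCircle (P (n + 1)) θ - pt θ * onCircle (P n) θ‖ ≤ 4 * ‖F (n + 1)‖ :=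
  norm_step_sub_le (Real.sqrt_nonneg _) (Real.sq_sqrt (by positivity)) (norm_pt θ)
    (by rw [norm_pow, norm_pt, one_pow]) (h.norm_left_le n θ) (h.norm_right_le n θ)
    (h.rec_left n θ)

/-- If `F_{n+1}` is small, then `φ̃_{n+1}` is close to `z φ̃_n`. -/
theorem norm_right_succ_sub_le (h : OPSystem μ F P Q) (n : ℕ) (θ : Torus) :
    ‖onCircle (Q (n + 1)) θ - pt θ * onCircle (Q n) θ‖ ≤ 4 * ‖F (n + 1)‖ := by
  have := norm_step_sub_le (f := -F (n + 1)) (Real.sqrt_nonneg (1 + ‖F (n + 1)‖ ^ 2))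
    (by rw [norm_neg]; exact Real.sq_sqrt (by positivity)) (norm_pt θ)
    (u := pt θ ^ n) (by rw [norm_pow, norm_pt, one_pow]) (h.norm_right_le n θ) (h.norm_left_le n θ)
    (p' := onCircle (Q (n + 1)) θ) (by rw [h.rec_right n θ, map_neg]; ring)
  rwa [norm_neg] at this

/-- The Christoffel–Darboux formula on the circle. -/
theorem christoffel_darboux (h : OPSystem μ F P Q) (n : ℕ) (α β : Torus) :
    (1 - pt α * conj (pt β)) *
        ∑ k ∈ Finset.range (n + 1), onCircle (P k) α * conj (onCircle (Q k) β) =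
      (pt α * conj (pt β)) ^ n * (conj (onCircle (Q n) α) * onCircle (P n) β) -
        pt α * conj (pt β) * (onCircle (P n) α * conj (onCircle (Q n) β)) := by
  induction n with
  | zero =>
    simp [h.zero_left, h.zero_right]
  | succ n ih =>
    rw [Finset.sum_range_succ, mul_add, ih]
    set r : ℂ := (Real.sqrt (1 + ‖F (n + 1)‖ ^ 2) : ℂ) with hr
    set f := F (n + 1)
    have hr' : r ^ 2 = 1 + f * conj f := by
      rw [hr, Complex.mul_conj', ← Complex.ofReal_pow, Real.sq_sqrt (by positivity)]
      push_cast; rfl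
    have hr0 : r ^ 2 ≠ 0 := by
      rw [hr, ← Complex.ofReal_pow, Real.sq_sqrt (by positivity)]
      exact Complex.ofReal_ne_zero.2 (by positivity)
    have h1 := h.rec_left n α
    have h2 := h.rec_left n β
    have h3 := congrArg conj (h.rec_right n α)
    have h4 := congrArg conj (h.rec_right n β)
    have hA := pt_mul_conj α
    have hB := pt_mul_conj β
    simp only [map_mul, map_sub, Complex.conj_ofReal, Complex.conj_conj, map_pow] at h3 h4
    change r * _ = _ at h1 h2 h3 h4
    generalize onCircle (P (n + 1)) α = a' at *
    generalize onCircle (P (n + 1)) β = b' at *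
    generalize conj (onCircle (Q (n + 1)) α) = c' at *
    generalize conj (onCircle (Q (n + 1)) β) = d' at *
    generalize onCircle (P n) α = a at *
    generalize onCircle (P n) β = b at *
    generalize conj (onCircle (Q n) α) = c at *
    generalize conj (onCircle (Q n) β) = d at *
    generalize pt α = x at *
    generalize pt β = y at *
    generalize conj x = x' at *
    generalize conj y = y' at *
    generalize conj f = g at *
    have hA2 : x ^ n * x' ^ n = 1 := by rw [← mul_pow, hA, one_pow]
    have hB2 : y ^ n * y' ^ n = 1 := by rw [← mul_pow, hB, one_pow]
    apply mul_left_cancel₀ hr0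
    have e : ∀ p q : ℂ, r ^ 2 * (p * q) = (r * p) * (r * q) := fun p q => by ring
    suffices H : r ^ 2 * ((x * y') ^ (n + 1) * (c' * b') - a' * d') =
        r ^ 2 * ((x * y') ^ n * (c * b) - x * y' * (a * d)) by linear_combination -H
    have H1 : r ^ 2 * ((x * y') ^ (n + 1) * (c' * b') - a' * d') =
        (x * y') ^ (n + 1) * ((r * c') * (r * b')) - (r * a') * (r * d') := by ring
    rw [H1, h1, h2, h3, h4, hr']
    simp only [mul_pow, pow_succ]
    generalize x ^ n = X at *
    generalize y ^ n = Y at *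
    generalize x' ^ n = X' at *
    generalize y' ^ n = Y' at *
    linear_combination X * Y' * c * b * (y * y' * hA + hB) +
      X * y' * g * c * d * (Y * Y' * hA + hB2) - Y' * x * f * a * b * (y * y' * hA2 + hB) -
      x * y' * f * g * a * d * (Y * Y' * hA2 + hB2)

end OPSystem

/-! ### The reproducing kernel -/

/-- The reproducing kernel `∑_{k ≤ n} conj φ_k(α) φ̃_k` of the polynomials of degree at most `n`. -/
def kernelPoly (P Q : ℕ → ℂ[X]) (n : ℕ) (α : Torus) : ℂ[X] :=
  ∑ k ∈ Finset.range (n + 1), C (conj (onCircle (P k) α)) * Q k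

theorem conj_onCircle_kernelPoly (P Q : ℕ → ℂ[X]) (n : ℕ) (α β : Torus) :
    conj (onCircle (kernelPoly P Q n α) β) =
      ∑ k ∈ Finset.range (n + 1), onCircle (P k) α * conj (onCircle (Q k) β) := by
  simp [kernelPoly, onCircle, eval_finsetSum]

namespace OPSystem

variable {μ : ComplexMeasure Torus} {F : ℕ → ℂ} {P Q : ℕ → ℂ[X]}

theorem pairing_left_right (h : OPSystem μ F P Q) (j k : ℕ) :
    pairing μ (P j) (Q k) = if j = k then 1 else 0 := by
  rcases lt_trichotomy j k with hjk | rfl | hjk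
  · rw [if_neg hjk.ne]
    exact h.orth_right k _ (by rw [h.degree_left]; exact_mod_cast hjk)
  · rw [if_pos rfl, h.pairing_self]
  · rw [if_neg hjk.ne']
    exact h.orth_left j _ (by rw [h.degree_right]; exact_mod_cast hjk)

/-- The reproducing property. -/
theorem pairing_kernelPoly (h : OPSystem μ F P Q) (n : ℕ) (α : Torus) (p : ℂ[X])
    (hp : p.natDegree ≤ n) : pairing μ p (kernelPoly P Q n α) = onCircle p α := by
  have hB := isToeplitzForm_pairing μ
  have hbasis : ∀ m ≤ n, pairing μ (P m) (kernelPoly P Q n α) = onCircle (P m) α := by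
    intro m hm
    simp only [kernelPoly, hB.sum_right, hB.C_mul_right, h.pairing_left_right, Complex.conj_conj,
      mul_ite, mul_one, mul_zero]
    rw [Finset.sum_ite_eq, if_pos (Finset.mem_range.2 (by omega))]
  have key : ∀ m ≤ n + 1, ∀ p : ℂ[X], p.degree < m →
      pairing μ p (kernelPoly P Q n α) = onCircle p α := by
    intro m
    induction m with
    | zero =>
      intro _ p hp
      have : p = 0 := by
        rw [← degree_eq_bot]; exact Nat.WithBot.lt_zero_iff.1 (by exact_mod_cast hp)
      rw [this, hB.zero_left, onCircle, eval_zero]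
    | succ m ih =>
      intro hm p hp
      set c := p.coeff m / (P m).coeff m with hc
      have hlc : (P m).coeff m ≠ 0 := by
        have := h.natDegree_left m
        nth_rewrite 2 [← this]
        rw [coeff_natDegree, leadingCoeff_ne_zero]
        intro h0
        have := h.degree_left m
        rw [h0, degree_zero] at this
        exact absurd this (by simp)
      have hlt : (p - C c * P m).degree < m := by
        rw [degree_lt_iff_coeff_zero]
        intro i hi
        rcases hi.eq_or_lt with rfl | hi
        · rw [coeff_sub, coeff_C_mul, hc, div_mul_cancel₀ _ hlc, sub_self]
        · rw [coeff_sub, coeff_C_mul,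
            coeff_eq_zero_of_degree_lt (hp.trans_le (by exact_mod_cast hi)),
            coeff_eq_zero_of_natDegree_lt ((h.natDegree_left m).trans_lt hi)]
          simp
      have h1 := ih (by omega) _ hlt
      rw [hB.sub_left, hB.C_mul_left, hbasis m (by omega)] at h1
      simp only [onCircle, eval_sub, eval_mul, eval_C] at h1 ⊢
      linear_combination h1
  exact key (n + 1) le_rfl p (degree_lt_succ_of_natDegree_le hp)

end OPSystem

/-! ### Localization at a Lebesgue point -/

theorem pt_coe (x : ℝ) : pt (x : Torus) = Complex.exp (Complex.I * x) := by
  have : 2 * Real.pi / (2 * Real.pi) * x = x := by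
    rw [div_self Real.two_pi_pos.ne', one_mul]
  rw [pt, AddCircle.toCircle_apply_mk, this, Circle.coe_exp, mul_comm]

theorem pt_add (α β : Torus) : pt (α + β) = pt α * pt β := by
  rw [pt, AddCircle.toCircle_add]; rfl

/-- A representative in `[-π, π]`. -/
theorem exists_coe_eq (θ : Torus) : ∃ x : ℝ, (x : Torus) = θ ∧ |x| = ‖θ‖ ∧ |x| ≤ Real.pi := by
  obtain ⟨y, hy, rfl⟩ := AddCircle.eq_coe_Ico θ
  have hT : (0 : ℝ) < 2 * Real.pi := Real.two_pi_pos
  have key : ∀ x : ℝ, |x| ≤ Real.pi → |x| = ‖(x : Torus)‖ := fun x hx =>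
    ((AddCircle.norm_coe_eq_abs_iff (2 * Real.pi) hT.ne').2 (by
      rw [abs_of_pos hT]; linarith)).symm
  rcases le_or_gt y Real.pi with h | h
  · have hy' : |y| ≤ Real.pi := by rwa [abs_of_nonneg hy.1]
    exact ⟨y, rfl, key y hy', hy'⟩
  · have hy' : |y - 2 * Real.pi| ≤ Real.pi := by
      rw [abs_le]; constructor <;> linarith [hy.2]
    have e : ((y - 2 * Real.pi : ℝ) : Torus) = (y : Torus) := by
      rw [AddCircle.coe_sub, AddCircle.coe_period, sub_zero]
    exact ⟨y - 2 * Real.pi, e, by rw [key _ hy', e], hy'⟩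

theorem norm_torus_le (θ : Torus) : ‖θ‖ ≤ Real.pi := by
  obtain ⟨x, _, h1, h2⟩ := exists_coe_eq θ
  rwa [← h1]

/-- A chord is at least `2/π` times its arc. -/
theorem mul_norm_sub_le_norm_pt_sub (θ s : Torus) :
    2 / Real.pi * ‖θ - s‖ ≤ ‖pt θ - pt s‖ := by
  obtain ⟨x, hx, h1, h2⟩ := exists_coe_eq (θ - s)
  have e : pt θ - pt s = pt s * (pt (x : Torus) - 1) := by
    have : θ = s + (x : Torus) := by rw [hx]; abel
    rw [mul_sub, ← pt_add, ← this, mul_one]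
  rw [e, norm_mul, norm_pt, one_mul, pt_coe, Complex.norm_exp_I_mul_ofReal_sub_one, ← h1]
  have h3 := Real.mul_le_sin (x := |x| / 2) (by positivity) (by linarith)
  have h4 : |Real.sin (x / 2)| = |Real.sin (|x| / 2)| := by
    rcases abs_cases x with ⟨h, _⟩ | ⟨h, _⟩
    · rw [h]
    · rw [h, neg_div, Real.sin_neg, abs_neg]
  rw [norm_mul, Real.norm_eq_abs, Real.norm_eq_abs, h4, abs_two]
  have := le_abs_self (Real.sin (|x| / 2))
  nlinarith

theorem norm_pt_sub_le (θ s : Torus) : ‖pt θ - pt s‖ ≤ ‖θ - s‖ := by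
  obtain ⟨x, hx, h1, h2⟩ := exists_coe_eq (θ - s)
  have e : pt θ - pt s = pt s * (pt (x : Torus) - 1) := by
    have : θ = s + (x : Torus) := by rw [hx]; abel
    rw [mul_sub, ← pt_add, ← this, mul_one]
  rw [e, norm_mul, norm_pt, one_mul, pt_coe, ← h1]
  exact Real.norm_exp_I_mul_ofReal_sub_one_le

theorem volume_eq : (volume : Measure Torus) = ENNReal.ofReal (2 * Real.pi) • arc :=
  AddCircle.volume_eq_smul_haarAddCircle

theorem ae_volume_iff {p : Torus → Prop} :
    (∀ᵐ θ ∂(volume : Measure Torus), p θ) ↔ ∀ᵐ θ ∂arc, p θ := by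
  rw [volume_eq]
  refine Measure.ae_ennreal_smul_measure_iff ?_
  simp [Real.pi_pos]

/-- An arbitrarily normalized measure gives the same averages as `arc`. -/
theorem setAverage_volume (f : Torus → ℝ) (A : Set Torus) :
    ⨍ x in A, f x = ⨍ x in A, f x ∂arc := by
  have hc : ENNReal.ofReal (2 * Real.pi) ≠ 0 := by simp [Real.pi_pos]
  have hc' : (2 * Real.pi) ≠ 0 := Real.two_pi_pos.ne'
  rw [setAverage_eq, setAverage_eq, volume_eq, Measure.restrict_smul, integral_smul_measure,
    measureReal_ennreal_smul_apply, ENNReal.toReal_ofReal Real.two_pi_pos.le, smul_eq_mul,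
    smul_eq_mul, smul_eq_mul]
  field_simp

theorem arc_real_closedBall_le (s : Torus) {r : ℝ} (hr : 0 ≤ r) :
    arc.real (Metric.closedBall s r) ≤ r / Real.pi := by
  have h := AddCircle.volume_closedBall (2 * Real.pi) (x := s) r
  rw [volume_eq, Measure.smul_apply, smul_eq_mul] at h
  have h2 := congrArg ENNReal.toReal h
  rw [ENNReal.toReal_mul, ENNReal.toReal_ofReal Real.two_pi_pos.le,
    ENNReal.toReal_ofReal (le_min Real.two_pi_pos.le (by linarith))] at h2
  have h3 : 2 * Real.pi * arc.real (Metric.closedBall s r) ≤ 2 * r := by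
    rw [Measure.real, h2]; exact min_le_right _ _
  rw [le_div_iff₀ Real.pi_pos]
  linarith

/-- A kernel of height `n` and width `1/n` with quadratic tails is dominated by a sum of
multiples of indicators of balls with dyadic radii. -/
theorem norm_le_sum_indicator {n : ℕ} (hn : 1 ≤ n) {C a : ℝ} (s θ : Torus) (hC : 0 ≤ C)
    (h1 : a ≤ C * n) (h2 : n * a * ‖pt θ - pt s‖ ^ 2 ≤ C) :
    a ≤ ∑ j ∈ Finset.range (n + 3),
      (Metric.closedBall s (2 ^ j / n)).indicator (fun _ => 10 * C * n * (1 / 4) ^ j) θ := by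
  have hn' : (0 : ℝ) < n := by exact_mod_cast hn
  have hpi := Real.pi_pos
  have hpi4 := Real.pi_lt_d2
  set d := ‖θ - s‖ with hd
  have hdpi : d ≤ Real.pi := norm_torus_le _
  have hex : ∃ j : ℕ, d ≤ 2 ^ j / n := by
    refine ⟨n + 2, ?_⟩
    rw [le_div_iff₀ hn', pow_add]
    have : (n : ℝ) ≤ 2 ^ n := by exact_mod_cast n.lt_two_pow_self.le
    nlinarith
  classical
  set j := Nat.find hex with hj
  have hj1 : d ≤ 2 ^ j / n := Nat.find_spec hex
  have hjn : j ≤ n + 2 := by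
    refine Nat.find_le ?_
    rw [le_div_iff₀ hn', pow_add]
    have : (n : ℝ) ≤ 2 ^ n := by exact_mod_cast n.lt_two_pow_self.le
    nlinarith
  have hmem : θ ∈ Metric.closedBall s (2 ^ j / n) := by
    rw [Metric.mem_closedBall, dist_eq_norm]; exact hj1
  have hterm : a ≤ 10 * C * n * (1 / 4) ^ j := by
    rcases Nat.eq_zero_or_pos j with h0 | hpos
    · rw [h0, pow_zero]
      nlinarith [mul_nonneg hC hn'.le]
    · obtain ⟨i, hi⟩ := Nat.exists_eq_add_of_le' hpos
      have hlt : 2 ^ i / n < d := by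
        by_contra hcon
        exact Nat.find_min hex (m := i) (by omega) (not_lt.1 hcon)
      have hch := mul_norm_sub_le_norm_pt_sub θ s
      rcases le_or_gt a 0 with ha | ha
      · exact ha.trans (by positivity)
      have hlow : 2 / Real.pi * (2 ^ i / n) ≤ ‖pt θ - pt s‖ :=
        (mul_le_mul_of_nonneg_left hlt.le (by positivity)).trans hch
      have hsq : (2 / Real.pi * (2 ^ i / n)) ^ 2 ≤ ‖pt θ - pt s‖ ^ 2 :=
        pow_le_pow_left₀ (by positivity) hlow 2
      have h3 : n * a * (2 / Real.pi * (2 ^ i / n)) ^ 2 ≤ C :=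
        (mul_le_mul_of_nonneg_left hsq (by positivity)).trans h2
      have e : (n : ℝ) * a * (2 / Real.pi * (2 ^ i / n)) ^ 2 =
          a * 4 ^ j / (Real.pi ^ 2 * n) := by
        have : (4 : ℝ) ^ j = 4 * (2 ^ i) ^ 2 := by
          rw [hi, pow_succ, ← pow_mul, mul_comm i 2, pow_mul]; norm_num; ring
        rw [this]
        field_simp
        ring
      rw [e, div_le_iff₀ (by positivity)] at h3
      have h4 : (1 / 4 : ℝ) ^ j = 1 / 4 ^ j := by rw [div_pow, one_pow]
      rw [h4, mul_one_div, le_div_iff₀ (by positivity)]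
      have h5 : Real.pi ^ 2 ≤ 10 := by nlinarith
      nlinarith [mul_nonneg hC hn'.le]
  calc a ≤ 10 * C * n * (1 / 4) ^ j := hterm
    _ = (Metric.closedBall s (2 ^ j / n)).indicator (fun _ => 10 * C * n * (1 / 4) ^ j) θ := by
      rw [Set.indicator_of_mem hmem]
    _ ≤ _ := Finset.single_le_sum (f := fun j : ℕ =>
        (Metric.closedBall s (2 ^ j / n)).indicator (fun _ => 10 * C * n * (1 / 4) ^ j) θ)
        (fun i _ => Set.indicator_nonneg (fun _ _ => by positivity) _)
        (Finset.mem_range.2 (by omega))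

/-- If the averages of `v ≥ 0` over the balls around `s` tend to `0`, then so do the integrals of
`v` against kernels of height `n` and width `1/n` at `s` with quadratic tails. -/
theorem tendsto_integral_mul_of_average {s : Torus} {v : Torus → ℝ} (hv : Integrable v arc)
    (hv0 : ∀ θ, 0 ≤ v θ)
    (hav : Tendsto (fun r : ℝ => ⨍ x in Metric.closedBall s r, v x ∂arc) (𝓝[>] 0) (𝓝 0))
    {a : ℕ → Torus → ℝ} (ha0 : ∀ n θ, 0 ≤ a n θ) {C : ℝ}
    (h1 : ∀ n θ, a n θ ≤ C * n) (h2 : ∀ n θ, n * a n θ * ‖pt θ - pt s‖ ^ 2 ≤ C) :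
    Tendsto (fun n => ∫ θ, a n θ * v θ ∂arc) atTop (𝓝 0) := by
  have hC : 0 ≤ C := by simpa using (ha0 1 s).trans (h1 1 s)
  set I : ℝ → ℝ := fun r => ∫ x in Metric.closedBall s r, v x ∂arc with hI
  have hI0 : ∀ r, 0 ≤ I r := fun r => integral_nonneg hv0
  have hIle : ∀ r, I r ≤ ∫ x, v x ∂arc := fun r =>
    setIntegral_le_integral hv (Eventually.of_forall hv0)
  have hIav : ∀ r, 0 < r → I r / r ≤ ⨍ x in Metric.closedBall s r, v x ∂arc := by
    intro r hr
    have hb := arc_real_closedBall_le s hr.le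
    rw [setAverage_eq, smul_eq_mul]
    change I r / r ≤ _ * I r
    rcases (measureReal_nonneg : 0 ≤ arc.real (Metric.closedBall s r)).eq_or_lt with h0 | hpos
    · have : I r = 0 := by
        have h0' : arc (Metric.closedBall s r) = 0 := by
          rw [Measure.real, eq_comm, ENNReal.toReal_eq_zero_iff] at h0
          exact h0.resolve_right (measure_ne_top _ _)
        exact setIntegral_measure_zero _ h0'
      rw [this]; simp
    · rw [div_eq_inv_mul]
      refine mul_le_mul_of_nonneg_right ?_ (hI0 r)
      refine inv_anti₀ hpos (hb.trans ?_)
      rw [div_le_iff₀ Real.pi_pos]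
      nlinarith [Real.pi_gt_three]
  have hB0 : Tendsto (fun r => I r / r) (𝓝[>] 0) (𝓝 0) := by
    refine tendsto_of_tendsto_of_tendsto_of_le_of_le' tendsto_const_nhds hav ?_ ?_
    · filter_upwards [self_mem_nhdsWithin] with r hr
      exact div_nonneg (hI0 r) (le_of_lt hr)
    · filter_upwards [self_mem_nhdsWithin] with r hr
      exact hIav r hr
  obtain ⟨M, hM⟩ : ∃ M, ∀ r, 0 < r → I r / r ≤ M := by
    have := hB0.eventually (gt_mem_nhds one_pos)
    rw [eventually_nhdsWithin_iff, Metric.eventually_nhds_iff] at this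
    obtain ⟨δ, hδ, hδ'⟩ := this
    refine ⟨max 1 ((∫ x, v x ∂arc) / δ), fun r hr => ?_⟩
    rcases lt_or_ge r δ with h | h
    · exact (hδ' (by simpa [abs_of_pos hr] using h) hr).le.trans (le_max_left _ _)
    · exact (div_le_div₀ (integral_nonneg hv0) (hIle r) hδ h).trans (le_max_right _ _)
  have hM0 : 0 ≤ M := (div_nonneg (hI0 1) zero_le_one).trans (hM 1 one_pos)
  set b : ℕ → ℕ → ℝ := fun n j => 10 * C * ((1 / 2) ^ j * (I (2 ^ j / n) / (2 ^ j / n))) with hb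
  have hb0 : ∀ n j, 0 ≤ b n j := fun n j => by
    have := hI0 (2 ^ j / n)
    positivity
  have hbM : ∀ n ≥ 1, ∀ j, b n j ≤ 10 * C * M * (1 / 2) ^ j := by
    intro n hn j
    have hn' : (0 : ℝ) < n := by exact_mod_cast hn
    have := hM (2 ^ j / n) (by positivity)
    have h3 : (1 / 2 : ℝ) ^ j * (I (2 ^ j / n) / (2 ^ j / n)) ≤ (1 / 2) ^ j * M := by gcongr
    calc b n j ≤ 10 * C * ((1 / 2) ^ j * M) := mul_le_mul_of_nonneg_left h3 (by positivity)
      _ = _ := by ring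
  have hsum : Summable fun j : ℕ => 10 * C * M * (1 / 2 : ℝ) ^ j :=
    (summable_geometric_of_lt_one (by norm_num) (by norm_num)).mul_left _
  have hmain : ∀ n ≥ 1, ∫ θ, a n θ * v θ ∂arc ≤ ∑' j, b n j := by
    intro n hn
    have hn' : (0 : ℝ) < n := by exact_mod_cast hn
    have hmul : ∀ j : ℕ, (fun θ => (Metric.closedBall s (2 ^ j / (n : ℝ))).indicator
        (fun _ => 10 * C * n * (1 / 4) ^ j) θ * v θ) =
          (Metric.closedBall s (2 ^ j / (n : ℝ))).indicator
            (fun θ => 10 * C * n * (1 / 4) ^ j * v θ) := by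
      intro j
      ext θ
      by_cases hθ : θ ∈ Metric.closedBall s (2 ^ j / (n : ℝ)) <;>
        simp only [Set.indicator_of_mem, Set.indicator_of_notMem, hθ, not_false_iff, zero_mul]
    have hind : ∀ j : ℕ, Integrable (fun θ => (Metric.closedBall s (2 ^ j / (n : ℝ))).indicator
        (fun _ => 10 * C * n * (1 / 4) ^ j) θ * v θ) arc := by
      intro j
      rw [hmul]
      exact (hv.const_mul _).indicator Metric.isClosed_closedBall.measurableSet
    calc ∫ θ, a n θ * v θ ∂arc
        ≤ ∫ θ, ∑ j ∈ Finset.range (n + 3), (Metric.closedBall s (2 ^ j / (n : ℝ))).indicator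
            (fun _ => 10 * C * n * (1 / 4) ^ j) θ * v θ ∂arc := by
          refine integral_mono_of_nonneg
            (Eventually.of_forall fun θ => mul_nonneg (ha0 n θ) (hv0 θ))
            (integrable_finsetSum _ fun j _ => hind j) (Eventually.of_forall fun θ => ?_)
          simp only [← Finset.sum_mul]
          exact mul_le_mul_of_nonneg_right
            (norm_le_sum_indicator hn s θ hC (h1 n θ) (h2 n θ)) (hv0 θ)
      _ = ∑ j ∈ Finset.range (n + 3), b n j := by
          rw [integral_finsetSum _ fun j _ => hind j]
          refine Finset.sum_congr rfl fun j _ => ?_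
          rw [hmul, integral_indicator Metric.isClosed_closedBall.measurableSet,
            integral_const_mul]
          change 10 * C * n * (1 / 4) ^ j * I (2 ^ j / n) = _
          have e : (1 / 4 : ℝ) ^ j = (1 / 2) ^ j * (1 / 2) ^ j := by
            rw [← mul_pow]; norm_num
          have e2 : (2 : ℝ) ^ j = ((1 / 2) ^ j)⁻¹ := by rw [← inv_pow]; norm_num
          have e3 : (1 / 2 : ℝ) ^ j ≠ 0 := by positivity
          simp only [hb]
          rw [e]
          generalize I (2 ^ j / n) = J
          rw [e2]
          generalize (1 / 2 : ℝ) ^ j = q at *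
          field_simp
      _ ≤ ∑' j, b n j :=
          (Summable.of_nonneg_of_le (hb0 n) (hbM n hn) hsum).sum_le_tsum _ fun j _ => hb0 n j
  have hlim : Tendsto (fun n => ∑' j, b n j) atTop (𝓝 0) := by
    have h := tendsto_tsum_of_dominated_convergence (𝓕 := atTop) (f := b) (g := fun _ => 0) hsum
      (fun j => ?_) (eventually_atTop.2 ⟨1, fun n hn j => ?_⟩)
    · simpa using h
    · have hr : Tendsto (fun n : ℕ => (2 : ℝ) ^ j / n) atTop (𝓝[>] 0) := by
        refine tendsto_nhdsWithin_iff.2 ⟨tendsto_const_div_atTop_nhds_zero_nat _, ?_⟩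
        filter_upwards [eventually_gt_atTop 0] with n hn
        have hn' : (0 : ℝ) < n := by exact_mod_cast hn
        exact Set.mem_Ioi.2 (by positivity)
      have := ((hB0.comp hr).const_mul ((1 / 2 : ℝ) ^ j)).const_mul (10 * C)
      simpa [hb] using this
    · rw [Real.norm_of_nonneg (hb0 n j)]
      exact hbM n hn j
  refine tendsto_of_tendsto_of_tendsto_of_le_of_le' tendsto_const_nhds hlim ?_ ?_
  · exact Eventually.of_forall fun n => integral_nonneg fun θ => mul_nonneg (ha0 n θ) (hv0 θ)
  · exact eventually_atTop.2 ⟨1, hmain⟩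

/-- The contribution of a measure whose closed support misses `s` to integrals of functions that
are small away from `s`. -/
theorem tendsto_cint_of_notMem_support {σ : ComplexMeasure Torus} {s : Torus}
    (hs : s ∉ σ.variation.support) {h : ℕ → Torus → ℂ} (hh : ∀ n, Continuous (h n)) {C : ℝ}
    (h2 : ∀ n θ, n * ‖h n θ‖ * ‖pt θ - pt s‖ ^ 2 ≤ C) :
    Tendsto (fun n => cint σ (h n)) atTop (𝓝 0) := by
  obtain ⟨U, hU, hU0⟩ := Measure.notMem_support_iff_exists.1 hs
  obtain ⟨δ, hδ, hball⟩ := Metric.mem_nhds_iff.1 hU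
  have hC : 0 ≤ C := by simpa using h2 0 s
  set κ := 2 / Real.pi * δ with hκ
  have hκ0 : 0 < κ := by have := Real.pi_pos; positivity
  have hae : ∀ᵐ θ ∂σ.variation, δ ≤ ‖θ - s‖ := by
    rw [ae_iff]
    refine measure_mono_null (fun θ hθ => hball ?_) hU0
    rw [Metric.mem_ball, dist_eq_norm]
    exact not_le.1 hθ
  have hbound : ∀ n ≥ 1, ‖cint σ (h n)‖ ≤ C / κ ^ 2 * σ.variation.real Set.univ * (1 / n) := by
    intro n hn
    have hn' : (0 : ℝ) < n := by exact_mod_cast hn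
    calc ‖cint σ (h n)‖ ≤ ∫ θ, ‖h n θ‖ ∂σ.variation := norm_cint_le
      _ ≤ ∫ _, C / (κ ^ 2 * n) ∂σ.variation := by
          refine integral_mono_ae (integrable_of_continuous (hh n)).norm (integrable_const _) ?_
          filter_upwards [hae] with θ hθ
          have h3 : κ ≤ ‖pt θ - pt s‖ :=
            (mul_le_mul_of_nonneg_left hθ (by have := Real.pi_pos; positivity)).trans
              (mul_norm_sub_le_norm_pt_sub θ s)
          have h4 := pow_le_pow_left₀ hκ0.le h3 2
          rw [le_div_iff₀ (by positivity)]
          calc ‖h n θ‖ * (κ ^ 2 * n) = n * ‖h n θ‖ * κ ^ 2 := by ring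
            _ ≤ n * ‖h n θ‖ * ‖pt θ - pt s‖ ^ 2 := by gcongr
            _ ≤ C := h2 n θ
      _ = C / κ ^ 2 * σ.variation.real Set.univ * (1 / n) := by
          rw [integral_const, smul_eq_mul]
          field_simp
  refine squeeze_zero_norm' (eventually_atTop.2 ⟨1, hbound⟩) ?_
  simpa using (tendsto_one_div_atTop_nhds_zero_nat (𝕜 := ℝ)).const_mul
    (C / κ ^ 2 * σ.variation.real Set.univ)

theorem integrable_of_ae_eq_rnDeriv {μ : ComplexMeasure Torus} {w : Torus → ℂ}
    (hw : w =ᵐ[arc] μ.rnDeriv arc) : Integrable w arc :=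
  (ComplexMeasure.integrable_rnDeriv μ arc).congr hw.symm

/-- At a point `s` of `E(μ)`, kernels of height `n` and width `1/n` with quadratic tails see `μ` as
the measure with constant density `w(s)`. -/
theorem tendsto_cint_sub_mul_integral {μ : ComplexMeasure Torus} {w : Torus → ℂ}
    (hw : w =ᵐ[arc] μ.rnDeriv arc) {s : Torus} (hs : s ∈ setE μ w)
    {h : ℕ → Torus → ℂ} (hh : ∀ n, Continuous (h n)) {C : ℝ}
    (h1 : ∀ n θ, ‖h n θ‖ ≤ C * n) (h2 : ∀ n θ, n * ‖h n θ‖ * ‖pt θ - pt s‖ ^ 2 ≤ C) :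
    Tendsto (fun n => cint μ (h n) - w s * ∫ θ, h n θ ∂arc) atTop (𝓝 0) := by
  have hwi := integrable_of_ae_eq_rnDeriv hw
  have hv : Integrable (fun θ => ‖w θ - w s‖) arc := (hwi.sub (integrable_const _)).norm
  have hA := tendsto_cint_of_notMem_support hs.1 hh h2
  have hB := tendsto_integral_mul_of_average hv (fun _ => norm_nonneg _) hs.2
    (fun _ _ => norm_nonneg _) h1 h2
  have hmul : ∀ n, Integrable (fun θ => h n θ * w θ) arc := fun n =>
    hwi.bdd_mul (hh n).aestronglyMeasurable (Eventually.of_forall (h1 n))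
  have key : ∀ n, cint μ (h n) - w s * ∫ θ, h n θ ∂arc =
      cint (μ.singularPart arc) (h n) + ∫ θ, h n θ * (w θ - w s) ∂arc := by
    intro n
    rw [cint_eq_singularPart_add μ arc hw (hh n).measurable (h1 n), ← integral_const_mul,
      add_sub_assoc, ← integral_sub (hmul n) ((integrable_of_continuous (hh n)).const_mul _)]
    congr 2
    ext θ
    ring
  simp only [key]
  rw [← add_zero (0 : ℂ)]
  refine hA.add (squeeze_zero_norm (fun n => ?_) hB)
  refine (norm_integral_le_integral_norm _).trans (le_of_eq ?_)
  simp only [norm_mul]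

/-! ### Integration against arclength -/

theorem integral_pt_pow_mul_conj (j k : ℕ) :
    ∫ θ, pt θ ^ j * conj (pt θ ^ k) ∂arc = if j = k then 1 else 0 := by
  have h := congrFun (fourierCoeff_fourier (T := 2 * Real.pi) (j : ℤ)) (k : ℤ)
  rw [fourierCoeff] at h
  have e : ∀ θ : Torus, fourier (-(k : ℤ)) θ • fourier (j : ℤ) θ = pt θ ^ j * conj (pt θ ^ k) := by
    intro θ
    rw [fourier_neg, fourier_apply, fourier_apply, smul_eq_mul, mul_comm]
    simp [pt, AddCircle.toCircle_nsmul]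
  simp only [e] at h
  rw [h, Pi.single_apply]
  simp [eq_comm]

/-- Against arclength, `∑_{k ≤ n} conj(g k) z^k` pairs with a polynomial by its coefficients. -/
theorem integral_onCircle_mul_conj_sum {n : ℕ} {p : ℂ[X]} (hp : p.natDegree ≤ n) (g : ℕ → ℂ) :
    ∫ θ, onCircle p θ * conj (∑ k ∈ Finset.range (n + 1), conj (g k) * pt θ ^ k) ∂arc =
      ∑ k ∈ Finset.range (n + 1), p.coeff k * g k := by
  have hi : ∀ j k : ℕ, Integrable (fun θ => p.coeff j * g k * (pt θ ^ j * conj (pt θ ^ k))) arc :=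
    fun j k => integrable_of_continuous (by
      have := continuous_pt
      fun_prop)
  have e : ∀ θ, onCircle p θ * conj (∑ k ∈ Finset.range (n + 1), conj (g k) * pt θ ^ k) =
      ∑ j ∈ Finset.range (n + 1), ∑ k ∈ Finset.range (n + 1),
        p.coeff j * g k * (pt θ ^ j * conj (pt θ ^ k)) := by
    intro θ
    rw [onCircle, eval_eq_sum_range' (Nat.lt_succ_of_le hp), map_sum, Finset.sum_mul_sum]
    refine Finset.sum_congr rfl fun j _ => Finset.sum_congr rfl fun k _ => ?_
    rw [map_mul, Complex.conj_conj]
    ring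
  simp only [e]
  rw [integral_finsetSum _ fun j _ => integrable_finsetSum _ fun k _ => hi j k]
  refine Finset.sum_congr rfl fun j hj => ?_
  rw [integral_finsetSum _ fun k _ => hi j k]
  simp only [integral_const_mul, integral_pt_pow_mul_conj, mul_ite, mul_one, mul_zero]
  rw [Finset.sum_ite_eq, if_pos hj]

/-! ### Local asymptotics at a point of `E(μ)` -/

/-- The point `s e^{i x / n}` of the circle. -/
def nearPt (s : Torus) (x : ℝ) (n : ℕ) : Torus := s + ((x / n : ℝ) : Torus)

theorem pt_nearPt (s : Torus) (x : ℝ) (n : ℕ) :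
    pt (nearPt s x n) = pt s * Complex.exp (Complex.I * (x / n)) := by
  rw [nearPt, pt_add, pt_coe]; push_cast; rfl

theorem pt_nearPt_pi (s : Torus) (n : ℕ) : pt (nearPt s Real.pi n) = pt s * gam n := by
  rw [pt_nearPt, gam, mul_div_assoc]

theorem norm_exp_div_sub_one_le (x : ℝ) (n : ℕ) :
    ‖Complex.exp (Complex.I * (x / n)) - 1‖ ≤ |x| / n := by
  have := Real.norm_exp_I_mul_ofReal_sub_one_le (x := x / n)
  rw [Real.norm_eq_abs, abs_div, Nat.abs_cast] at this
  exact_mod_cast this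

theorem norm_exp_div (x : ℝ) (n : ℕ) : ‖Complex.exp (Complex.I * (x / n))‖ = 1 := by
  have := Complex.norm_exp_I_mul_ofReal (x / n)
  exact_mod_cast this

theorem exp_div_pow (x : ℝ) {n : ℕ} (hn : n ≠ 0) :
    Complex.exp (Complex.I * (x / n)) ^ n = Complex.exp (Complex.I * x) := by
  rw [← Complex.exp_nat_mul]
  congr 1
  have : (n : ℂ) ≠ 0 := Nat.cast_ne_zero.2 hn
  field_simp

theorem norm_pt_nearPt_sub_le (s : Torus) (x : ℝ) (n : ℕ) :
    ‖pt (nearPt s x n) - pt s‖ ≤ |x| / n := by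
  rw [pt_nearPt]
  have : pt s * Complex.exp (Complex.I * (x / n)) - pt s =
      pt s * (Complex.exp (Complex.I * (x / n)) - 1) := by ring
  rw [this, norm_mul, norm_pt, one_mul]
  exact norm_exp_div_sub_one_le x n

theorem norm_one_sub_pt_mul_conj (α β : Torus) : ‖1 - pt α * conj (pt β)‖ = ‖pt α - pt β‖ := by
  have : pt α - pt β = -(pt β * (1 - pt α * conj (pt β))) := by
    linear_combination (-pt α) * pt_mul_conj β
  rw [this, norm_neg, norm_mul, norm_pt, one_mul]

/-- The Dirichlet kernel `∑_{k ≤ n} (z conj ζ)^k` with pole at `ζ`. -/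
def dirichletPoly (n : ℕ) (ζ : Torus) : ℂ[X] :=
  ∑ k ∈ Finset.range (n + 1), C (conj (pt ζ ^ k)) * X ^ k

theorem natDegree_sum_C_mul_X_pow_le (n : ℕ) (g : ℕ → ℂ) :
    (∑ k ∈ Finset.range (n + 1), C (g k) * X ^ k).natDegree ≤ n :=
  natDegree_sum_le_of_forall_le _ _ fun _ hk =>
    (natDegree_C_mul_X_pow_le _ _).trans (Nat.lt_succ_iff.1 (Finset.mem_range.1 hk))

theorem onCircle_sum_C_mul_X_pow (n : ℕ) (g : ℕ → ℂ) (θ : Torus) :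
    onCircle (∑ k ∈ Finset.range (n + 1), C (g k) * X ^ k) θ =
      ∑ k ∈ Finset.range (n + 1), g k * pt θ ^ k := by
  simp [onCircle, eval_finsetSum]

theorem natDegree_dirichletPoly_le (n : ℕ) (ζ : Torus) : (dirichletPoly n ζ).natDegree ≤ n :=
  natDegree_sum_C_mul_X_pow_le n _

theorem onCircle_dirichletPoly (n : ℕ) (ζ θ : Torus) :
    onCircle (dirichletPoly n ζ) θ = ∑ k ∈ Finset.range (n + 1), (pt θ * conj (pt ζ)) ^ k := by
  rw [dirichletPoly, onCircle_sum_C_mul_X_pow]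
  refine Finset.sum_congr rfl fun k _ => ?_
  rw [map_pow, mul_pow, mul_comm]

theorem one_sub_mul_onCircle_dirichletPoly (n : ℕ) (ζ θ : Torus) :
    (1 - pt θ * conj (pt ζ)) * onCircle (dirichletPoly n ζ) θ =
      1 - (pt θ * conj (pt ζ)) ^ (n + 1) := by
  rw [onCircle_dirichletPoly, mul_neg_geom_sum]

theorem norm_pt_mul_conj_pt (α β : Torus) : ‖pt α * conj (pt β)‖ = 1 := by
  rw [norm_mul, RCLike.norm_conj, norm_pt, norm_pt, one_mul]

theorem norm_onCircle_dirichletPoly_le (n : ℕ) (ζ θ : Torus) :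
    ‖onCircle (dirichletPoly n ζ) θ‖ ≤ n + 1 := by
  rw [onCircle_dirichletPoly]
  refine (norm_sum_le _ _).trans ?_
  simp [norm_pt]

theorem norm_onCircle_dirichletPoly_mul_le (n : ℕ) (ζ θ : Torus) :
    ‖onCircle (dirichletPoly n ζ) θ‖ * ‖pt θ - pt ζ‖ ≤ 2 := by
  rw [mul_comm, ← norm_one_sub_pt_mul_conj, ← norm_mul, one_sub_mul_onCircle_dirichletPoly]
  refine (norm_sub_le _ _).trans ?_
  rw [norm_pow, norm_pt_mul_conj_pt, norm_one, one_pow]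
  norm_num

namespace OPSystem

variable {μ : ComplexMeasure Torus} {F : ℕ → ℂ} {P Q : ℕ → ℂ[X]}

theorem norm_kernelPoly_le (h : OPSystem μ F P Q) (n : ℕ) (α β : Torus) :
    ‖conj (onCircle (kernelPoly P Q n α) β)‖ ≤ 4 * (n + 1) := by
  rw [conj_onCircle_kernelPoly]
  refine (norm_sum_le _ _).trans ?_
  have : ∀ k ∈ Finset.range (n + 1), ‖onCircle (P k) α * conj (onCircle (Q k) β)‖ ≤ 4 := by
    intro k _
    rw [norm_mul, RCLike.norm_conj]
    nlinarith [h.norm_left_le k α, h.norm_right_le k β, norm_nonneg (onCircle (P k) α),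
      norm_nonneg (onCircle (Q k) β)]
  refine (Finset.sum_le_sum this).trans ?_
  simp [mul_comm]

theorem norm_kernelPoly_mul_le (h : OPSystem μ F P Q) (n : ℕ) (α β : Torus) :
    ‖conj (onCircle (kernelPoly P Q n α) β)‖ * ‖pt β - pt α‖ ≤ 8 := by
  rw [conj_onCircle_kernelPoly, mul_comm, ← norm_neg (pt β - pt α), neg_sub,
    ← norm_one_sub_pt_mul_conj, ← norm_mul, h.christoffel_darboux]
  refine (norm_sub_le _ _).trans ?_
  simp only [norm_mul, norm_pow, RCLike.norm_conj, norm_pt, one_pow, one_mul]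
  have h1 := h.norm_left_le n α
  have h2 := h.norm_left_le n β
  have h3 := h.norm_right_le n α
  have h4 := h.norm_right_le n β
  nlinarith [norm_nonneg (onCircle (P n) α), norm_nonneg (onCircle (Q n) β),
    norm_nonneg (onCircle (P n) β), norm_nonneg (onCircle (Q n) α)]

/-- Testing the reproducing property at `s` against the Dirichlet kernel at `s γ_n` and localizing:
this is where the value `w(s)` enters, and it forces `w(s) ≠ 0`. -/
theorem tendsto_density_mul (h : OPSystem μ F P Q) {w : Torus → ℂ}
    (hw : w =ᵐ[arc] μ.rnDeriv arc) {s : Torus} (hs : s ∈ setE μ w) :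
    Tendsto (fun n => w s * (onCircle (P n) s * conj (onCircle (Q n) (nearPt s Real.pi n)) +
      onCircle (P n) (nearPt s Real.pi n) * conj (onCircle (Q n) s))) atTop (𝓝 (-2)) := by
  set ζ : ℕ → Torus := nearPt s Real.pi with hζ
  set f : ℕ → Torus → ℂ := fun n θ => (n : ℂ)⁻¹ *
    (onCircle (dirichletPoly n (ζ n)) θ * conj (onCircle (kernelPoly P Q n s) θ)) with hf
  have hζs : ∀ n : ℕ, n * ‖pt (ζ n) - pt s‖ ≤ Real.pi := by
    intro n
    have := norm_pt_nearPt_sub_le s Real.pi n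
    rw [abs_of_pos Real.pi_pos] at this
    rcases Nat.eq_zero_or_pos n with rfl | hn
    · simpa using Real.pi_pos.le
    · have hn' : (0 : ℝ) < n := by exact_mod_cast hn
      rwa [le_div_iff₀ hn', mul_comm] at this
  have hcont : ∀ n, Continuous (f n) := fun n =>
    continuous_const.mul (continuous_onCircle_mul_conj _ _)
  have hb1 : ∀ n θ, ‖f n θ‖ ≤ 80 * n := by
    intro n θ
    rcases Nat.eq_zero_or_pos n with rfl | hn
    · simp [hf]
    have hn' : (1 : ℝ) ≤ n := by exact_mod_cast hn
    have h1 := norm_onCircle_dirichletPoly_le n (ζ n) θ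
    have h2 := h.norm_kernelPoly_le n s θ
    rw [hf]
    simp only [norm_mul, norm_inv, Complex.norm_natCast]
    rw [inv_mul_le_iff₀ (by linarith)]
    have := mul_le_mul h1 h2 (norm_nonneg _) (by positivity)
    nlinarith
  have hb2 : ∀ n θ, n * ‖f n θ‖ * ‖pt θ - pt s‖ ^ 2 ≤ 80 := by
    intro n θ
    rcases Nat.eq_zero_or_pos n with rfl | hn
    · simp
    have hn' : (1 : ℝ) ≤ n := by exact_mod_cast hn
    have h1 := norm_onCircle_dirichletPoly_le n (ζ n) θ
    have h2 := h.norm_kernelPoly_mul_le n s θ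
    have h3 := norm_onCircle_dirichletPoly_mul_le n (ζ n) θ
    have h4 := hζs n
    rw [hf]
    simp only [norm_mul, norm_inv, Complex.norm_natCast]
    set p := ‖onCircle (dirichletPoly n (ζ n)) θ‖
    set q := ‖conj (onCircle (kernelPoly P Q n s) θ)‖
    have hp : 0 ≤ p := norm_nonneg _
    have htri : ‖pt θ - pt s‖ ≤ ‖pt θ - pt (ζ n)‖ + ‖pt (ζ n) - pt s‖ := by
      have := norm_add_le (pt θ - pt (ζ n)) (pt (ζ n) - pt s)
      rwa [sub_add_sub_cancel] at this
    have h5 : p * ‖pt θ - pt s‖ ≤ 10 := by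
      have : p * ‖pt (ζ n) - pt s‖ ≤ 2 * Real.pi := by
        calc p * ‖pt (ζ n) - pt s‖ ≤ (2 * n) * ‖pt (ζ n) - pt s‖ := by
              refine mul_le_mul_of_nonneg_right ?_ (norm_nonneg _)
              linarith
          _ ≤ 2 * Real.pi := by linarith
      have := Real.pi_lt_d2
      nlinarith
    calc (n : ℝ) * ((n : ℝ)⁻¹ * (p * q)) * ‖pt θ - pt s‖ ^ 2
        = (p * ‖pt θ - pt s‖) * (q * ‖pt θ - pt s‖) := by field_simp
      _ ≤ 10 * 8 := mul_le_mul h5 h2 (by positivity) (by norm_num)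
      _ = 80 := by norm_num
  have hlim := tendsto_cint_sub_mul_integral hw hs hcont hb1 hb2
  set u : ℕ → ℂ := fun n => pt s * conj (pt (ζ n)) with hu
  -- Against `μ` the reproducing kernel evaluates the Dirichlet kernel at `s`; against arclength the
  -- Dirichlet kernel evaluates the reproducing kernel at `s γ_n`.
  have hcint : ∀ n, cint μ (f n) = (n : ℂ)⁻¹ * onCircle (dirichletPoly n (ζ n)) s := by
    intro n
    rw [hf, cint_const_mul (integrable_of_continuous (continuous_onCircle_mul_conj _ _)),
      ← pairing_eq, h.pairing_kernelPoly n s _ (natDegree_dirichletPoly_le _ _)]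
  have hkdeg : ∀ n, (kernelPoly P Q n s).natDegree ≤ n := fun n =>
    natDegree_sum_le_of_forall_le _ _ fun k hk =>
      (natDegree_C_mul_le _ _).trans ((h.natDegree_right k).le.trans
        (Nat.lt_succ_iff.1 (Finset.mem_range.1 hk)))
  have hint : ∀ n, ∫ θ, f n θ ∂arc =
      (n : ℂ)⁻¹ * conj (onCircle (kernelPoly P Q n s) (ζ n)) := by
    intro n
    have h1 := integral_onCircle_mul_conj_sum (hkdeg n) (fun k => pt (ζ n) ^ k)
    rw [← eval_eq_sum_range' (Nat.lt_succ_of_le (hkdeg n))] at h1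
    rw [hf, integral_const_mul, onCircle, ← h1, ← integral_conj]
    congr 1
    refine integral_congr_ae (Eventually.of_forall fun θ => ?_)
    simp only [map_mul, Complex.conj_conj]
    rw [dirichletPoly, onCircle_sum_C_mul_X_pow, mul_comm]
  have hupow : ∀ n ≥ 1, u n ^ n = -1 := by
    intro n hn
    have e1 : pt (ζ n) ^ n = - pt s ^ n := by
      rw [hζ, pt_nearPt, mul_pow, exp_div_pow _ (by omega), mul_comm Complex.I,
        Complex.exp_pi_mul_I]
      ring
    rw [hu]
    simp only
    rw [mul_pow, ← map_pow, e1, map_neg, mul_neg, map_pow, ← mul_pow, pt_mul_conj, one_pow]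
  have hu1 : ∀ n : ℕ, ‖1 - u n‖ ≤ Real.pi / n := by
    intro n
    rw [hu]
    simp only
    rw [norm_one_sub_pt_mul_conj, ← norm_neg, neg_sub]
    have := norm_pt_nearPt_sub_le s Real.pi n
    rwa [abs_of_pos Real.pi_pos] at this
  have hu0 : Tendsto (fun n => 1 - u n) atTop (𝓝 0) :=
    squeeze_zero_norm hu1 (tendsto_const_div_atTop_nhds_zero_nat _)
  set Xn : ℕ → ℂ := fun n => onCircle (P n) s * conj (onCircle (Q n) (ζ n)) with hX
  set Yn : ℕ → ℂ := fun n => onCircle (P n) (ζ n) * conj (onCircle (Q n) s) with hY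
  have hXb : ∀ n, ‖Xn n‖ ≤ 4 := by
    intro n
    rw [hX]
    simp only [norm_mul, RCLike.norm_conj]
    nlinarith [h.norm_left_le n s, h.norm_right_le n (ζ n), norm_nonneg (onCircle (P n) s),
      norm_nonneg (onCircle (Q n) (ζ n))]
  -- With `u = s conj (s γ_n)`, the geometric sum and the Christoffel–Darboux formula both simplify
  -- because `u^n = -1`.
  have hident : ∀ n ≥ 1, w s * (Xn n + Yn n) =
      n * (1 - u n) * (cint μ (f n) - w s * ∫ θ, f n θ ∂arc) + (1 - u n) - 2
        + w s * ((1 - u n) * Xn n) := by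
    intro n hn
    have hn0 : (n : ℂ) ≠ 0 := Nat.cast_ne_zero.2 (by omega)
    have h1 := one_sub_mul_onCircle_dirichletPoly n (ζ n) s
    have h2 := h.christoffel_darboux n s (ζ n)
    have h3 := hupow n hn
    rw [← conj_onCircle_kernelPoly] at h2
    change (1 - u n) * _ = 1 - u n ^ (n + 1) at h1
    change (1 - u n) * _ = u n ^ n * (_ * _) - u n * Xn n at h2
    rw [pow_succ, h3] at h1
    rw [h3] at h2
    rw [hcint, hint, hY]
    have e : (n : ℂ) * (1 - u n) * ((n : ℂ)⁻¹ * onCircle (dirichletPoly n (ζ n)) s -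
        w s * ((n : ℂ)⁻¹ * conj (onCircle (kernelPoly P Q n s) (ζ n)))) =
        (1 - u n) * onCircle (dirichletPoly n (ζ n)) s -
        w s * ((1 - u n) * conj (onCircle (kernelPoly P Q n s) (ζ n))) := by
      field_simp
    simp only
    rw [e, h1, h2]
    ring
  have hbdd : Tendsto (fun n : ℕ => n * (1 - u n) * (cint μ (f n) - w s * ∫ θ, f n θ ∂arc))
      atTop (𝓝 0) := by
    have hle : ∀ n : ℕ, ‖(n : ℂ) * (1 - u n)‖ ≤ Real.pi := by
      intro n
      rw [norm_mul, Complex.norm_natCast]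
      have := hu1 n
      rcases Nat.eq_zero_or_pos n with rfl | hn
      · simpa using Real.pi_pos.le
      · have hn' : (0 : ℝ) < n := by exact_mod_cast hn
        rwa [le_div_iff₀ hn', mul_comm] at this
    refine squeeze_zero_norm (fun n => ?_) (by simpa using hlim.norm.const_mul Real.pi)
    rw [norm_mul]
    exact mul_le_mul_of_nonneg_right (hle n) (norm_nonneg _)
  have hXu : Tendsto (fun n => (1 - u n) * Xn n) atTop (𝓝 0) := by
    refine squeeze_zero_norm (fun n => ?_) (by simpa using hu0.norm.mul_const 4)
    rw [norm_mul]
    exact mul_le_mul_of_nonneg_left (hXb n) (norm_nonneg _)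
  have hfin := ((hbdd.add hu0).sub_const 2).add (hXu.const_mul (w s))
  rw [mul_zero, add_zero, add_zero, zero_sub] at hfin
  refine hfin.congr' ?_
  filter_upwards [eventually_ge_atTop 1] with n hn
  exact (hident n hn).symm

/-- The density does not vanish on `E(μ)`: a vanishing limit cannot equal `-2`. -/
theorem density_ne_zero (h : OPSystem μ F P Q) {w : Torus → ℂ}
    (hw : w =ᵐ[arc] μ.rnDeriv arc) {s : Torus} (hs : s ∈ setE μ w) : w s ≠ 0 := by
  intro h0
  have := h.tendsto_density_mul hw hs
  simp only [h0, zero_mul] at this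
  exact absurd (tendsto_nhds_unique this tendsto_const_nhds) (by norm_num)

end OPSystem

/-! ### Interpolation at scale `1/n` -/

/-- Summation by parts against a geometric sequence. -/
theorem one_sub_mul_sum (v : ℂ) (g : ℕ → ℂ) (m : ℕ) :
    (1 - v) * ∑ k ∈ Finset.range (m + 1), g k * v ^ k =
      g 0 - g m * v ^ (m + 1) + v * ∑ k ∈ Finset.range m, (g (k + 1) - g k) * v ^ k := by
  induction m with
  | zero => simp; ring
  | succ m ih =>
    rw [Finset.sum_range_succ, mul_add, ih, Finset.sum_range_succ _ m]
    ring

/-- Two summations by parts: coefficients that vary at scale `n` and vanish at both ends give a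
trigonometric sum with quadratic decay. -/
theorem norm_sum_mul_pow_mul_le {n : ℕ} {D : ℝ} {g : ℕ → ℂ} (hD : 0 ≤ D) (h0 : g 0 = 0)
    (hn : g n = 0) (h1 : ∀ k, ‖g (k + 1) - g k‖ ≤ D / n)
    (h2 : ∀ k, ‖g (k + 2) - g (k + 1) - (g (k + 1) - g k)‖ ≤ D / n ^ 2) {v : ℂ} (hv : ‖v‖ = 1) :
    n * ‖∑ k ∈ Finset.range (n + 1), g k * v ^ k‖ * ‖1 - v‖ ^ 2 ≤ 3 * D := by
  rcases Nat.eq_zero_or_pos n with rfl | hpos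
  · simp [hD]
  obtain ⟨m, rfl⟩ := Nat.exists_eq_add_of_le' hpos
  have hn' : (0 : ℝ) < (m + 1 : ℕ) := by exact_mod_cast hpos
  have e : (1 - v) ^ 2 * ∑ k ∈ Finset.range (m + 1 + 1), g k * v ^ k =
      v * ((g 1 - g 0) - (g (m + 1) - g m) * v ^ (m + 1) +
        v * ∑ k ∈ Finset.range m, (g (k + 2) - g (k + 1) - (g (k + 1) - g k)) * v ^ k) := by
    rw [pow_two, mul_assoc, one_sub_mul_sum v g (m + 1), h0, hn, zero_mul, sub_zero, zero_add,
      mul_left_comm, one_sub_mul_sum v (fun k => g (k + 1) - g k) m, zero_add, h0, hn]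
  have h3 : ‖∑ k ∈ Finset.range m, (g (k + 2) - g (k + 1) - (g (k + 1) - g k)) * v ^ k‖ ≤
      m * (D / (m + 1 : ℕ) ^ 2) := by
    refine (norm_sum_le _ _).trans ((Finset.sum_le_card_nsmul _ _
      (D / (m + 1 : ℕ) ^ 2) fun k _ => ?_).trans ?_)
    · rw [norm_mul, norm_pow, hv, one_pow, mul_one]; exact h2 k
    · simp
  have h4 : ‖(1 - v) ^ 2 * ∑ k ∈ Finset.range (m + 1 + 1), g k * v ^ k‖ ≤
      D / (m + 1 : ℕ) + D / (m + 1 : ℕ) + m * (D / (m + 1 : ℕ) ^ 2) := by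
    rw [e, norm_mul, hv, one_mul]
    refine (norm_add_le _ _).trans (add_le_add ((norm_sub_le _ _).trans (add_le_add (h1 0) ?_)) ?_)
    · rw [norm_mul, norm_pow, hv, one_pow, mul_one]; exact h1 m
    · rw [norm_mul, hv, one_mul]; exact h3
  rw [norm_mul, norm_pow] at h4
  have h5 : (m : ℝ) * (D / (m + 1 : ℕ) ^ 2) ≤ D / (m + 1 : ℕ) := by
    rw [pow_two, ← div_div, ← mul_div_assoc, div_le_iff₀ hn', mul_comm]
    refine mul_le_mul_of_nonneg_left ?_ (by positivity)
    push_cast; linarith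
  calc ((m + 1 : ℕ) : ℝ) * ‖∑ k ∈ Finset.range (m + 1 + 1), g k * v ^ k‖ * ‖1 - v‖ ^ 2
      = (m + 1 : ℕ) *
        (‖1 - v‖ ^ 2 * ‖∑ k ∈ Finset.range (m + 1 + 1), g k * v ^ k‖) := by ring
    _ ≤ (m + 1 : ℕ) * (3 * (D / (m + 1 : ℕ))) :=
      mul_le_mul_of_nonneg_left (by linarith) hn'.le
    _ = 3 * D := by field_simp

/-- The weight of the value at `s` in the interpolation of `A e^{ix} + B` from the values at
`x = 0` and `x = π`. -/
def weightZero (x : ℝ) : ℂ := (1 + Complex.exp (Complex.I * x)) / 2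

/-- The weight of the value at `s γ_n` in the interpolation of `A e^{ix} + B` from the values at
`x = 0` and `x = π`. -/
def weightPi (x : ℝ) : ℂ := (1 - Complex.exp (Complex.I * x)) / 2

theorem norm_weightZero_le (x : ℝ) : ‖weightZero x‖ ≤ 1 := by
  rw [weightZero, norm_div, Complex.norm_ofNat, div_le_one two_pos]
  refine (norm_add_le _ _).trans ?_
  rw [Complex.norm_exp_I_mul_ofReal, norm_one]; norm_num

theorem norm_weightPi_le (x : ℝ) : ‖weightPi x‖ ≤ 1 := by
  rw [weightPi, norm_div, Complex.norm_ofNat, div_le_one two_pos]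
  refine (norm_sub_le _ _).trans ?_
  rw [Complex.norm_exp_I_mul_ofReal, norm_one]; norm_num

theorem weightZero_half : weightZero (Real.pi / 2) = (1 + Complex.I) / 2 := by
  rw [weightZero]; push_cast; rw [mul_comm, Complex.exp_pi_div_two_mul_I]

theorem weightPi_half : weightPi (Real.pi / 2) = (1 - Complex.I) / 2 := by
  rw [weightPi]; push_cast; rw [mul_comm, Complex.exp_pi_div_two_mul_I]

/-- The coefficients, relative to `s^k`, of the functional comparing the value at `s e^{ix/n}` with
its interpolation from `s` and `s γ_n`. They vanish at `k = 0` and at `k = n`, which is what makes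
the representing kernel decay quadratically. -/
def interpCoeff (x : ℝ) (n k : ℕ) : ℂ :=
  Complex.exp (Complex.I * (x / n)) ^ k - weightZero x -
    weightPi x * Complex.exp (Complex.I * ((Real.pi : ℝ) / n)) ^ k

theorem interpCoeff_zero (x : ℝ) (n : ℕ) : interpCoeff x n 0 = 0 := by
  simp only [interpCoeff, weightZero, weightPi, pow_zero]; ring

theorem interpCoeff_self (x : ℝ) (n : ℕ) : interpCoeff x n n = 0 := by
  rcases eq_or_ne n 0 with rfl | hn
  · exact interpCoeff_zero x 0
  · rw [interpCoeff, exp_div_pow x hn, exp_div_pow Real.pi hn, mul_comm Complex.I (Real.pi : ℂ),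
      Complex.exp_pi_mul_I, weightZero, weightPi]
    ring

theorem norm_interpCoeff_le (x : ℝ) (n k : ℕ) : ‖interpCoeff x n k‖ ≤ 3 := by
  refine (norm_sub_le _ _).trans ((add_le_add (norm_sub_le _ _) le_rfl).trans ?_)
  rw [norm_mul, norm_pow, norm_pow, norm_exp_div, norm_exp_div, one_pow, mul_one]
  linarith [norm_weightZero_le x, norm_weightPi_le x]

theorem norm_interpCoeff_succ_sub_le {x : ℝ} (hx : |x| ≤ Real.pi) (n k : ℕ) :
    ‖interpCoeff x n (k + 1) - interpCoeff x n k‖ ≤ 20 / n := by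
  have h1 := norm_exp_div_sub_one_le x n
  have h2 := norm_exp_div_sub_one_le Real.pi n
  rw [abs_of_pos Real.pi_pos] at h2
  have h3 : |x| / n ≤ Real.pi / n := by gcongr
  have e : interpCoeff x n (k + 1) - interpCoeff x n k =
      Complex.exp (Complex.I * (x / n)) ^ k * (Complex.exp (Complex.I * (x / n)) - 1) -
        weightPi x * (Complex.exp (Complex.I * ((Real.pi : ℝ) / n)) ^ k *
          (Complex.exp (Complex.I * ((Real.pi : ℝ) / n)) - 1)) := by
    rw [interpCoeff, interpCoeff]; ring
  rw [e]
  refine (norm_sub_le _ _).trans ?_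
  rw [norm_mul, norm_mul, norm_mul, norm_pow, norm_pow, norm_exp_div, norm_exp_div, one_pow,
    one_mul, one_mul]
  have h4 := mul_le_mul (norm_weightPi_le x) h2 (norm_nonneg _) zero_le_one
  calc _ ≤ Real.pi / n + 1 * (Real.pi / n) := add_le_add (h1.trans h3) h4
    _ = 2 * Real.pi / n := by ring
    _ ≤ 20 / n := by gcongr; linarith [Real.pi_lt_d2]

theorem norm_interpCoeff_second_diff_le {x : ℝ} (hx : |x| ≤ Real.pi) (n k : ℕ) :
    ‖interpCoeff x n (k + 2) - interpCoeff x n (k + 1) -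
      (interpCoeff x n (k + 1) - interpCoeff x n k)‖ ≤ 20 / n ^ 2 := by
  have h1 := norm_exp_div_sub_one_le x n
  have h2 := norm_exp_div_sub_one_le Real.pi n
  rw [abs_of_pos Real.pi_pos] at h2
  have h3 : |x| / n ≤ Real.pi / n := by gcongr
  have e : interpCoeff x n (k + 2) - interpCoeff x n (k + 1) -
      (interpCoeff x n (k + 1) - interpCoeff x n k) =
      Complex.exp (Complex.I * (x / n)) ^ k * (Complex.exp (Complex.I * (x / n)) - 1) ^ 2 -
        weightPi x * (Complex.exp (Complex.I * ((Real.pi : ℝ) / n)) ^ k *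
          (Complex.exp (Complex.I * ((Real.pi : ℝ) / n)) - 1) ^ 2) := by
    rw [interpCoeff, interpCoeff, interpCoeff]; ring
  rw [e]
  refine (norm_sub_le _ _).trans ?_
  rw [norm_mul, norm_mul, norm_mul, norm_pow, norm_pow, norm_pow, norm_pow, norm_exp_div,
    norm_exp_div, one_pow, one_mul, one_mul]
  have h5 := pow_le_pow_left₀ (norm_nonneg _) (h1.trans h3) 2
  have h6 := pow_le_pow_left₀ (norm_nonneg _) h2 2
  have h4 := mul_le_mul (norm_weightPi_le x) h6 (by positivity) zero_le_one
  calc _ ≤ (Real.pi / n) ^ 2 + 1 * (Real.pi / n) ^ 2 := add_le_add h5 h4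
    _ = 2 * Real.pi ^ 2 / n ^ 2 := by ring
    _ ≤ 20 / n ^ 2 := by gcongr; nlinarith [Real.pi_lt_d2, Real.pi_pos]

/-- The polynomial representing the interpolation error at `s e^{ix/n}` against arclength. -/
def interpPoly (x : ℝ) (n : ℕ) (s : Torus) : ℂ[X] :=
  ∑ k ∈ Finset.range (n + 1), C (conj (pt s ^ k * interpCoeff x n k)) * X ^ k

theorem degree_interpPoly_lt (x : ℝ) (n : ℕ) (s : Torus) : (interpPoly x n s).degree < n := by
  rw [interpPoly, Finset.sum_range_succ, interpCoeff_self, mul_zero, map_zero, C_0, zero_mul,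
    add_zero]
  refine (degree_sum_le _ _).trans_lt ((Finset.sup_lt_iff (WithBot.bot_lt_coe n)).2 fun k hk => ?_)
  exact (degree_C_mul_X_pow_le _ _).trans_lt (WithBot.coe_lt_coe.2 (Finset.mem_range.1 hk))

theorem norm_onCircle_interpPoly_eq (x : ℝ) (n : ℕ) (s θ : Torus) :
    ‖onCircle (interpPoly x n s) θ‖ =
      ‖∑ k ∈ Finset.range (n + 1), interpCoeff x n k * (pt s * conj (pt θ)) ^ k‖ := by
  rw [interpPoly, onCircle_sum_C_mul_X_pow, ← RCLike.norm_conj, map_sum]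
  congr 1
  refine Finset.sum_congr rfl fun k _ => ?_
  rw [map_mul, Complex.conj_conj, map_pow, mul_pow]
  ring

theorem norm_onCircle_interpPoly_le (x : ℝ) (n : ℕ) (s θ : Torus) :
    ‖onCircle (interpPoly x n s) θ‖ ≤ 6 * n := by
  rcases Nat.eq_zero_or_pos n with rfl | hn
  · rw [norm_onCircle_interpPoly_eq]
    simp [interpCoeff_zero]
  have hn' : (1 : ℝ) ≤ n := by exact_mod_cast hn
  rw [norm_onCircle_interpPoly_eq]
  refine (norm_sum_le _ _).trans
    ((Finset.sum_le_card_nsmul _ _ 3 fun k _ => ?_).trans ?_)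
  · rw [norm_mul, norm_pow, norm_pt_mul_conj_pt, one_pow, mul_one]
    exact norm_interpCoeff_le x n k
  · simp only [Finset.card_range, nsmul_eq_mul]
    push_cast
    linarith

theorem norm_onCircle_interpPoly_mul_le {x : ℝ} (hx : |x| ≤ Real.pi) (n : ℕ) (s θ : Torus) :
    n * ‖onCircle (interpPoly x n s) θ‖ * ‖pt θ - pt s‖ ^ 2 ≤ 60 := by
  have := norm_sum_mul_pow_mul_le (n := n) (g := interpCoeff x n) (D := 20) (by norm_num)
    (interpCoeff_zero x n) (interpCoeff_self x n) (norm_interpCoeff_succ_sub_le hx n)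
    (norm_interpCoeff_second_diff_le hx n) (norm_pt_mul_conj_pt s θ)
  rw [← norm_onCircle_interpPoly_eq, norm_one_sub_pt_mul_conj, norm_sub_rev (pt s)] at this
  linarith

/-- Evaluation of the interpolation error of a polynomial by integration against arclength. -/
theorem integral_mul_conj_interpPoly {n : ℕ} {p : ℂ[X]} (hp : p.natDegree ≤ n) (x : ℝ)
    (s : Torus) :
    ∫ θ, onCircle p θ * conj (onCircle (interpPoly x n s) θ) ∂arc =
      onCircle p (nearPt s x n) - weightZero x * onCircle p s -
        weightPi x * onCircle p (nearPt s Real.pi n) := by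
  have h1 := integral_onCircle_mul_conj_sum hp (fun k => pt s ^ k * interpCoeff x n k)
  simp only [interpPoly, onCircle_sum_C_mul_X_pow]
  rw [h1, onCircle, onCircle, onCircle, eval_eq_sum_range' (Nat.lt_succ_of_le hp),
    eval_eq_sum_range' (Nat.lt_succ_of_le hp), eval_eq_sum_range' (Nat.lt_succ_of_le hp),
    Finset.mul_sum, Finset.mul_sum, ← Finset.sum_sub_distrib, ← Finset.sum_sub_distrib]
  refine Finset.sum_congr rfl fun k _ => ?_
  rw [pt_nearPt, pt_nearPt, interpCoeff, mul_pow, mul_pow]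
  ring

namespace OPSystem

variable {μ : ComplexMeasure Torus} {F : ℕ → ℂ} {P Q : ℕ → ℂ[X]} {w : Torus → ℂ} {s : Torus}

/-- At scale `1/n` around a point of `E(μ)`, `φ_n` behaves like `A e^{ix} + B`. -/
theorem tendsto_left_interp (h : OPSystem μ F P Q) (hw : w =ᵐ[arc] μ.rnDeriv arc)
    (hs : s ∈ setE μ w) {x : ℕ → ℝ} (hx : ∀ n, |x n| ≤ Real.pi) :
    Tendsto (fun n => onCircle (P n) (nearPt s (x n) n) - weightZero (x n) * onCircle (P n) s -
      weightPi (x n) * onCircle (P n) (nearPt s Real.pi n)) atTop (𝓝 0) := by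
  have hlim := tendsto_cint_sub_mul_integral hw hs (C := 120)
    (h := fun n θ => onCircle (P n) θ * conj (onCircle (interpPoly (x n) n s) θ))
    (fun n => continuous_onCircle_mul_conj _ _) (fun n θ => ?_) (fun n θ => ?_)
  · simp only [← pairing_eq, h.orth_left _ _ (degree_interpPoly_lt _ _ _), zero_sub,
      integral_mul_conj_interpPoly (h.natDegree_left _).le] at hlim
    have h0 := h.density_ne_zero hw hs
    have := hlim.const_mul (-(w s)⁻¹)
    rw [mul_zero] at this
    refine this.congr fun n => ?_
    field_simp
  · rw [norm_mul, RCLike.norm_conj]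
    have h1 := h.norm_left_le n θ
    have h2 := norm_onCircle_interpPoly_le (x n) n s θ
    nlinarith [norm_nonneg (onCircle (P n) θ), norm_nonneg (onCircle (interpPoly (x n) n s) θ)]
  · rw [norm_mul, RCLike.norm_conj]
    have h1 := h.norm_left_le n θ
    have h2 := norm_onCircle_interpPoly_mul_le (hx n) n s θ
    calc _ = ‖onCircle (P n) θ‖ *
          (n * ‖onCircle (interpPoly (x n) n s) θ‖ * ‖pt θ - pt s‖ ^ 2) := by ring
      _ ≤ 2 * 60 := mul_le_mul h1 h2 (by positivity) (by norm_num)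
      _ = 120 := by norm_num

/-- At scale `1/n` around a point of `E(μ)`, `φ̃_n` behaves like `Ã e^{ix} + B̃`. -/
theorem tendsto_right_interp (h : OPSystem μ F P Q) (hw : w =ᵐ[arc] μ.rnDeriv arc)
    (hs : s ∈ setE μ w) {x : ℕ → ℝ} (hx : ∀ n, |x n| ≤ Real.pi) :
    Tendsto (fun n => onCircle (Q n) (nearPt s (x n) n) - weightZero (x n) * onCircle (Q n) s -
      weightPi (x n) * onCircle (Q n) (nearPt s Real.pi n)) atTop (𝓝 0) := by
  have hlim := tendsto_cint_sub_mul_integral hw hs (C := 120)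
    (h := fun n θ => onCircle (interpPoly (x n) n s) θ * conj (onCircle (Q n) θ))
    (fun n => continuous_onCircle_mul_conj _ _) (fun n θ => ?_) (fun n θ => ?_)
  · have hint : ∀ n, ∫ θ, onCircle (interpPoly (x n) n s) θ * conj (onCircle (Q n) θ) ∂arc =
        conj (onCircle (Q n) (nearPt s (x n) n) - weightZero (x n) * onCircle (Q n) s -
          weightPi (x n) * onCircle (Q n) (nearPt s Real.pi n)) := by
      intro n
      rw [← integral_mul_conj_interpPoly (h.natDegree_right n).le, ← integral_conj]
      refine integral_congr_ae (Eventually.of_forall fun θ => ?_)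
      simp only [map_mul, Complex.conj_conj]
      ring
    simp only [← pairing_eq, h.orth_right _ _ (degree_interpPoly_lt _ _ _), zero_sub, hint] at hlim
    have h0 := h.density_ne_zero hw hs
    have := (Complex.continuous_conj.tendsto _).comp (hlim.const_mul (-(w s)⁻¹))
    rw [mul_zero, map_zero] at this
    refine this.congr fun n => ?_
    simp only [Function.comp]
    rw [neg_mul_neg, inv_mul_cancel_left₀ h0, Complex.conj_conj]
  · rw [norm_mul, RCLike.norm_conj]
    have h1 := h.norm_right_le n θ
    have h2 := norm_onCircle_interpPoly_le (x n) n s θ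
    nlinarith [norm_nonneg (onCircle (Q n) θ), norm_nonneg (onCircle (interpPoly (x n) n s) θ)]
  · rw [norm_mul, RCLike.norm_conj]
    have h1 := h.norm_right_le n θ
    have h2 := norm_onCircle_interpPoly_mul_le (hx n) n s θ
    calc _ = ‖onCircle (Q n) θ‖ *
          (n * ‖onCircle (interpPoly (x n) n s) θ‖ * ‖pt θ - pt s‖ ^ 2) := by ring
      _ ≤ 2 * 60 := mul_le_mul h1 h2 (by positivity) (by norm_num)
      _ = 120 := by norm_num

end OPSystem

/-! ### Limits of the local parameters -/

/-- The relations satisfied by limits `A, B` of the local parameters of `φ_n` (with the factor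
`s^n` absorbed into `A`) and `A', B'` of those of `φ̃_n`, where `W` is the reciprocal density. -/
structure LimitRelations (W A B A' B' : ℂ) : Prop where
  orth : A * conj B + A' * conj B' = 0
  norm_sq : ‖A‖ ^ 2 + ‖B‖ ^ 2 + ‖A'‖ ^ 2 + ‖B'‖ ^ 2 = 2
  density : A * conj A' - B * conj B' = W

theorem norm_sq_eq (z : ℂ) : ((‖z‖ ^ 2 : ℝ) : ℂ) = z * conj z := by
  rw [Complex.mul_conj, Complex.normSq_eq_norm_sq]

/-- The relation `|φ_n|² + |φ̃_n|² = 2` at the three points `x = 0, π/2, π` determines the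
relations between the parameters. -/
theorem limitRelations_of_norm_sq {W A B A' B' : ℂ}
    (h0 : ‖A + B‖ ^ 2 + ‖A' + B'‖ ^ 2 = 2) (hpi : ‖B - A‖ ^ 2 + ‖B' - A'‖ ^ 2 = 2)
    (hhalf : ‖Complex.I * A + B‖ ^ 2 + ‖Complex.I * A' + B'‖ ^ 2 = 2)
    (hW : A * conj A' - B * conj B' = W) : LimitRelations W A B A' B' := by
  have k0 := congrArg (fun x : ℝ => (x : ℂ)) h0
  have k1 := congrArg (fun x : ℝ => (x : ℂ)) hpi
  have k2 := congrArg (fun x : ℝ => (x : ℂ)) hhalf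
  simp only [Complex.ofReal_add, norm_sq_eq, map_add, map_sub, map_mul, Complex.conj_I,
    Complex.ofReal_ofNat] at k0 k1 k2
  refine ⟨?_, ?_, hW⟩
  · linear_combination ((1 + Complex.I) / 4 : ℂ) * k0 + ((-1 + Complex.I) / 4 : ℂ) * k1 -
      Complex.I / 2 * k2 + ((A * conj B + A' * conj B' - B * conj A - B' * conj A') / 2 -
        Complex.I / 2 * (A * conj A + A' * conj A')) * Complex.I_sq
  · have : ((‖A‖ ^ 2 + ‖B‖ ^ 2 + ‖A'‖ ^ 2 + ‖B'‖ ^ 2 : ℝ) : ℂ) = (2 : ℝ) := by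
      simp only [Complex.ofReal_add, norm_sq_eq, Complex.ofReal_ofNat]
      linear_combination (1 / 2 : ℂ) * k0 + (1 / 2 : ℂ) * k1
    exact_mod_cast this

namespace LimitRelations

variable {W A B A' B' : ℂ}

/-- If one parameter vanishes, the orthogonality relation makes a second one vanish. -/
theorem eq_zero_of_mul_eq_zero (h : LimitRelations W A B A' B') (hAB : A * B = 0) :
    (A = 0 ∧ A' = 0) ∨ (B = 0 ∧ B' = 0) ∨ (A = 0 ∧ B' = 0) ∨ (B = 0 ∧ A' = 0) := by
  have ho := h.orth
  rcases mul_eq_zero.1 hAB with rfl | rfl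
  · rw [zero_mul, zero_add] at ho
    rcases mul_eq_zero.1 ho with h1 | h1
    · exact .inl ⟨rfl, h1⟩
    · exact .inr (.inr (.inl ⟨rfl, by simpa using h1⟩))
  · rw [map_zero, mul_zero, zero_add] at ho
    rcases mul_eq_zero.1 ho with h1 | h1
    · exact .inr (.inr (.inr ⟨rfl, h1⟩))
    · exact .inr (.inl ⟨rfl, by simpa using h1⟩)

/-- If a parameter vanishes, the product at `x = 0` is `W` or `-W`. The cases in which the two
vanishing parameters have different types are excluded by `W ≠ 0`. -/
theorem sq_eq_of_mul_eq_zero (h : LimitRelations W A B A' B') (hW : W ≠ 0) (hAB : A * B = 0) :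
    ((A + B) * conj (A' + B')) ^ 2 = W ^ 2 := by
  have hd := h.density
  rcases h.eq_zero_of_mul_eq_zero hAB with ⟨rfl, rfl⟩ | ⟨rfl, rfl⟩ | ⟨rfl, rfl⟩ | ⟨rfl, rfl⟩
  · rw [← hd]; simp
  · rw [← hd]; simp
  · simp at hd; exact absurd hd.symm hW
  · simp at hd; exact absurd hd.symm hW

/-- If the product takes the value `W` at both `x = 0` and `x = π`, a parameter vanishes. -/
theorem mul_eq_zero_of_eq (h : LimitRelations W A B A' B')
    (h0 : (A + B) * conj (A' + B') = W) (hpi : (B - A) * conj (B' - A') = W) : A * B = 0 := by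
  have hd := h.density
  have ho := h.orth
  simp only [map_add, map_sub] at h0 hpi
  have : B * conj B' = 0 := by linear_combination (1 / 4 : ℂ) * h0 + (1 / 4 : ℂ) * hpi -
    (1 / 2 : ℂ) * hd
  rcases mul_eq_zero.1 this with h1 | h1
  · rw [h1, mul_zero]
  · rw [h1, mul_zero, add_zero] at ho
    rcases mul_eq_zero.1 ho with h2 | h2
    · rw [h2, zero_mul]
    · rw [(map_eq_zero _).1 h2, mul_zero]

/-- If the product takes the value `W` at `x = 0`, then `|AB|` is either zero or a number
determined by `W`. -/
theorem norm_mul_eq (h : LimitRelations W A B A' B')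
    (h0 : (A + B) * conj (A' + B') = W) (hAB : A * B ≠ 0) :
    ‖A * B‖ = √(‖W‖ ^ 4 * (1 - ‖W‖ ^ 2)) := by
  have hA : A ≠ 0 := left_ne_zero_of_mul hAB
  have hB : B ≠ 0 := right_ne_zero_of_mul hAB
  have hA' : A' ≠ 0 := by
    rintro rfl
    have := h.orth
    rw [zero_mul, add_zero] at this
    exact (mul_ne_zero hA ((_root_.map_ne_zero _).2 hB)) this
  have ho := h.orth
  have hd := h.density
  have ha : 0 < ‖A‖ ^ 2 := by positivity
  have hb : 0 < ‖B‖ ^ 2 := by positivity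
  have hc : 0 < ‖A'‖ ^ 2 := by positivity
  have hsum := h.norm_sq
  have hac : ‖A * B‖ ^ 2 = ‖A‖ ^ 2 * ‖B‖ ^ 2 := by rw [norm_mul, mul_pow]
  have hce : ‖A‖ ^ 2 * ‖B‖ ^ 2 = ‖A'‖ ^ 2 * ‖B'‖ ^ 2 := by
    have := congrArg norm (eq_neg_of_add_eq_zero_left ho)
    rw [norm_neg, norm_mul, norm_mul, RCLike.norm_conj, RCLike.norm_conj] at this
    rw [← mul_pow, ← mul_pow, this]
  -- `Y = A conj B` satisfies a quadratic equation with real coefficients and real roots.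
  obtain ⟨Y, hY⟩ : ∃ Y, Y = A * conj B := ⟨_, rfl⟩
  have hquad : Y ^ 2 + 2 * (‖B‖ ^ 2 : ℝ) * Y = (‖B‖ ^ 2 : ℝ) * (‖A'‖ ^ 2 : ℝ) := by
    have h1 : 2 * B * conj B' + A * conj B' + B * conj A' = 0 := by
      simp only [map_add] at h0
      linear_combination h0 - hd
    rw [norm_sq_eq, norm_sq_eq, hY]
    linear_combination (-(A' * conj B)) * h1 + (2 * B * conj B + A * conj B) * ho
  have him : Y.im = 0 := by
    have h1 := congrArg Complex.re hquad
    have h2 := congrArg Complex.im hquad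
    simp only [pow_two Y, Complex.add_re, Complex.add_im, Complex.mul_re, Complex.mul_im,
      Complex.ofReal_re, Complex.ofReal_im, Complex.re_ofNat, Complex.im_ofNat] at h1 h2
    have h3 : Y.im * (Y.re + ‖B‖ ^ 2) = 0 := by linarith
    rcases mul_eq_zero.1 h3 with h4 | h4
    · exact h4
    · nlinarith [sq_nonneg Y.im, sq_nonneg (‖B‖ ^ 2), mul_pos hb hc]
  obtain ⟨y, rfl⟩ : ∃ y : ℝ, (y : ℂ) = Y := ⟨Y.re, Complex.ext rfl him.symm⟩
  have hyq : y ^ 2 + 2 * ‖B‖ ^ 2 * y = ‖B‖ ^ 2 * ‖A'‖ ^ 2 := by exact_mod_cast hquad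
  have hy2 : y ^ 2 = ‖A‖ ^ 2 * ‖B‖ ^ 2 := by
    have := congrArg (fun z : ℂ => ‖z‖ ^ 2) hY
    simpa [mul_pow] using this
  have hlin : ‖A‖ ^ 2 + 2 * y - ‖A'‖ ^ 2 = 0 := by
    refine (mul_eq_zero.1 (?_ : ‖B‖ ^ 2 * (‖A‖ ^ 2 + 2 * y - ‖A'‖ ^ 2) = 0)).resolve_left hb.ne'
    linear_combination hyq - hy2
  have hV : ‖W‖ ^ 2 = ‖A‖ ^ 2 * ‖A'‖ ^ 2 + ‖B‖ ^ 2 * ‖B'‖ ^ 2 + 2 * (‖A‖ ^ 2 * ‖B‖ ^ 2) := by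
    have h1 : ((‖W‖ ^ 2 : ℝ) : ℂ) = ((‖A‖ ^ 2 * ‖A'‖ ^ 2 + ‖B‖ ^ 2 * ‖B'‖ ^ 2 +
        2 * (‖A‖ ^ 2 * ‖B‖ ^ 2) : ℝ) : ℂ) := by
      have ho' : conj A * B + conj A' * B' = 0 := by
        have := congrArg conj ho
        simpa using this
      rw [Complex.ofReal_add, Complex.ofReal_add, Complex.ofReal_mul, Complex.ofReal_mul,
        Complex.ofReal_mul, Complex.ofReal_mul, norm_sq_eq, norm_sq_eq, norm_sq_eq, norm_sq_eq,
        norm_sq_eq, Complex.ofReal_ofNat, ← hd]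
      simp only [map_sub, map_mul, Complex.conj_conj]
      linear_combination (-(A * conj B)) * ho' - (conj A * B) * ho
    exact_mod_cast h1
  rw [← Real.sqrt_sq (norm_nonneg (A * B)), hac]
  congr 1
  have e4 : ‖W‖ ^ 4 = (‖W‖ ^ 2) ^ 2 := by ring
  rw [e4]
  generalize ‖W‖ ^ 2 = V at *
  generalize ‖A‖ ^ 2 = a at *
  generalize ‖B‖ ^ 2 = b at *
  generalize ‖A'‖ ^ 2 = c at *
  generalize ‖B'‖ ^ 2 = e at *
  -- What remains is elimination of `c`, `e` and `y` from real polynomial relations.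
  have k1 : c * V = a * (b + c) ^ 2 := by rw [hV]; linear_combination (-b) * hce
  have k2 : (c + a) * (c + b) = 2 * c := by linear_combination c * hsum + hce
  have k3 : (c + a) ^ 2 = 4 * a * (b + c) := by
    linear_combination (a - c - 2 * y) * hlin + 4 * hy2
  have k4 : c = V * (b + c) := by
    have : 4 * c * c = 4 * c * (V * (b + c)) := by
      linear_combination (-((c + a) * (c + b) + 2 * c)) * k2 + (c + b) ^ 2 * k3 -
        4 * (b + c) * k1
    exact mul_left_cancel₀ (by positivity) this
  have k5 : c ^ 2 * (a * b) = c ^ 2 * (V ^ 2 * (1 - V)) := by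
    have : c * (1 - V) = V * b := by linear_combination k4
    linear_combination (-(c * V ^ 2)) * this - (V ^ 2 * b) * k1 +
      (a * b) * (c + V * (b + c)) * k4
  exact mul_left_cancel₀ (by positivity) k5

end LimitRelations

/-- A sequence with vanishing increments whose cluster points are among `u` and `v` converges to
`u` as soon as it does so along a subsequence. -/
theorem tendsto_of_tendsto_mul_sub {K : Type*} [NormedField K] {z : ℕ → K} {u v : K}
    (hz : Tendsto (fun n => (z n - u) * (z n - v)) atTop (𝓝 0))
    (hslow : Tendsto (fun n => z (n + 1) - z n) atTop (𝓝 0)) {m : ℕ → ℕ}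
    (hm : Tendsto m atTop atTop) (hu : Tendsto (fun k => z (m k)) atTop (𝓝 u)) :
    Tendsto z atTop (𝓝 u) := by
  rcases eq_or_ne u v with rfl | huv
  · rw [tendsto_iff_norm_sub_tendsto_zero]
    have := hz.norm.sqrt
    simpa [← pow_two, Real.sqrt_sq] using this
  set d := ‖u - v‖ with hd
  have hd0 : 0 < d := norm_pos_iff.2 (sub_ne_zero.2 huv)
  rw [Metric.tendsto_atTop]
  intro ε₀ hε₀
  set ε := min ε₀ (d / 4) with hε
  have hεpos : 0 < ε := lt_min hε₀ (by positivity)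
  have hε4 : ε ≤ d / 4 := min_le_right _ _
  have e1 : ∀ᶠ n in atTop, ‖z n - u‖ * ‖z n - v‖ < ε * (d / 4) := by
    have := hz.norm
    rw [norm_zero] at this
    filter_upwards [this.eventually_lt_const (by positivity : 0 < ε * (d / 4))] with n hn
    rwa [norm_mul] at hn
  have e2 : ∀ᶠ n in atTop, ‖z (n + 1) - z n‖ < d / 2 := by
    have := hslow.norm
    rw [norm_zero] at this
    exact this.eventually_lt_const (by positivity)
  obtain ⟨N, hN⟩ := eventually_atTop.1 (e1.and e2)
  -- Beyond `N` the distance to `u` is below `ε` or above `3d/4`.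
  have gap : ∀ n, N ≤ n → ε ≤ ‖z n - u‖ → 3 * d / 4 < ‖z n - u‖ := by
    intro n hn hle
    have h1 := (hN n hn).1
    have h2 : ‖z n - v‖ < d / 4 := by
      by_contra! h3
      exact absurd (mul_le_mul hle h3 (by positivity) (norm_nonneg _)) (not_le.2 h1)
    have h3 : d ≤ ‖z n - u‖ + ‖z n - v‖ := by
      rw [hd, norm_sub_rev (z n) u]; exact norm_sub_le_norm_sub_add_norm_sub u (z n) v
    linarith
  obtain ⟨k, hk1, hk2⟩ :=
    ((Metric.tendsto_nhds.1 hu ε hεpos).and (hm.eventually_ge_atTop N)).exists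
  refine ⟨m k, fun n hn => lt_of_lt_of_le ?_ (min_le_left ε₀ (d / 4))⟩
  induction n, hn using Nat.le_induction with
  | base => exact hk1
  | succ n hn ih =>
    rw [dist_eq_norm] at ih ⊢
    by_contra! hle
    have h1 := gap (n + 1) (hk2.trans (hn.trans n.le_succ)) hle
    have h2 := (hN n (hk2.trans hn)).2
    have h3 := norm_sub_le_norm_sub_add_norm_sub (z (n + 1)) (z n) u
    linarith

theorem tendsto_mul_sub_mul {x x' y y' : ℕ → ℂ} {C : ℝ} (hx : ∀ n, ‖x n‖ ≤ C)
    (hy : ∀ n, ‖y' n‖ ≤ C) (hxx : Tendsto (fun n => x' n - x n) atTop (𝓝 0))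
    (hyy : Tendsto (fun n => y' n - y n) atTop (𝓝 0)) :
    Tendsto (fun n => x' n * y' n - x n * y n) atTop (𝓝 0) := by
  have h1 : Tendsto (fun n => (x' n - x n) * y' n) atTop (𝓝 0) :=
    hxx.zero_mul_isBoundedUnder_le (isBoundedUnder_of ⟨C, hy⟩)
  have h2 : Tendsto (fun n => x n * (y' n - y n)) atTop (𝓝 0) :=
    isBoundedUnder_le_mul_tendsto_zero (isBoundedUnder_of ⟨C, hx⟩) hyy
  rw [← add_zero (0 : ℂ)]
  refine (h1.add h2).congr fun n => ?_
  ring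

namespace OPSystem

variable {μ : ComplexMeasure Torus} {F : ℕ → ℂ} {P Q : ℕ → ℂ[X]} {w : Torus → ℂ} {s : Torus}

theorem norm_left_mem_closedBall (h : OPSystem μ F P Q) (n : ℕ) (θ : Torus) :
    onCircle (P n) θ ∈ Metric.closedBall (0 : ℂ) 2 := by
  rw [mem_closedBall_zero_iff]; exact h.norm_left_le n θ

theorem norm_right_mem_closedBall (h : OPSystem μ F P Q) (n : ℕ) (θ : Torus) :
    onCircle (Q n) θ ∈ Metric.closedBall (0 : ℂ) 2 := by
  rw [mem_closedBall_zero_iff]; exact h.norm_right_le n θ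

/-- Compactness: along a further subsequence the local parameters converge, and the limits satisfy
the relations. -/
theorem exists_subseq_limitRelations (h : OPSystem μ F P Q) (hw : w =ᵐ[arc] μ.rnDeriv arc)
    (hs : s ∈ setE μ w) {m : ℕ → ℕ} (hm : Tendsto m atTop atTop) :
    ∃ (A B A' B' : ℂ) (k : ℕ → ℕ), Tendsto k atTop atTop ∧
      LimitRelations (w s)⁻¹ A B A' B' ∧
      Tendsto (fun j => onCircle (P (m (k j))) s) atTop (𝓝 (A + B)) ∧
      Tendsto (fun j => onCircle (P (m (k j))) (nearPt s Real.pi (m (k j)))) atTop (𝓝 (B - A)) ∧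
      Tendsto (fun j => onCircle (Q (m (k j))) s) atTop (𝓝 (A' + B')) ∧
      Tendsto (fun j => onCircle (Q (m (k j))) (nearPt s Real.pi (m (k j)))) atTop
        (𝓝 (B' - A')) := by
  have hK := ((isCompact_closedBall (0 : ℂ) 2).prod (isCompact_closedBall (0 : ℂ) 2)).prod
    ((isCompact_closedBall (0 : ℂ) 2).prod (isCompact_closedBall (0 : ℂ) 2))
  obtain ⟨⟨⟨a, b⟩, c, d⟩, -, k, hk, hlim⟩ := hK.tendsto_subseq
    (x := fun j => ((onCircle (P (m j)) s, onCircle (P (m j)) (nearPt s Real.pi (m j))),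
      (onCircle (Q (m j)) s, onCircle (Q (m j)) (nearPt s Real.pi (m j)))))
    fun j => ⟨⟨h.norm_left_mem_closedBall _ _, h.norm_left_mem_closedBall _ _⟩,
      h.norm_right_mem_closedBall _ _, h.norm_right_mem_closedBall _ _⟩
  have ha : Tendsto (fun j => onCircle (P (m (k j))) s) atTop (𝓝 a) := hlim.fst_nhds.fst_nhds
  have hb : Tendsto (fun j => onCircle (P (m (k j))) (nearPt s Real.pi (m (k j)))) atTop (𝓝 b) :=
    hlim.fst_nhds.snd_nhds
  have hc : Tendsto (fun j => onCircle (Q (m (k j))) s) atTop (𝓝 c) := hlim.snd_nhds.fst_nhds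
  have hd : Tendsto (fun j => onCircle (Q (m (k j))) (nearPt s Real.pi (m (k j)))) atTop (𝓝 d) :=
    hlim.snd_nhds.snd_nhds
  have hmk : Tendsto (fun j => m (k j)) atTop atTop := hm.comp hk.tendsto_atTop
  have hpi : |Real.pi / 2| ≤ Real.pi := by
    rw [abs_of_pos Real.pi_div_two_pos]; linarith [Real.pi_pos]
  have hp : Tendsto (fun j => onCircle (P (m (k j))) (nearPt s (Real.pi / 2) (m (k j)))) atTop
      (𝓝 (Complex.I * ((a - b) / 2) + (a + b) / 2)) := by
    have h1 := (h.tendsto_left_interp hw hs (x := fun _ => Real.pi / 2) fun _ => hpi).comp hmk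
    have h2 := (h1.add (ha.const_mul (weightZero (Real.pi / 2)))).add
      (hb.const_mul (weightPi (Real.pi / 2)))
    convert h2 using 1
    · ext j; simp only [Function.comp]; ring
    · rw [weightZero_half, weightPi_half]; congr 1; ring
  have hq : Tendsto (fun j => onCircle (Q (m (k j))) (nearPt s (Real.pi / 2) (m (k j)))) atTop
      (𝓝 (Complex.I * ((c - d) / 2) + (c + d) / 2)) := by
    have h1 := (h.tendsto_right_interp hw hs (x := fun _ => Real.pi / 2) fun _ => hpi).comp hmk
    have h2 := (h1.add (hc.const_mul (weightZero (Real.pi / 2)))).add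
      (hd.const_mul (weightPi (Real.pi / 2)))
    convert h2 using 1
    · ext j; simp only [Function.comp]; ring
    · rw [weightZero_half, weightPi_half]; congr 1; ring
  have hsq : ∀ {x y : ℂ} {θ : ℕ → Torus},
      Tendsto (fun j => onCircle (P (m (k j))) (θ j)) atTop (𝓝 x) →
      Tendsto (fun j => onCircle (Q (m (k j))) (θ j)) atTop (𝓝 y) → ‖x‖ ^ 2 + ‖y‖ ^ 2 = 2 := by
    intro x y θ hx hy
    refine tendsto_nhds_unique ((hx.norm.pow 2).add (hy.norm.pow 2)) ?_
    simp only [h.norm_sq_add_norm_sq]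
    exact tendsto_const_nhds
  have hW : w s * (a * conj d + b * conj c) = -2 := by
    have hcc := (Complex.continuous_conj.tendsto c).comp hc
    have hdc := (Complex.continuous_conj.tendsto d).comp hd
    exact tendsto_nhds_unique (((ha.mul hdc).add (hb.mul hcc)).const_mul (w s))
      ((h.tendsto_density_mul hw hs).comp hmk)
  have e1 : ∀ x y : ℂ, (x - y) / 2 + (x + y) / 2 = x := fun x y => by ring
  have e2 : ∀ x y : ℂ, (x + y) / 2 - (x - y) / 2 = y := fun x y => by ring
  refine ⟨(a - b) / 2, (a + b) / 2, (c - d) / 2, (c + d) / 2, k, hk.tendsto_atTop, ?_, ?_, ?_, ?_,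
    ?_⟩
  · refine limitRelations_of_norm_sq ?_ ?_ (hsq hp hq) ?_
    · rw [e1, e1]; exact hsq ha hc
    · rw [e2, e2]; exact hsq hb hd
    · have hw0 := h.density_ne_zero hw hs
      rw [eq_comm, inv_eq_of_mul_eq_one_right]
      simp only [map_div₀, map_add, map_sub, map_ofNat]
      linear_combination (-1 / 2 : ℂ) * hW
  · rwa [e1]
  · rwa [e2]
  · rwa [e1]
  · rwa [e2]

end OPSystem

/-! ### Convergence at a fixed point of `E(μ)` -/

/-- The product `((φ(s) - φ(s γ_n)) / 2) ((φ(s) + φ(s γ_n)) / 2)`, which is `s^n A_{n,s} B_{n,s}`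
when `φ = φ_n`. -/
def localProd (p : ℂ[X]) (n : ℕ) (s : Torus) : ℂ :=
  (onCircle p s ^ 2 - onCircle p (nearPt s Real.pi n) ^ 2) / 4

theorem nearPt_pi_succ (s : Torus) {n : ℕ} (hn : n ≠ 0) :
    nearPt s Real.pi (n + 1) = nearPt s (Real.pi * (n / (n + 1 : ℕ))) n := by
  have : (n : ℝ) ≠ 0 := Nat.cast_ne_zero.2 hn
  rw [nearPt, nearPt]
  congr 2
  field_simp

theorem tendsto_pi_mul_div : Tendsto (fun n : ℕ => Real.pi * ((n : ℝ) / (n + 1 : ℕ))) atTop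
    (𝓝 Real.pi) := by
  have := (tendsto_natCast_div_add_atTop (1 : ℝ)).const_mul Real.pi
  rw [mul_one] at this
  exact_mod_cast this

theorem abs_pi_mul_div_le (n : ℕ) : |Real.pi * ((n : ℝ) / (n + 1 : ℕ))| ≤ Real.pi := by
  rw [abs_of_nonneg (by positivity)]
  refine mul_le_of_le_one_right Real.pi_pos.le ((div_le_one (by positivity)).2 ?_)
  push_cast; linarith

theorem weightZero_pi : weightZero Real.pi = 0 := by
  rw [weightZero, mul_comm, Complex.exp_pi_mul_I]; ring

theorem weightPi_pi : weightPi Real.pi = 1 := by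
  rw [weightPi, mul_comm, Complex.exp_pi_mul_I]; ring

theorem continuous_weightZero : Continuous weightZero := by
  unfold weightZero; fun_prop

theorem continuous_weightPi : Continuous weightPi := by
  unfold weightPi; fun_prop

theorem tendsto_localProd {R : ℕ → ℂ[X]} {s : Torus} {m : ℕ → ℕ} {A B : ℂ}
    (h0 : Tendsto (fun j => onCircle (R (m j)) s) atTop (𝓝 (A + B)))
    (hpi : Tendsto (fun j => onCircle (R (m j)) (nearPt s Real.pi (m j))) atTop (𝓝 (B - A))) :
    Tendsto (fun j => localProd (R (m j)) (m j) s) atTop (𝓝 (A * B)) := by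
  have e : A * B = ((A + B) ^ 2 - (B - A) ^ 2) / 4 := by ring
  rw [e]
  exact ((h0.pow 2).sub (hpi.pow 2)).div_const 4

/-- Comparison of the points `s γ_{n+1}` and `s γ_n` for functions that interpolate at scale `1/n`
and are nearly multiplied by `z` when passing from `n` to `n + 1`. -/
theorem tendsto_nearPt_succ {R : ℕ → ℂ[X]} {s : Torus} (hb : ∀ n θ, ‖onCircle (R n) θ‖ ≤ 2)
    (hint : Tendsto (fun n : ℕ => onCircle (R n) (nearPt s (Real.pi * (n / (n + 1 : ℕ))) n) -
      weightZero (Real.pi * (n / (n + 1 : ℕ))) * onCircle (R n) s -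
      weightPi (Real.pi * (n / (n + 1 : ℕ))) * onCircle (R n) (nearPt s Real.pi n)) atTop (𝓝 0))
    (hstep : Tendsto (fun n => onCircle (R (n + 1)) (nearPt s Real.pi (n + 1)) -
      pt (nearPt s Real.pi (n + 1)) * onCircle (R n) (nearPt s Real.pi (n + 1))) atTop (𝓝 0)) :
    Tendsto (fun n => onCircle (R (n + 1)) (nearPt s Real.pi (n + 1)) -
      pt s * onCircle (R n) (nearPt s Real.pi n)) atTop (𝓝 0) := by
  have h1 : Tendsto (fun n : ℕ => weightZero (Real.pi * (n / (n + 1 : ℕ))) * onCircle (R n) s)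
      atTop (𝓝 0) := by
    have := (continuous_weightZero.tendsto Real.pi).comp tendsto_pi_mul_div
    rw [weightZero_pi] at this
    exact this.zero_mul_isBoundedUnder_le (isBoundedUnder_of ⟨2, fun n => hb n s⟩)
  have h2 : Tendsto (fun n : ℕ => (weightPi (Real.pi * (n / (n + 1 : ℕ))) - 1) *
      onCircle (R n) (nearPt s Real.pi n)) atTop (𝓝 0) := by
    have := ((continuous_weightPi.tendsto Real.pi).comp tendsto_pi_mul_div).sub_const 1
    rw [weightPi_pi, sub_self] at this
    exact this.zero_mul_isBoundedUnder_le (isBoundedUnder_of ⟨2, fun n => hb n _⟩)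
  have h3 : Tendsto (fun n : ℕ => (pt (nearPt s Real.pi (n + 1)) - pt s) *
      onCircle (R n) (nearPt s Real.pi (n + 1))) atTop (𝓝 0) := by
    refine Tendsto.zero_mul_isBoundedUnder_le (squeeze_zero_norm
      (fun n => norm_pt_nearPt_sub_le s Real.pi (n + 1)) ?_)
      (isBoundedUnder_of ⟨2, fun n => hb n _⟩)
    exact (tendsto_const_div_atTop_nhds_zero_nat |Real.pi|).comp (tendsto_add_atTop_nat 1)
  have h4 := (hstep.add h3).add (((hint.add h1).add h2).const_mul (pt s))
  simp only [add_zero, mul_zero] at h4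
  refine h4.congr' ?_
  filter_upwards [eventually_ne_atTop 0] with n hn
  rw [← nearPt_pi_succ s hn]
  ring

namespace OPSystem

variable {μ : ComplexMeasure Torus} {F : ℕ → ℂ} {P Q : ℕ → ℂ[X]} {w : Torus → ℂ} {s : Torus}

theorem tendsto_left_succ_sub (h : OPSystem μ F P Q) (hF : Tendsto (fun n => ‖F n‖) atTop (𝓝 0))
    (θ : ℕ → Torus) :
    Tendsto (fun n => onCircle (P (n + 1)) (θ n) - pt (θ n) * onCircle (P n) (θ n)) atTop
      (𝓝 0) := by
  refine squeeze_zero_norm (fun n => h.norm_left_succ_sub_le n (θ n)) ?_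
  simpa using (hF.comp (tendsto_add_atTop_nat 1)).const_mul 4

theorem tendsto_right_succ_sub (h : OPSystem μ F P Q) (hF : Tendsto (fun n => ‖F n‖) atTop (𝓝 0))
    (θ : ℕ → Torus) :
    Tendsto (fun n => onCircle (Q (n + 1)) (θ n) - pt (θ n) * onCircle (Q n) (θ n)) atTop
      (𝓝 0) := by
  refine squeeze_zero_norm (fun n => h.norm_right_succ_sub_le n (θ n)) ?_
  simpa using (hF.comp (tendsto_add_atTop_nat 1)).const_mul 4

theorem tendsto_left_sq_succ_sub (h : OPSystem μ F P Q) {θ : ℕ → Torus}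
    (hθ : Tendsto (fun n => onCircle (P (n + 1)) (θ (n + 1)) - pt s * onCircle (P n) (θ n)) atTop
      (𝓝 0)) :
    Tendsto (fun n => onCircle (P (n + 1)) (θ (n + 1)) ^ 2 -
      pt s ^ 2 * onCircle (P n) (θ n) ^ 2) atTop (𝓝 0) := by
  have hb : ∀ n, ‖pt s * onCircle (P n) (θ n)‖ ≤ 2 := fun n => by
    rw [norm_mul, norm_pt, one_mul]; exact h.norm_left_le n _
  have hb' : ∀ n, ‖onCircle (P (n + 1)) (θ (n + 1))‖ ≤ 2 := fun n => h.norm_left_le _ _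
  have := tendsto_mul_sub_mul hb hb' hθ hθ
  simp only [← pow_two, mul_pow] at this
  exact this

/-- If `F_n → 0`, the modulus of `A_{n,s} B_{n,s}` varies slowly with `n`. -/
theorem tendsto_norm_localProd_succ_sub (h : OPSystem μ F P Q) (hw : w =ᵐ[arc] μ.rnDeriv arc)
    (hs : s ∈ setE μ w) (hF : Tendsto (fun n => ‖F n‖) atTop (𝓝 0)) :
    Tendsto (fun n => ‖localProd (P (n + 1)) (n + 1) s‖ - ‖localProd (P n) n s‖) atTop (𝓝 0) := by
  have h1 := h.tendsto_left_sq_succ_sub (θ := fun _ => s) (h.tendsto_left_succ_sub hF fun _ => s)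
  have h2 := h.tendsto_left_sq_succ_sub (θ := fun n => nearPt s Real.pi n)
    (tendsto_nearPt_succ h.norm_left_le (h.tendsto_left_interp hw hs abs_pi_mul_div_le)
      (h.tendsto_left_succ_sub hF fun n => nearPt s Real.pi (n + 1)))
  have h3 := (h1.sub h2).norm.div_const 4
  rw [sub_zero, norm_zero, zero_div] at h3
  refine squeeze_zero_norm (fun n => ?_) h3
  have h4 : ‖localProd (P n) n s‖ = ‖pt s ^ 2 * localProd (P n) n s‖ := by
    rw [norm_mul, norm_pow, norm_pt, one_pow, one_mul]
  rw [h4, Real.norm_eq_abs]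
  refine (abs_norm_sub_norm_le _ _).trans (le_of_eq ?_)
  rw [← Complex.norm_ofNat (n := 4), ← norm_div]
  congr 1
  rw [localProd, localProd]
  ring

/-- If `F_n → 0`, the product `φ_n^* φ̃_n` varies slowly with `n`. -/
theorem tendsto_conj_mul_succ_sub (h : OPSystem μ F P Q)
    (hF : Tendsto (fun n => ‖F n‖) atTop (𝓝 0)) (s : Torus) :
    Tendsto (fun n => conj (onCircle (P (n + 1)) s) * onCircle (Q (n + 1)) s -
      conj (onCircle (P n) s) * onCircle (Q n) s) atTop (𝓝 0) := by
  have h1 := (Complex.continuous_conj.tendsto 0).comp (h.tendsto_left_succ_sub hF fun _ => s)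
  rw [map_zero] at h1
  refine (tendsto_mul_sub_mul (C := 2) (x := fun n => conj (pt s * onCircle (P n) s))
    (x' := fun n => conj (onCircle (P (n + 1)) s)) (fun n => ?_)
    (fun n => h.norm_right_le (n + 1) s)
    (h1.congr fun n => by simp) (h.tendsto_right_succ_sub hF fun _ => s)).congr fun n => ?_
  · rw [RCLike.norm_conj, norm_mul, norm_pt, one_mul]; exact h.norm_left_le n _
  · rw [map_mul]
    linear_combination (-(conj (onCircle (P n) s) * onCircle (Q n) s)) * conj_pt_mul s

/-- If `A_{n,s} B_{n,s} → 0` along a sequence, the square of `φ_n^* φ̃_n` converges along it. -/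
theorem tendsto_sq_of_tendsto_localProd (h : OPSystem μ F P Q) (hw : w =ᵐ[arc] μ.rnDeriv arc)
    (hs : s ∈ setE μ w) {m : ℕ → ℕ} (hm : Tendsto m atTop atTop)
    (hAB : Tendsto (fun k => localProd (P (m k)) (m k) s) atTop (𝓝 0)) :
    Tendsto (fun k => (conj (onCircle (P (m k)) s) * onCircle (Q (m k)) s) ^ 2) atTop
      (𝓝 (conj (w s)⁻¹ ^ 2)) := by
  refine tendsto_of_subseq_tendsto fun ns hns => ?_
  obtain ⟨A, B, A', B', k, hk, hrel, ha, hb, hc, -⟩ :=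
    h.exists_subseq_limitRelations hw hs (hm.comp hns)
  refine ⟨k, ?_⟩
  have hAB' : A * B = 0 := tendsto_nhds_unique (tendsto_localProd ha hb) (hAB.comp (hns.comp hk))
  have hsq := hrel.sq_eq_of_mul_eq_zero (inv_ne_zero (h.density_ne_zero hw hs)) hAB'
  have hlim := (((Complex.continuous_conj.tendsto _).comp ha).mul hc).pow 2
  have e : conj (w s)⁻¹ ^ 2 = (conj (A + B) * (A' + B')) ^ 2 := by
    rw [← map_pow, ← hsq, map_pow, map_mul, Complex.conj_conj]
  rw [e]
  exact hlim

/-- If the square of `φ_n^* φ̃_n` converges at a point of `E(μ)`, `F_n → 0`, and along some sequence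
`φ_n^* φ̃_n` has the right limit both at `s` and at `s γ_n`, then the whole sequence has the right
limit at `s`, and `A_{n,s} B_{n,s} → 0`. -/
theorem tendsto_of_tendsto_sq (h : OPSystem μ F P Q) (hw : w =ᵐ[arc] μ.rnDeriv arc)
    (hs : s ∈ setE μ w) (hF : Tendsto (fun n => ‖F n‖) atTop (𝓝 0)) {m : ℕ → ℕ}
    (hm : Tendsto m atTop atTop)
    (h0 : Tendsto (fun k => conj (onCircle (P (m k)) s) * onCircle (Q (m k)) s) atTop
      (𝓝 (conj (w s)⁻¹)))
    (hpi : Tendsto (fun k => conj (onCircle (P (m k)) (nearPt s Real.pi (m k))) *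
      onCircle (Q (m k)) (nearPt s Real.pi (m k))) atTop (𝓝 (conj (w s)⁻¹)))
    (hsq : Tendsto (fun n => (conj (onCircle (P n) s) * onCircle (Q n) s) ^ 2) atTop
      (𝓝 (conj (w s)⁻¹ ^ 2))) :
    Tendsto (fun n => conj (onCircle (P n) s) * onCircle (Q n) s) atTop (𝓝 (conj (w s)⁻¹)) ∧
      Tendsto (fun n => localProd (P n) n s) atTop (𝓝 0) := by
  have hprod : Tendsto (fun n => conj (onCircle (P n) s) * onCircle (Q n) s) atTop
      (𝓝 (conj (w s)⁻¹)) := by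
    refine tendsto_of_tendsto_mul_sub (v := -conj (w s)⁻¹) ?_ (h.tendsto_conj_mul_succ_sub hF s)
      hm h0
    have := hsq.sub_const (conj (w s)⁻¹ ^ 2)
    rw [sub_self] at this
    exact this.congr fun n => by ring
  refine ⟨hprod, ?_⟩
  have hval : ∀ {ns : ℕ → ℕ} {θ : ℕ → Torus} {x y : ℂ},
      Tendsto (fun j => onCircle (P (ns j)) (θ j)) atTop (𝓝 x) →
      Tendsto (fun j => onCircle (Q (ns j)) (θ j)) atTop (𝓝 y) →
      Tendsto (fun j => conj (onCircle (P (ns j)) (θ j)) * onCircle (Q (ns j)) (θ j)) atTop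
        (𝓝 (conj (w s)⁻¹)) → x * conj y = (w s)⁻¹ := by
    intro ns θ x y hx hy hxy
    have := congrArg conj (tendsto_nhds_unique
      (((Complex.continuous_conj.tendsto x).comp hx).mul hy) hxy)
    simpa only [map_mul, Complex.conj_conj] using this
  -- The modulus is slowly varying with at most two cluster points, and a subsequence of `m`
  -- takes it to zero.
  rw [tendsto_zero_iff_norm_tendsto_zero]
  obtain ⟨A, B, A', B', k, hk, hrel, ha, hb, hc, hd⟩ := h.exists_subseq_limitRelations hw hs hm
  refine tendsto_of_tendsto_mul_sub
    (v := √(‖(w s)⁻¹‖ ^ 4 * (1 - ‖(w s)⁻¹‖ ^ 2))) ?_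
    (h.tendsto_norm_localProd_succ_sub hw hs hF) (hm.comp hk) ?_
  · refine tendsto_of_subseq_tendsto fun ns hns => ?_
    obtain ⟨A, B, A', B', k, hk, hrel, ha, hb, hc, -⟩ := h.exists_subseq_limitRelations hw hs hns
    refine ⟨k, ?_⟩
    have h1 := (tendsto_localProd ha hb).norm
    have e : (‖A * B‖ - 0) * (‖A * B‖ - √(‖(w s)⁻¹‖ ^ 4 * (1 - ‖(w s)⁻¹‖ ^ 2))) = 0 := by
      rcases eq_or_ne (A * B) 0 with h3 | h3
      · simp [h3]
      · rw [hrel.norm_mul_eq (hval ha hc (hprod.comp (hns.comp hk))) h3, sub_self, mul_zero]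
    have h2 := (h1.sub_const 0).mul
      (h1.sub_const (√(‖(w s)⁻¹‖ ^ 4 * (1 - ‖(w s)⁻¹‖ ^ 2))))
    rwa [e] at h2
  · have h1 := (tendsto_localProd ha hb).norm
    rw [hrel.mul_eq_zero_of_eq (hval ha hc (h0.comp hk)) (hval hb hd (hpi.comp hk)),
      norm_zero] at h1
    exact h1

end OPSystem

/-! ### Peak functions on compact null sets -/

/-- The length of a ball that does not wrap around the circle. -/
theorem arc_real_closedBall (s : Torus) {r : ℝ} (hr : 0 ≤ r) (hr' : r ≤ Real.pi) :
    arc.real (Metric.closedBall s r) = r / Real.pi := by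
  have h := AddCircle.volume_closedBall (2 * Real.pi) (x := s) r
  rw [volume_eq, Measure.smul_apply, smul_eq_mul, min_eq_right (by linarith)] at h
  have h2 := congrArg ENNReal.toReal h
  rw [ENNReal.toReal_mul, ENNReal.toReal_ofReal Real.two_pi_pos.le,
    ENNReal.toReal_ofReal (by linarith)] at h2
  rw [eq_div_iff Real.pi_ne_zero, Measure.real]
  linarith

/-- A compact null set has, at arbitrarily fine scales `δ`, a finite `δ`-net with `δ` times the
number of points small: the balls of radius `δ / 2` around a maximal separated set are disjoint and
lie in a small neighbourhood. -/
theorem exists_net {N : Set Torus} (hN : IsCompact N) (h0 : arc N = 0) {η : ℝ} (hη : 0 < η) :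
    ∃ δ : ℝ, 0 < δ ∧ ∃ T : Finset Torus, (∀ x ∈ T, x ∈ N) ∧ (∀ θ ∈ N, ∃ x ∈ T, ‖θ - x‖ ≤ δ) ∧
      T.card * δ ≤ η := by
  have hlim : Tendsto (fun r => arc.real (Metric.cthickening r N)) (𝓝[>] 0) (𝓝 0) := by
    have h1 := (ENNReal.tendsto_toReal (measure_ne_top arc N)).comp
      (tendsto_measure_cthickening_of_isCompact (μ := arc) hN)
    rw [h0, ENNReal.toReal_zero] at h1
    exact h1.mono_left nhdsWithin_le_nhds
  have hlt : ∀ᶠ r : ℝ in 𝓝[>] 0, r < 1 := nhdsWithin_le_nhds (Iio_mem_nhds one_pos)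
  obtain ⟨δ, ⟨h1, h3⟩, h2⟩ := (((hlim.eventually_lt_const
    (by positivity : 0 < η / (2 * Real.pi))).and hlt).and eventually_mem_nhdsWithin).exists
  rw [Set.mem_Ioi] at h2
  obtain ⟨ε, rfl⟩ : ∃ ε : NNReal, (ε : ℝ) = δ := ⟨⟨δ, h2.le⟩, rfl⟩
  have hpack : Metric.packingNumber ε N ≠ ⊤ := by
    obtain ⟨C, -, hCf, hC⟩ := Metric.exists_finite_isCover_of_isCompact (ε := ε / 2)
      (by have : 0 < ε := by exact_mod_cast h2
          positivity) hN
    have h4 := Metric.packingNumber_two_mul_le_externalCoveringNumber (ε / 2) N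
    rw [mul_div_cancel₀ ε (two_ne_zero)] at h4
    exact ne_top_of_le_ne_top (Set.encard_ne_top_iff.2 hCf)
      (h4.trans hC.externalCoveringNumber_le_encard)
  have hfin : (Metric.maximalSeparatedSet ε N).Finite := by
    rw [← Set.encard_ne_top_iff, Metric.encard_maximalSeparatedSet hpack]; exact hpack
  have hsub : ∀ x ∈ hfin.toFinset, x ∈ N := fun x hx =>
    Metric.maximalSeparatedSet_subset (hfin.mem_toFinset.1 hx)
  refine ⟨ε, h2, hfin.toFinset, hsub, fun θ hθ => ?_, ?_⟩
  · obtain ⟨x, hx, hd⟩ := Metric.isCover_maximalSeparatedSet hpack hθ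
    refine ⟨x, hfin.mem_toFinset.2 hx, ?_⟩
    rw [← dist_eq_norm, ← coe_nndist, NNReal.coe_le_coe]
    have hd' : edist θ x ≤ ε := hd
    rwa [edist_nndist, ENNReal.coe_le_coe] at hd'
  · have hdisj : (hfin.toFinset : Set Torus).PairwiseDisjoint
        fun x => Metric.closedBall x (ε / 2 : ℝ) := by
      intro x hx y hy hxy
      have h4 : (ε : ENNReal) < edist x y :=
        Metric.isSeparated_maximalSeparatedSet (hfin.mem_toFinset.1 hx) (hfin.mem_toFinset.1 hy) hxy
      refine Metric.closedBall_disjoint_closedBall ?_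
      rw [add_halves, ← coe_nndist, NNReal.coe_lt_coe]
      rwa [edist_nndist, ENNReal.coe_lt_coe] at h4
    have h4 := measureReal_biUnion_finset (μ := arc) hdisj fun x _ => measurableSet_closedBall
    rw [Finset.sum_congr rfl fun x _ => arc_real_closedBall x (by positivity)
      (by linarith [Real.pi_gt_three])] at h4
    have h5 : (⋃ x ∈ hfin.toFinset, Metric.closedBall x (ε / 2 : ℝ)) ⊆ Metric.cthickening ε N :=
      Set.iUnion₂_subset fun x hx =>
        (Metric.closedBall_subset_closedBall (by linarith)).trans
          (Metric.closedBall_subset_cthickening (hsub x hx) _)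
    have h6 := (h4.symm.le.trans (measureReal_mono h5)).trans_lt h1
    rw [Finset.sum_const, nsmul_eq_mul, div_div, ← mul_div_assoc] at h6
    exact ((div_lt_div_iff_of_pos_right Real.two_pi_pos).1 h6).le

/-- The sum of `M δ` times the Cauchy kernels with poles at the points `(1 + δ) x`, `x ∈ T`, just
outside the circle. -/
def poleSum (M δ : ℝ) (T : Finset Torus) (z : ℂ) : ℂ :=
  (M * δ : ℝ) * ∑ x ∈ T, (1 + δ - z * conj (pt x))⁻¹

theorem re_inv_nonneg {u : ℂ} (hu : 0 ≤ u.re) : 0 ≤ (u⁻¹).re := by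
  rw [Complex.inv_re]; exact div_nonneg hu (Complex.normSq_nonneg _)

theorem re_mul_conj_pt_le (z : ℂ) (x : Torus) : (z * conj (pt x)).re ≤ ‖z‖ := by
  refine (Complex.re_le_norm _).trans ?_
  rw [norm_mul, RCLike.norm_conj, norm_pt, mul_one]

section poleSum

variable {M δ : ℝ} {T : Finset Torus}

theorem re_poleSum_nonneg (hM : 0 ≤ M) (hδ : 0 ≤ δ) {z : ℂ} (hz : ‖z‖ ≤ 1 + δ) :
    0 ≤ (poleSum M δ T z).re := by
  rw [poleSum, Complex.re_ofReal_mul, Complex.re_sum]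
  refine mul_nonneg (mul_nonneg hM hδ) (Finset.sum_nonneg fun x _ => re_inv_nonneg ?_)
  have := re_mul_conj_pt_le z x
  simp only [Complex.sub_re, Complex.add_re, Complex.one_re, Complex.ofReal_re]
  linarith

theorem one_add_ne_zero_of_re_nonneg {u : ℂ} (hu : 0 ≤ u.re) : 1 + u ≠ 0 := by
  intro h
  have := congrArg Complex.re h
  simp at this
  linarith

theorem one_le_norm_one_add {u : ℂ} (hu : 0 ≤ u.re) : 1 ≤ ‖1 + u‖ := by
  refine le_trans ?_ (Complex.re_le_norm _)
  simp [hu]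

theorem differentiableOn_poleSum : DifferentiableOn ℂ (poleSum M δ T) (Metric.ball 0 (1 + δ)) := by
  unfold poleSum
  refine DifferentiableOn.const_mul (DifferentiableOn.fun_sum fun x _ => ?_) _
  refine DifferentiableOn.inv (by fun_prop) fun z hz h => ?_
  have h1 := re_mul_conj_pt_le z x
  have h2 := congrArg Complex.re h
  rw [mem_ball_zero_iff] at hz
  simp only [Complex.sub_re, Complex.add_re, Complex.one_re, Complex.ofReal_re,
    Complex.zero_re] at h2
  linarith

theorem norm_poleSum_zero_le (hM : 0 ≤ M) (hδ : 0 ≤ δ) : ‖poleSum M δ T 0‖ ≤ M * (T.card * δ) := by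
  have h1 : (1 : ℝ) ≤ ‖(1 + δ : ℂ)‖ := one_le_norm_one_add (by simpa using hδ)
  simp only [poleSum, zero_mul, sub_zero, Finset.sum_const, nsmul_eq_mul, norm_mul, norm_inv,
    Complex.norm_natCast, Complex.norm_real, Real.norm_eq_abs, abs_of_nonneg hM, abs_of_nonneg hδ]
  calc M * δ * (T.card * ‖(1 + δ : ℂ)‖⁻¹) ≤ M * δ * (T.card * 1) := by
        gcongr; exact inv_le_one_of_one_le₀ h1
    _ = M * (T.card * δ) := by ring

/-- Away from `T` the sum of kernels is of the order of `M` times the total length `card T * δ`. -/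
theorem norm_poleSum_le (hM : 0 ≤ M) (hδ : 0 ≤ δ) {θ : Torus} {d : ℝ} (hd : 0 < d)
    (h : ∀ x ∈ T, d ≤ ‖pt θ - pt x‖) : ‖poleSum M δ T (pt θ)‖ ≤ M * (T.card * δ) / d := by
  have h1 : ∀ x ∈ T, ‖(1 + δ - pt θ * conj (pt x))⁻¹‖ ≤ 1 / d := by
    intro x hx
    rw [norm_inv, ← one_div]
    refine one_div_le_one_div_of_le hd ((h x hx).trans ?_)
    rw [← norm_one_sub_pt_mul_conj]
    refine abs_le_of_sq_le_sq' ?_ (norm_nonneg _) |>.2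
    have h2 := re_mul_conj_pt_le (pt θ) x
    rw [norm_pt] at h2
    rw [← Complex.normSq_eq_norm_sq, ← Complex.normSq_eq_norm_sq, Complex.normSq_apply,
      Complex.normSq_apply]
    simp only [Complex.sub_re, Complex.add_re, Complex.one_re, Complex.ofReal_re, Complex.sub_im,
      Complex.add_im, Complex.one_im, Complex.ofReal_im]
    nlinarith
  rw [poleSum, norm_mul, Complex.norm_real, Real.norm_eq_abs, abs_of_nonneg (by positivity)]
  calc M * δ * ‖∑ x ∈ T, (1 + δ - pt θ * conj (pt x))⁻¹‖ ≤ M * δ * (T.card * (1 / d)) := by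
        gcongr
        refine (norm_sum_le _ _).trans ((Finset.sum_le_card_nsmul _ _ _ h1).trans ?_)
        rw [nsmul_eq_mul]
    _ = M * (T.card * δ) / d := by ring

/-- Within `δ` of a point of `T`, the kernel with pole at that point alone contributes `M / 4`. -/
theorem le_re_poleSum (hM : 0 ≤ M) (hδ : 0 < δ) {θ : Torus} {x : Torus} (hx : x ∈ T)
    (hθ : ‖θ - x‖ ≤ δ) : M / 4 ≤ (poleSum M δ T (pt θ)).re := by
  have hre : ∀ y : Torus, δ ≤ (1 + δ - pt θ * conj (pt y) : ℂ).re := by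
    intro y
    have := re_mul_conj_pt_le (pt θ) y
    rw [norm_pt] at this
    simp only [Complex.sub_re, Complex.add_re, Complex.one_re, Complex.ofReal_re]
    linarith
  have h1 : 1 / (4 * δ) ≤ ((1 + δ - pt θ * conj (pt x) : ℂ)⁻¹).re := by
    have h2 : ‖(1 + δ - pt θ * conj (pt x) : ℂ)‖ ≤ 2 * δ := by
      have e : (1 + δ - pt θ * conj (pt x) : ℂ) = (1 - pt θ * conj (pt x)) + δ := by ring
      rw [e]
      refine (norm_add_le _ _).trans ?_
      rw [norm_one_sub_pt_mul_conj, Complex.norm_real, Real.norm_eq_abs, abs_of_pos hδ]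
      linarith [norm_pt_sub_le θ x]
    have h3 : 0 < Complex.normSq (1 + δ - pt θ * conj (pt x) : ℂ) := by
      refine Complex.normSq_pos.2 fun h => ?_
      have := hre x
      rw [h, Complex.zero_re] at this
      linarith
    rw [Complex.inv_re, div_le_div_iff₀ (by positivity) h3, Complex.normSq_eq_norm_sq, one_mul]
    have h4 := pow_le_pow_left₀ (norm_nonneg _) h2 2
    nlinarith [hre x]
  rw [poleSum, Complex.re_ofReal_mul, Complex.re_sum]
  calc M / 4 = M * δ * (1 / (4 * δ)) := by field_simp
    _ ≤ M * δ * ∑ y ∈ T, ((1 + δ - pt θ * conj (pt y) : ℂ)⁻¹).re := by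
        gcongr
        exact h1.trans (Finset.single_le_sum
          (f := fun y => ((1 + δ - pt θ * conj (pt y) : ℂ)⁻¹).re)
          (fun y _ => re_inv_nonneg (hδ.le.trans (hre y))) hx)

end poleSum

/-- For a compact null set `N` of the circle there are functions, analytic past the closed unit
disc and bounded by `2` on it, that tend to `1` on `N`, to `0` on the rest of the circle, and to `0`
at the origin. -/
theorem exists_peak {N : Set Torus} (hN : IsCompact N) (h0 : arc N = 0) :
    ∃ G : ℕ → ℂ → ℂ, (∀ m, ∃ R > 1, DifferentiableOn ℂ (G m) (Metric.ball 0 R)) ∧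
      (∀ m θ, ‖G m (pt θ)‖ ≤ 2) ∧ Tendsto (fun m => G m 0) atTop (𝓝 0) ∧
      ∀ θ, Tendsto (fun m => G m (pt θ)) atTop (𝓝 (N.indicator (fun _ => 1) θ)) := by
  have hnet := fun m : ℕ => exists_net hN h0 (η := 1 / ((m + 1 : ℕ) : ℝ) ^ 2) (by positivity)
  choose δ hδ T hTN hcov hcard using hnet
  -- `H m` has nonnegative real part, is large on `N` and small elsewhere, and `u ↦ u / (1 + u)`
  -- turns it into a bounded function close to `1` or `0`.
  set H : ℕ → ℂ → ℂ := fun m => poleSum (m + 1 : ℕ) (δ m) (T m) with hH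
  have hre : ∀ m z, ‖z‖ ≤ 1 + δ m → 0 ≤ (H m z).re := fun m z hz =>
    re_poleSum_nonneg (by positivity) (hδ m).le hz
  have hpt : ∀ m θ, 0 ≤ (H m (pt θ)).re := fun m θ =>
    hre m _ (by rw [norm_pt]; linarith [hδ m])
  have hz0 : ∀ m, 0 ≤ (H m 0).re := fun m => hre m 0 (by rw [norm_zero]; linarith [hδ m])
  have hmc : ∀ m : ℕ, ((m + 1 : ℕ) : ℝ) * ((T m).card * δ m) ≤ 1 / ((m : ℝ) + 1) := by
    intro m
    calc ((m + 1 : ℕ) : ℝ) * ((T m).card * δ m) ≤ (m + 1 : ℕ) * (1 / ((m + 1 : ℕ) : ℝ) ^ 2) := by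
          gcongr; exact hcard m
      _ = 1 / ((m : ℝ) + 1) := by push_cast; field_simp
  have hdiv : ∀ {u : ℂ}, 0 ≤ u.re → ‖u / (1 + u)‖ ≤ ‖u‖ := fun {u} hu => by
    rw [norm_div]; exact div_le_self (norm_nonneg _) (one_le_norm_one_add hu)
  have hone : ∀ {u : ℂ}, 0 ≤ u.re → u / (1 + u) - 1 = -(1 + u)⁻¹ := fun {u} hu => by
    have := one_add_ne_zero_of_re_nonneg hu
    field_simp; ring
  refine ⟨fun m z => H m z / (1 + H m z), fun m => ⟨1 + δ m, by linarith [hδ m], ?_⟩,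
    fun m θ => ?_, ?_, fun θ => ?_⟩
  · refine differentiableOn_poleSum.fun_div (differentiableOn_poleSum.const_add 1) fun z hz => ?_
    exact one_add_ne_zero_of_re_nonneg (hre m z (mem_ball_zero_iff.1 hz).le)
  · have h1 := hone (hpt m θ)
    have h2 : H m (pt θ) / (1 + H m (pt θ)) = 1 + -(1 + H m (pt θ))⁻¹ := by rw [← h1]; ring
    simp only [h2]
    refine (norm_add_le _ _).trans ?_
    rw [norm_neg, norm_inv, norm_one]
    linarith [inv_le_one_of_one_le₀ (one_le_norm_one_add (hpt m θ))]
  · refine squeeze_zero_norm (fun m => (hdiv (hz0 m)).trans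
      ((norm_poleSum_zero_le (by positivity) (hδ m).le).trans (hmc m))) ?_
    exact tendsto_one_div_add_atTop_nhds_zero_nat
  · by_cases hθ : θ ∈ N
    · rw [Set.indicator_of_mem hθ, tendsto_iff_norm_sub_tendsto_zero]
      refine squeeze_zero (fun _ => norm_nonneg _) (g := fun m : ℕ => 4 * (1 / ((m : ℝ) + 1)))
        (fun m => ?_) ?_
      · rw [hone (hpt m θ), norm_neg, norm_inv]
        obtain ⟨x, hx, hxd⟩ := hcov m θ hθ
        have h1 : ((m + 1 : ℕ) : ℝ) / 4 ≤ (H m (pt θ)).re :=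
          le_re_poleSum (by positivity) (hδ m) hx hxd
        have h2 : ((m : ℝ) + 1) / 4 ≤ ‖1 + H m (pt θ)‖ := by
          refine le_trans ?_ (Complex.re_le_norm _)
          rw [Complex.add_re, Complex.one_re]
          push_cast at h1
          linarith
        refine (inv_anti₀ (by positivity) h2).trans (le_of_eq ?_)
        rw [inv_div, mul_one_div]
      · simpa using tendsto_one_div_add_atTop_nhds_zero_nat (𝕜 := ℝ).const_mul 4
    · rw [Set.indicator_of_notMem hθ]
      obtain ⟨d, hd, hdN⟩ : ∃ d > 0, ∀ x ∈ N, d ≤ ‖pt θ - pt x‖ := by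
        rcases N.eq_empty_or_nonempty with rfl | hne
        · exact ⟨1, one_pos, by simp⟩
        · obtain ⟨x, hx, hmin⟩ := hN.exists_isMinOn hne
            (f := fun x => ‖pt θ - pt x‖) (by have := continuous_pt; fun_prop)
          refine ⟨‖pt θ - pt x‖, norm_pos_iff.2 (sub_ne_zero.2 fun h => hθ ?_), fun y hy => hmin hy⟩
          rwa [AddCircle.injective_toCircle Real.two_pi_pos.ne' (Subtype.coe_injective h)]
      refine squeeze_zero_norm (fun m => (hdiv (hpt m θ)).trans
        ((norm_poleSum_le (by positivity) (hδ m).le hd fun x hx => hdN x (hTN m x hx)).trans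
          (div_le_div_of_nonneg_right (hmc m) hd.le))) ?_
      simpa using (tendsto_one_div_add_atTop_nhds_zero_nat (𝕜 := ℝ)).div_const d

/-! ### Absolute continuity when `F_n → 0` -/

/-- A function analytic past the closed unit disc is a uniform limit of polynomials on it. -/
theorem exists_polynomial_norm_sub_le {G : ℂ → ℂ} {R : ℝ} (hR : 1 < R)
    (hG : DifferentiableOn ℂ G (Metric.ball 0 R)) {ε : ℝ} (hε : 0 < ε) :
    ∃ g : ℂ[X], ∀ z : ℂ, ‖z‖ ≤ 1 → ‖G z - g.eval z‖ ≤ ε := by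
  obtain ⟨r, h1r, hrR⟩ := exists_between hR
  obtain ⟨r', h1r', hr'r⟩ := exists_between h1r
  lift r to NNReal using by linarith
  lift r' to NNReal using by linarith
  have hps := (hG.mono (Metric.closedBall_subset_ball hrR)).hasFPowerSeriesOnBall
    (by exact_mod_cast zero_lt_one.trans h1r)
  have hlim := hps.tendstoUniformlyOn (r' := r') (by exact_mod_cast hr'r)
  rw [Metric.tendstoUniformlyOn_iff] at hlim
  obtain ⟨n, hn⟩ := (hlim ε hε).exists
  refine ⟨∑ k ∈ Finset.range n, C ((cauchyPowerSeries G 0 r).coeff k) * X ^ k, fun z hz => ?_⟩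
  have := hn z (mem_ball_zero_iff.2 (hz.trans_lt h1r'))
  rw [zero_add, dist_eq_norm] at this
  have e : eval z (∑ k ∈ Finset.range n, C ((cauchyPowerSeries G 0 r).coeff k) * X ^ k) =
      (cauchyPowerSeries G 0 r).partialSum n z := by
    rw [eval_finsetSum, FormalMultilinearSeries.partialSum]
    refine Finset.sum_congr rfl fun k _ => ?_
    rw [FormalMultilinearSeries.apply_eq_pow_smul_coeff, smul_eq_mul, eval_mul, eval_C, eval_pow,
      eval_X, mul_comm]
  rw [e]
  exact this.le

theorem tendsto_zero_of_forall_norm_le {x : ℕ → ℂ}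
    (h : ∀ ε > 0, ∃ y : ℕ → ℂ, Tendsto y atTop (𝓝 0) ∧ ∀ n, ‖x n‖ ≤ ‖y n‖ + ε) :
    Tendsto x atTop (𝓝 0) := by
  rw [Metric.tendsto_nhds]
  intro ε hε
  obtain ⟨y, hy, hxy⟩ := h (ε / 2) (half_pos hε)
  filter_upwards [Metric.tendsto_nhds.1 hy (ε / 2) (half_pos hε)] with n hn
  rw [dist_zero_right] at hn ⊢
  linarith [hxy n]

section annihilation

variable {μ : ComplexMeasure Torus} {u : ℕ → Torus → ℂ} {e : Torus → ℂ} {K : ℝ}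

/-- If all positive powers of `e` are asymptotically annihilated by `u_n dμ`, so is every function
analytic past the closed unit disc and vanishing at the origin, composed with `e`. -/
theorem tendsto_cint_analytic (hu : ∀ n, Continuous (u n)) (hK : ∀ n θ, ‖u n θ‖ ≤ K)
    (he : Continuous e) (he1 : ∀ θ, ‖e θ‖ = 1)
    (h : ∀ j : ℕ, Tendsto (fun n => cint μ (fun θ => e θ ^ (j + 1) * u n θ)) atTop (𝓝 0))
    {G : ℂ → ℂ} {R : ℝ} (hR : 1 < R) (hG : DifferentiableOn ℂ G (Metric.ball 0 R)) :
    Tendsto (fun n => cint μ (fun θ => (G (e θ) - G 0) * u n θ)) atTop (𝓝 0) := by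
  have hpoly : ∀ q : ℂ[X],
      Tendsto (fun n => cint μ (fun θ => e θ * q.eval (e θ) * u n θ)) atTop (𝓝 0) := by
    intro q
    induction q using Polynomial.induction_on' with
    | add p q hp hq =>
      have := hp.add hq
      rw [add_zero] at this
      refine this.congr fun n => ?_
      rw [← cint_add (integrable_of_continuous (by have := hu n; fun_prop))
        (integrable_of_continuous (by have := hu n; fun_prop))]
      congr 1
      ext θ
      rw [eval_add]; ring
    | monomial k c =>
      have := (h k).const_mul c
      rw [mul_zero] at this
      refine this.congr fun n => ?_
      rw [← cint_const_mul (integrable_of_continuous (by have := hu n; fun_prop))]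
      congr 1
      ext θ
      rw [eval_monomial]; ring
  have hGe : Continuous fun θ => G (e θ) := by
    refine hG.continuousOn.comp_continuous he fun θ => ?_
    rw [mem_ball_zero_iff, he1]; exact hR
  have hK0 : 0 ≤ K := (norm_nonneg _).trans (hK 0 0)
  set V := μ.variation.real Set.univ with hV
  have hV0 : 0 ≤ V := measureReal_nonneg
  refine tendsto_zero_of_forall_norm_le fun ε hε => ?_
  have hε' : 0 < ε / (2 * K * V + 1) := by positivity
  obtain ⟨g, hg⟩ := exists_polynomial_norm_sub_le hR hG hε'
  refine ⟨_, hpoly g.divX, fun n => ?_⟩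
  have e1 : ∀ z : ℂ, z * g.divX.eval z = g.eval z - g.eval 0 := by
    intro z
    have := congrArg (eval z) g.divX_mul_X_add
    rw [eval_add, eval_mul, eval_X, eval_C] at this
    rw [← coeff_zero_eq_eval_zero, ← this]; ring
  have e2 : cint μ (fun θ => (G (e θ) - G 0) * u n θ) =
      cint μ (fun θ => e θ * g.divX.eval (e θ) * u n θ) +
        cint μ (fun θ => ((G (e θ) - g.eval (e θ)) - (G 0 - g.eval 0)) * u n θ) := by
    have c : Continuous fun θ => ((G (e θ) - g.eval (e θ)) - (G 0 - g.eval 0)) * u n θ :=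
      ((hGe.sub (g.continuous.comp he)).sub continuous_const).mul (hu n)
    rw [← cint_add (integrable_of_continuous (by have := hu n; fun_prop))
      (integrable_of_continuous c)]
    congr 1
    ext θ
    rw [e1]; ring
  rw [e2]
  refine (norm_add_le _ _).trans (add_le_add le_rfl ?_)
  refine (norm_cint_le_of_norm_le (C := 2 * (ε / (2 * K * V + 1)) * K) fun θ => ?_).trans ?_
  · rw [norm_mul]
    refine mul_le_mul ((norm_sub_le _ _).trans ?_) (hK n θ) (norm_nonneg _) (by positivity)
    linarith [hg (e θ) (he1 θ).le, hg 0 (by simp)]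
  · calc 2 * (ε / (2 * K * V + 1)) * K * V = ε * ((2 * K * V) / (2 * K * V + 1)) := by ring
      _ ≤ ε * 1 := by
        gcongr
        exact (div_le_one (by positivity)).2 (by linarith)
      _ = ε := mul_one ε

/-- If the powers of `e` are asymptotically annihilated by `u_n dμ`, then `u_n dμ` asymptotically
gives no mass to a set that carries peak functions. -/
theorem tendsto_cint_indicator (hu : ∀ n, Continuous (u n)) (hK : ∀ n θ, ‖u n θ‖ ≤ K)
    (he : Continuous e) (he1 : ∀ θ, ‖e θ‖ = 1)
    (h : ∀ j : ℕ, Tendsto (fun n => cint μ (fun θ => e θ ^ (j + 1) * u n θ)) atTop (𝓝 0))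
    {N : Set Torus} (hN : MeasurableSet N) {G : ℕ → ℂ → ℂ}
    (hG : ∀ m, ∃ R > 1, DifferentiableOn ℂ (G m) (Metric.ball 0 R))
    (hG2 : ∀ m θ, ‖G m (e θ)‖ ≤ 2) (hG0 : Tendsto (fun m => G m 0) atTop (𝓝 0))
    (hGN : ∀ θ, Tendsto (fun m => G m (e θ)) atTop (𝓝 (N.indicator (fun _ => 1) θ))) :
    Tendsto (fun n => cint μ (N.indicator (u n))) atTop (𝓝 0) := by
  have hK0 : 0 ≤ K := (norm_nonneg _).trans (hK 0 0)
  set V := μ.variation.real Set.univ with hV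
  have hV0 : 0 ≤ V := measureReal_nonneg
  have hGe : ∀ m, Continuous fun θ => G m (e θ) := by
    intro m
    obtain ⟨R, hR, hd⟩ := hG m
    refine hd.continuousOn.comp_continuous he fun θ => ?_
    rw [mem_ball_zero_iff, he1]; exact hR
  have hind : ∀ θ, ‖N.indicator (fun _ => (1 : ℂ)) θ‖ ≤ 1 := fun θ =>
    (norm_indicator_le_norm_self _ _).trans norm_one.le
  have hindm : Measurable (N.indicator fun _ => (1 : ℂ)) := measurable_const.indicator hN
  have hdiff : ∀ m θ, ‖N.indicator (fun _ => (1 : ℂ)) θ - G m (e θ)‖ ≤ 3 := fun m θ =>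
    (norm_sub_le _ _).trans (by linarith [hind θ, hG2 m θ])
  have hI : Tendsto (fun m => ∫ θ, ‖N.indicator (fun _ => (1 : ℂ)) θ - G m (e θ)‖ ∂μ.variation)
      atTop (𝓝 0) := by
    rw [← integral_zero Torus ℝ (μ := μ.variation)]
    refine tendsto_integral_of_dominated_convergence (fun _ => 3)
      (fun m => (hindm.sub (hGe m).measurable).norm.aestronglyMeasurable) (integrable_const _)
      (fun m => Eventually.of_forall fun θ => ?_) (Eventually.of_forall fun θ => ?_)
    · rw [norm_norm]; exact hdiff m θ
    · simpa using ((hGN θ).const_sub (N.indicator (fun _ => (1 : ℂ)) θ)).norm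
  have hA : Tendsto (fun m => K *
      (∫ θ, ‖N.indicator (fun _ => (1 : ℂ)) θ - G m (e θ)‖ ∂μ.variation) + ‖G m 0‖ * (K * V))
      atTop (𝓝 0) := by
    simpa using (hI.const_mul K).add (hG0.norm.mul_const (K * V))
  refine tendsto_zero_of_forall_norm_le fun ε hε => ?_
  obtain ⟨m, hm⟩ := (hA.eventually_lt_const hε).exists
  obtain ⟨R, hR, hd⟩ := hG m
  refine ⟨_, tendsto_cint_analytic hu hK he he1 h hR hd, fun n => ?_⟩
  have i1 : Integrable (fun θ => (N.indicator (fun _ => (1 : ℂ)) θ - G m (e θ)) * u n θ)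
      μ.variation := by
    refine integrable_of_measurable_of_norm_le
      ((hindm.sub (hGe m).measurable).mul (hu n).measurable) (C := 3 * K) fun θ => ?_
    rw [norm_mul]
    exact mul_le_mul (hdiff m θ) (hK n θ) (norm_nonneg _) (by norm_num)
  have i2 : Integrable (fun θ => (G m (e θ) - G m 0) * u n θ) μ.variation :=
    integrable_of_continuous (((hGe m).sub continuous_const).mul (hu n))
  have i3 : Integrable (u n) μ.variation := integrable_of_continuous (hu n)
  have i4 : Integrable (fun θ => G m 0 * u n θ) μ.variation := i3.const_mul _
  have i5 : Integrable (fun θ => (N.indicator (fun _ => (1 : ℂ)) θ - G m (e θ)) * u n θ +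
      G m 0 * u n θ) μ.variation := i1.add i4
  have e1 : cint μ (N.indicator (u n)) = cint μ (fun θ => (G m (e θ) - G m 0) * u n θ) +
      (cint μ (fun θ => (N.indicator (fun _ => (1 : ℂ)) θ - G m (e θ)) * u n θ) +
        G m 0 * cint μ (u n)) := by
    rw [← cint_const_mul i3, ← cint_add i1 i4, ← cint_add i2 i5]
    congr 1
    ext θ
    by_cases hθ : θ ∈ N
    · simp only [Set.indicator_of_mem hθ]; ring
    · simp only [Set.indicator_of_notMem hθ]; ring
  rw [e1]
  refine (norm_add_le _ _).trans (add_le_add le_rfl (le_trans ?_ hm.le))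
  refine (norm_add_le _ _).trans (add_le_add ?_ ?_)
  · refine norm_cint_le.trans ?_
    rw [← integral_const_mul]
    refine integral_mono i1.norm ?_ fun θ => ?_
    · exact (integrable_of_measurable_of_norm_le (hindm.sub (hGe m).measurable)
        (hdiff m)).norm.const_mul K
    · rw [norm_mul, mul_comm]
      exact mul_le_mul_of_nonneg_right (hK n θ) (norm_nonneg _)
  · rw [norm_mul]
    exact mul_le_mul_of_nonneg_left (norm_cint_le_of_norm_le (hK n)) (norm_nonneg _)

end annihilation

/-- If `R_{n+1}` is close to `z R_n` for large `n`, then `R_{n+j}` is close to `z^j R_n`. -/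
theorem exists_norm_add_sub_le {R : ℕ → ℂ[X]} {c : ℕ → ℝ} (hc : Tendsto c atTop (𝓝 0))
    (h : ∀ n θ, ‖onCircle (R (n + 1)) θ - pt θ * onCircle (R n) θ‖ ≤ c n) (j : ℕ) :
    ∃ b : ℕ → ℝ, Tendsto b atTop (𝓝 0) ∧
      ∀ n θ, ‖onCircle (R (n + j)) θ - pt θ ^ j * onCircle (R n) θ‖ ≤ b n := by
  induction j with
  | zero => exact ⟨0, tendsto_const_nhds, fun n θ => by simp⟩
  | succ j ih =>
    obtain ⟨b, hb, hle⟩ := ih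
    refine ⟨fun n => c (n + j) + b n, ?_, fun n θ => ?_⟩
    · simpa using (hc.comp (tendsto_add_atTop_nat j)).add hb
    · have e : onCircle (R (n + (j + 1))) θ - pt θ ^ (j + 1) * onCircle (R n) θ =
          (onCircle (R (n + j + 1)) θ - pt θ * onCircle (R (n + j)) θ) +
            pt θ * (onCircle (R (n + j)) θ - pt θ ^ j * onCircle (R n) θ) := by
        rw [← add_assoc]; ring
      rw [e]
      refine (norm_add_le _ _).trans (add_le_add (h _ θ) ?_)
      rw [norm_mul, norm_pt, one_mul]; exact hle n θ

/-- A complex measure that vanishes on the compact null sets has no singular part. -/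
theorem singularPart_eq_zero {μ : ComplexMeasure Torus}
    (h : ∀ N : Set Torus, IsCompact N → arc N = 0 → μ N = 0) : μ.singularPart arc = 0 := by
  have hnull : ∀ B : Set Torus, MeasurableSet B → arc B = 0 → μ B = 0 := by
    intro B hB hB0
    refine norm_eq_zero.1 (le_antisymm (le_of_forall_pos_le_add fun ε hε => ?_) (norm_nonneg _))
    obtain ⟨N, hNB, hN, hlt⟩ := hB.exists_isCompact_sdiff_lt (μ := μ.variation)
      (measure_ne_top _ _) (ENNReal.ofReal_pos.2 hε).ne'
    have h1 : μ B = μ (B \ N) := by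
      have := VectorMeasure.of_add_of_sdiff (v := μ) hN.measurableSet hB hNB
      rw [h N hN (measure_mono_null hNB hB0), zero_add] at this
      exact this.symm
    rw [h1, zero_add]
    have h2 := VectorMeasure.enorm_measure_le_variation μ (B \ N)
    rw [← ofReal_norm] at h2
    exact (ENNReal.ofReal_le_ofReal_iff hε.le).1 (h2.trans hlt.le)
  obtain ⟨S, hS, hS0, hcarr⟩ := exists_null_carrier_singularPart μ arc
  ext B hB
  have h1 : μ.singularPart arc B = μ.singularPart arc (B ∩ S) := by
    have := VectorMeasure.of_add_of_sdiff (v := μ.singularPart arc) (hB.inter hS) hB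
      Set.inter_subset_left
    rw [hcarr (B \ (B ∩ S)) (hB.diff (hB.inter hS))
      (by rw [Set.sdiff_self_inter]; exact Set.disjoint_sdiff_left), add_zero] at this
    exact this.symm
  have h0 : arc (B ∩ S) = 0 := measure_mono_null Set.inter_subset_right hS0
  have h2 := cint_eq_singularPart_add (f := (B ∩ S).indicator fun _ => 1) μ arc
    (ae_eq_refl _) (measurable_const.indicator (hB.inter hS)) (C := 1)
    (fun θ => (norm_indicator_le_norm_self _ _).trans norm_one.le)
  rw [cint_indicator_const (hB.inter hS), cint_indicator_const (hB.inter hS), one_mul, one_mul,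
    hnull _ (hB.inter hS) h0] at h2
  have h3 : ∫ θ, (B ∩ S).indicator (fun _ => (1 : ℂ)) θ * μ.rnDeriv arc θ ∂arc = 0 := by
    refine integral_eq_zero_of_ae ?_
    filter_upwards [measure_eq_zero_iff_ae_notMem.1 h0] with θ hθ
    rw [Set.indicator_of_notMem hθ, zero_mul]; rfl
  rw [h1]
  rw [h3, add_zero] at h2
  exact h2.symm

namespace OPSystem

variable {μ : ComplexMeasure Torus} {F : ℕ → ℂ} {P Q : ℕ → ℂ[X]}

/-- Since `z^j φ_n` is close to `φ_{n+j}`, which is left orthogonal to `φ_n`, the moments of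
`|φ_n|² dμ` of positive order tend to zero. -/
theorem tendsto_cint_pow_mul_left (h : OPSystem μ F P Q)
    (hF : Tendsto (fun n => ‖F n‖) atTop (𝓝 0)) (j : ℕ) :
    Tendsto (fun n => cint μ (fun θ => pt θ ^ (j + 1) *
      (onCircle (P n) θ * conj (onCircle (P n) θ)))) atTop (𝓝 0) := by
  have hc : Tendsto (fun n => 4 * ‖F (n + 1)‖) atTop (𝓝 0) := by
    simpa using (hF.comp (tendsto_add_atTop_nat 1)).const_mul 4
  obtain ⟨b, hb, hle⟩ := exists_norm_add_sub_le hc h.norm_left_succ_sub_le (j + 1)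
  have hlim := (hb.mul_const 2).mul_const (μ.variation.real Set.univ)
  rw [zero_mul, zero_mul] at hlim
  refine squeeze_zero_norm (fun n => ?_) hlim
  have horth : cint μ (fun θ => onCircle (P (n + (j + 1))) θ * conj (onCircle (P n) θ)) = 0 := by
    rw [← pairing_eq]
    refine h.orth_left _ _ ?_
    rw [h.degree_left]
    exact_mod_cast Nat.lt_add_of_pos_right j.succ_pos
  have c1 := continuous_onCircle_mul_conj (P (n + (j + 1))) (P n)
  have c2 := continuous_onCircle_mul_conj (P n) (P n)
  have c3 := continuous_pt
  rw [← norm_neg, ← zero_sub, ← horth, ← cint_sub (integrable_of_continuous c1)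
    (integrable_of_continuous (by fun_prop))]
  refine norm_cint_le_of_norm_le fun θ => ?_
  rw [← mul_assoc, ← sub_mul, norm_mul, RCLike.norm_conj]
  exact mul_le_mul (hle n θ) (h.norm_left_le n θ) (norm_nonneg _)
    ((norm_nonneg _).trans (hle n θ))

/-- Likewise the moments of `|φ̃_n|² dμ` of negative order tend to zero. -/
theorem tendsto_cint_conj_pow_mul_right (h : OPSystem μ F P Q)
    (hF : Tendsto (fun n => ‖F n‖) atTop (𝓝 0)) (j : ℕ) :
    Tendsto (fun n => cint μ (fun θ => conj (pt θ) ^ (j + 1) *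
      (onCircle (Q n) θ * conj (onCircle (Q n) θ)))) atTop (𝓝 0) := by
  have hc : Tendsto (fun n => 4 * ‖F (n + 1)‖) atTop (𝓝 0) := by
    simpa using (hF.comp (tendsto_add_atTop_nat 1)).const_mul 4
  obtain ⟨b, hb, hle⟩ := exists_norm_add_sub_le hc h.norm_right_succ_sub_le (j + 1)
  have hlim := (hb.mul_const 2).mul_const (μ.variation.real Set.univ)
  rw [zero_mul, zero_mul] at hlim
  refine squeeze_zero_norm (fun n => ?_) hlim
  have horth : cint μ (fun θ => onCircle (Q n) θ * conj (onCircle (Q (n + (j + 1))) θ)) = 0 := by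
    rw [← pairing_eq]
    refine h.orth_right _ _ ?_
    rw [h.degree_right]
    exact_mod_cast Nat.lt_add_of_pos_right j.succ_pos
  have c1 := continuous_onCircle_mul_conj (Q n) (Q (n + (j + 1)))
  have c2 := continuous_onCircle_mul_conj (Q n) (Q n)
  have c3 : Continuous fun θ => conj (pt θ) ^ (j + 1) *
      (onCircle (Q n) θ * conj (onCircle (Q n) θ)) :=
    ((Complex.continuous_conj.comp continuous_pt).pow (j + 1)).mul c2
  rw [← norm_neg, ← zero_sub, ← horth, ← cint_sub (integrable_of_continuous c1)
    (integrable_of_continuous c3)]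
  refine norm_cint_le_of_norm_le fun θ => ?_
  have e : onCircle (Q n) θ * conj (onCircle (Q (n + (j + 1))) θ) -
      conj (pt θ) ^ (j + 1) * (onCircle (Q n) θ * conj (onCircle (Q n) θ)) =
      conj (onCircle (Q (n + (j + 1))) θ - pt θ ^ (j + 1) * onCircle (Q n) θ) *
        onCircle (Q n) θ := by
    rw [map_sub, map_mul, map_pow]; ring
  rw [e, norm_mul, RCLike.norm_conj]
  exact mul_le_mul (hle n θ) (h.norm_right_le n θ) (norm_nonneg _)
    ((norm_nonneg _).trans (hle n θ))

/-- If `F_n → 0`, the measure has no singular part: `|φ_n|² dμ` is asymptotically of analytic type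
and `|φ̃_n|² dμ` asymptotically of anti-analytic type, so neither charges a compact null set, while
they add up to `2 dμ`. -/
theorem singularPart_eq_zero (h : OPSystem μ F P Q)
    (hF : Tendsto (fun n => ‖F n‖) atTop (𝓝 0)) : μ.singularPart arc = 0 := by
  refine OneSidedOP.singularPart_eq_zero fun N hN hN0 => ?_
  have hbound : ∀ {z : ℂ}, ‖z‖ ≤ 2 → ‖z * conj z‖ ≤ 4 := fun {z} hz => by
    rw [norm_mul, RCLike.norm_conj]; nlinarith [norm_nonneg z]
  obtain ⟨G, hG, hG2, hG0, hGN⟩ := exists_peak hN hN0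
  have hl := tendsto_cint_indicator (u := fun n θ => onCircle (P n) θ * conj (onCircle (P n) θ))
    (fun n => continuous_onCircle_mul_conj _ _) (fun n θ => hbound (h.norm_left_le n θ))
    continuous_pt norm_pt (h.tendsto_cint_pow_mul_left hF) hN.measurableSet hG hG2 hG0 hGN
  -- On the anti-analytic side, the peak functions of the reflected set are used.
  have hneg : ∀ θ : Torus, conj (pt θ) = pt (-θ) := fun θ => by
    rw [conj_pt, pt, pt, AddCircle.toCircle_neg, Circle.coe_inv]
  have hN0' : arc (-N) = 0 := by rw [Measure.measure_neg]; exact hN0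
  obtain ⟨G, hG, hG2, hG0, hGN⟩ := exists_peak hN.neg hN0'
  have hr := tendsto_cint_indicator (u := fun n θ => onCircle (Q n) θ * conj (onCircle (Q n) θ))
    (e := fun θ => conj (pt θ))
    (fun n => continuous_onCircle_mul_conj _ _) (fun n θ => hbound (h.norm_right_le n θ))
    (Complex.continuous_conj.comp continuous_pt) (fun θ => by rw [RCLike.norm_conj, norm_pt])
    (h.tendsto_cint_conj_pow_mul_right hF) hN.measurableSet hG
    (fun m θ => by rw [hneg]; exact hG2 m _) hG0 fun θ => by
      have := hGN (-θ)
      have e : (-N).indicator (fun _ => (1 : ℂ)) (-θ) = N.indicator (fun _ => 1) θ := by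
        by_cases hθ : θ ∈ N
        · rw [Set.indicator_of_mem hθ, Set.indicator_of_mem (Set.neg_mem_neg.2 hθ)]
        · rw [Set.indicator_of_notMem hθ, Set.indicator_of_notMem fun h => hθ (Set.neg_mem_neg.1 h)]
      rwa [← hneg, e] at this
  have hsum : ∀ n, cint μ (N.indicator fun θ => onCircle (P n) θ * conj (onCircle (P n) θ)) +
      cint μ (N.indicator fun θ => onCircle (Q n) θ * conj (onCircle (Q n) θ)) = 2 * μ N := by
    intro n
    rw [← cint_indicator_const hN.measurableSet, ← cint_add]
    · congr 1
      ext θ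
      by_cases hθ : θ ∈ N
      · simp only [Set.indicator_of_mem hθ]
        rw [← norm_sq_eq, ← norm_sq_eq, ← Complex.ofReal_add, h.norm_sq_add_norm_sq,
          Complex.ofReal_ofNat]
      · simp only [Set.indicator_of_notMem hθ, add_zero]
    · exact (integrable_of_continuous (continuous_onCircle_mul_conj _ _)).indicator hN.measurableSet
    · exact (integrable_of_continuous (continuous_onCircle_mul_conj _ _)).indicator hN.measurableSet
  have h2 := hl.add hr
  simp only [hsum, add_zero] at h2
  simpa using tendsto_nhds_unique tendsto_const_nhds h2

end OPSystem

/-! ### Almost everywhere convergence along a subsequence -/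

/-- Continuity of translations in `L¹`. -/
theorem tendsto_eLpNorm_translate {f : Torus → ℂ} (hf : Integrable f arc) {τ : ℕ → Torus}
    (hτ : Tendsto τ atTop (𝓝 0)) :
    Tendsto (fun n => eLpNorm (fun θ => f (τ n + θ) - f θ) 1 arc) atTop (𝓝 0) := by
  have : Fact ((1 : ENNReal) ≠ ⊤) := ⟨ENNReal.one_ne_top⟩
  have hf1 : MemLp f 1 arc := memLp_one_iff_integrable.2 hf
  have hcomp : ∀ c : Torus, MemLp (fun θ => f (c + θ)) 1 arc := fun c =>
    hf1.comp_measurePreserving (measurePreserving_add_left arc c)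
  have h1 : Tendsto (fun n => (hcomp (τ n)).toLp) atTop (𝓝 hf1.toLp) := by
    have h2 : Continuous fun c : Torus => DomAddAct.mk c +ᵥ hf1.toLp := by
      have : Continuous (DomAddAct.mk : Torus → Torusᵈᵃᵃ) := DomAddAct.continuous_mk
      fun_prop
    have h3 := (h2.tendsto 0).comp hτ
    have h4 : DomAddAct.mk (0 : Torus) +ᵥ hf1.toLp = hf1.toLp := by
      rw [DomAddAct.mk_zero, zero_vadd]
    rw [h4] at h3
    refine h3.congr fun n => ?_
    exact DomAddAct.mk_vadd_toLp (τ n) hf1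
  exact (Lp.tendsto_Lp_iff_tendsto_eLpNorm'' (fun n θ => f (τ n + θ)) (fun n => hcomp (τ n)) _
    hf1).1 h1

/-- Along a subsequence, `L¹`-convergence yields convergence almost everywhere, at the points
themselves and at their translates by `π / n`. -/
theorem exists_seq_tendsto_ae_nearPt {f : ℕ → Torus → ℂ} {g : Torus → ℂ}
    (hf : ∀ n, Continuous (f n)) (hg : AEStronglyMeasurable g arc)
    (h : Tendsto (fun n => ∫⁻ θ, ‖f n θ - g θ‖ₑ ∂arc) atTop (𝓝 0)) :
    ∃ m : ℕ → ℕ, Tendsto m atTop atTop ∧ ∀ᵐ θ ∂arc,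
      Tendsto (fun k => f (m k) θ) atTop (𝓝 (g θ)) ∧
      Tendsto (fun k => f (m k) (nearPt θ Real.pi (m k))) atTop (𝓝 (g θ)) := by
  have h1 : Tendsto (fun n => eLpNorm (f n - g) 1 arc) atTop (𝓝 0) := by
    simpa only [eLpNorm_one_eq_lintegral_enorm, Pi.sub_apply] using h
  have hgint : Integrable g arc := by
    obtain ⟨n, hn⟩ := (h1.eventually_lt_const ENNReal.zero_lt_top).exists
    have h2 : Integrable (f n - g) arc := memLp_one_iff_integrable.1
      ⟨(hf n).aestronglyMeasurable.sub hg, hn⟩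
    have := (integrable_of_continuous (ν := arc) (hf n)).sub h2
    rwa [sub_sub_cancel] at this
  set τ : ℕ → Torus := fun n => ((Real.pi / n : ℝ) : Torus) with hτ
  have hτ0 : Tendsto τ atTop (𝓝 0) := by
    have h2 : Continuous fun x : ℝ => (x : Torus) := AddCircle.continuous_mk' _
    exact (h2.tendsto' 0 0 rfl).comp (tendsto_const_div_atTop_nhds_zero_nat Real.pi)
  have hmp : ∀ n, MeasurePreserving (fun θ => τ n + θ) arc arc := fun n =>
    measurePreserving_add_left arc (τ n)
  have hfτ : ∀ n, Continuous fun θ => f n (τ n + θ) := fun n => (hf n).comp (by fun_prop)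
  have h2 : Tendsto (fun n => eLpNorm ((fun θ => f n (τ n + θ)) - g) 1 arc) atTop (𝓝 0) := by
    have h3 := h1.add (tendsto_eLpNorm_translate hgint hτ0)
    rw [add_zero] at h3
    refine tendsto_of_tendsto_of_tendsto_of_le_of_le tendsto_const_nhds h3 (fun _ => bot_le)
      fun n => ?_
    have e : (fun θ => f n (τ n + θ)) - g =
        (f n - g) ∘ (fun θ => τ n + θ) + fun θ => g (τ n + θ) - g θ := by
      ext θ; simp
    have hgτ : AEStronglyMeasurable (g ∘ fun θ => τ n + θ) arc :=
      hg.comp_measurePreserving (hmp n)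
    rw [e]
    refine (eLpNorm_add_le ?_ (hgτ.sub hg) le_rfl).trans (add_le_add (le_of_eq ?_) le_rfl)
    · exact ((hf n).aestronglyMeasurable.sub hg).comp_measurePreserving (hmp n)
    · exact eLpNorm_comp_measurePreserving ((hf n).aestronglyMeasurable.sub hg) (hmp n)
  obtain ⟨m₁, hm₁, hae₁⟩ := (tendstoInMeasure_of_tendsto_eLpNorm one_ne_zero
    (fun n => (hf n).aestronglyMeasurable) hg h1).exists_seq_tendsto_ae
  obtain ⟨m₂, hm₂, hae₂⟩ := (tendstoInMeasure_of_tendsto_eLpNorm one_ne_zero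
    (fun k => (hfτ (m₁ k)).aestronglyMeasurable) hg
    (h2.comp hm₁.tendsto_atTop)).exists_seq_tendsto_ae
  refine ⟨fun k => m₁ (m₂ k), hm₁.tendsto_atTop.comp hm₂.tendsto_atTop, ?_⟩
  filter_upwards [hae₁, hae₂] with θ hθ₁ hθ₂
  refine ⟨hθ₁.comp hm₂.tendsto_atTop, hθ₂.congr fun k => ?_⟩
  rw [nearPt, add_comm]

/-- In the absence of a singular part, `E(μ)` has full measure by the Lebesgue differentiation
theorem. -/
theorem ae_mem_setE {μ : ComplexMeasure Torus} {w : Torus → ℂ} (hw : w =ᵐ[arc] μ.rnDeriv arc)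
    (hμ : μ.singularPart arc = 0) : ∀ᵐ s ∂arc, s ∈ setE μ w := by
  have hint : Integrable w (volume : Measure Torus) := by
    rw [volume_eq]
    exact (integrable_of_ae_eq_rnDeriv hw).smul_measure ENNReal.ofReal_ne_top
  rw [← ae_volume_iff]
  filter_upwards [IsUnifLocDoublingMeasure.ae_tendsto_average_norm_sub
    (μ := (volume : Measure Torus)) hint.locallyIntegrable 1] with s hs
  refine ⟨?_, ?_⟩
  · rw [hμ]; simp
  · have := hs (ι := ℝ) (l := 𝓝[>] 0) (fun _ => s) (fun r => r) tendsto_id ?_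
    · simpa only [setAverage_volume] using this
    · filter_upwards [self_mem_nhdsWithin] with r hr
      exact Metric.mem_closedBall_self (by rw [one_mul]; exact (Set.mem_Ioi.1 hr).le)

/-! ### The functions `φ_n^* φ̃_n` and the parameters `A_{n,s}`, `B_{n,s}` -/

theorem phiProd_eq (μ : ComplexMeasure Torus) (n : ℕ) (s : Torus) :
    phiProd μ n s = conj (onCircle (normPhi μ n) s) * onCircle (normPhiT μ n) s := by
  rw [phiProd, starFn_pt, phi_eq, phiT_eq]; rfl

theorem localProd_normPhi (μ : ComplexMeasure Torus) (n : ℕ) (s : Torus) :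
    localProd (normPhi μ n) n s = pt s ^ n * (paramA μ n s * paramB μ n s) := by
  have := pow_ne_zero n (pt_ne_zero s)
  rw [localProd, paramA, paramB, phi_eq, phi_eq, onCircle, onCircle, pt_nearPt_pi]
  field_simp
  ring

theorem tendsto_localProd_iff {μ : ComplexMeasure Torus} {s : Torus} {m : ℕ → ℕ} :
    Tendsto (fun k => localProd (normPhi μ (m k)) (m k) s) atTop (𝓝 0) ↔
      Tendsto (fun k => paramA μ (m k) s * paramB μ (m k) s) atTop (𝓝 0) := by
  rw [tendsto_zero_iff_norm_tendsto_zero, tendsto_zero_iff_norm_tendsto_zero (f := fun k =>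
    paramA μ (m k) s * paramB μ (m k) s)]
  simp only [localProd_normPhi, norm_mul, norm_pow, norm_pt, one_pow, one_mul]

end OneSidedOP

end

theorem theorem2 (μ : ComplexMeasure OneSidedOP.Torus) (hμ : OneSidedOP.ClassTMinus μ)
    (w : OneSidedOP.Torus → ℂ) (hw : w =ᵐ[OneSidedOP.arc] μ.rnDeriv OneSidedOP.arc) :
    (∀ s ∈ OneSidedOP.setE μ w, ∀ n : ℕ → ℕ, StrictMono n →
      Tendsto (fun k => OneSidedOP.paramA μ (n k) s * OneSidedOP.paramB μ (n k) s) atTop (𝓝 0) →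
      Tendsto (fun k => OneSidedOP.phiProd μ (n k) s ^ 2) atTop (𝓝 (conj (w s ^ (-2 : ℤ))))) ∧
    (Tendsto (fun n => ‖OneSidedOP.coeffF μ n‖) atTop (𝓝 0) →
      Tendsto (fun n => ∫⁻ s, ‖OneSidedOP.phiProd μ n s - 1 / conj (w s)‖ₑ ∂OneSidedOP.arc)
        atTop (𝓝 0) →
      ∃ E₀ : Set OneSidedOP.Torus, E₀ ⊆ OneSidedOP.setE μ w ∧ OneSidedOP.arc E₀ᶜ = 0 ∧
        ∀ s ∈ E₀,
          Tendsto (fun n => OneSidedOP.phiProd μ n s ^ 2) atTop (𝓝 (conj (w s ^ (-2 : ℤ)))) →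
          Tendsto (fun n => OneSidedOP.phiProd μ n s) atTop (𝓝 (conj (w s)⁻¹)) ∧
          Tendsto (fun n => OneSidedOP.paramA μ n s * OneSidedOP.paramB μ n s) atTop (𝓝 0)) := by
  have h := OneSidedOP.opSystem hμ
  have hpow : ∀ s, conj (w s ^ (-2 : ℤ)) = conj (w s)⁻¹ ^ 2 := by
    intro s
    rw [← map_pow, zpow_neg, inv_pow]
    rfl
  simp only [hpow]
  refine ⟨fun s hs n hn hAB => ?_, fun hF hL => ?_⟩
  · simp only [OneSidedOP.phiProd_eq]
    exact h.tendsto_sq_of_tendsto_localProd hw hs hn.tendsto_atTop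
      (OneSidedOP.tendsto_localProd_iff.2 hAB)
  · have hcont : ∀ n, Continuous (OneSidedOP.phiProd μ n) := by
      intro n
      have e : OneSidedOP.phiProd μ n = fun s => OneSidedOP.onCircle (OneSidedOP.normPhiT μ n) s *
          conj (OneSidedOP.onCircle (OneSidedOP.normPhi μ n) s) := by
        ext s; rw [OneSidedOP.phiProd_eq, mul_comm]
      rw [e]
      exact OneSidedOP.continuous_onCircle_mul_conj _ _
    have hmeas : AEStronglyMeasurable (fun s => 1 / conj (w s)) OneSidedOP.arc := by
      have h1 := (OneSidedOP.integrable_of_ae_eq_rnDeriv hw).aestronglyMeasurable.aemeasurable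
      exact ((Complex.continuous_conj.measurable.comp_aemeasurable h1).const_div
        1).aestronglyMeasurable
    obtain ⟨m, hm, hae⟩ := OneSidedOP.exists_seq_tendsto_ae_nearPt hcont hmeas hL
    refine ⟨OneSidedOP.setE μ w ∩ _, Set.inter_subset_left,
      mem_ae_iff.1 (inter_mem (OneSidedOP.ae_mem_setE hw (h.singularPart_eq_zero hF)) hae), ?_⟩
    rintro s ⟨hs, h0, hpi⟩ hsq
    have e : 1 / conj (w s) = conj (w s)⁻¹ := by rw [map_inv₀, one_div]
    rw [e] at h0 hpi
    simp only [OneSidedOP.phiProd_eq] at h0 hpi hsq ⊢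
    obtain ⟨h1, h2⟩ := h.tendsto_of_tendsto_sq hw hs hF hm h0 hpi hsq
    exact ⟨h1, OneSidedOP.tendsto_localProd_iff (m := fun n => n).1 h2⟩
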